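/- For a finitely presented smooth morphism of schemes $g\colon Y\to S$, let $\pi_0(Y/S)$ denote the quotient, in the category of sheaves on the big étale site of schemes, of $Y$ by the equivalence relation which identifies $a,b\in Y(U)$ when $g\circ a=g\circ b$ and, for every geometric point $\bar u$ of $U$, the points $a(\bar u)$ and $b(\bar u)$ lie in the same connected component of the corresponding geometric fiber of $g$. (This is an algebraic space, étale over $S$.) Let $\pi\colon X\to S$ be a proper, flat, finitely presented morphism of schemes which is pure-dimensional, i.e., for every $s\in S$ all irreducible components of the fiber $X_s$ have the same dimension. Assume that for every $s\in S$ the smooth locus of the fiber $X_s$ (over the residue field $\kappa(s)$) is dense in $X_s$. Let $X^{\mathrm{sm}}\subset X$ denote the relative smooth locus of $\pi$. Then the morphism $\pi_0(X^{\mathrm{sm}}/S)\to S$ is universally closed. If, moreover, there is an integer $d\ge 0$ such that every geometric fiber of $\pi$ has exactly $d$ irreducible components, then $\pi_0(X^{\mathrm{sm}}/S)\to S$ is finite étale of degree $d$ (in particular, representable by a scheme). -/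

import Mathlib

open CategoryTheory Limits Opposite AlgebraicGeometry

universe u

noncomputable section

namespace ComponentsInFamilies

/-! ### Sheaves on the big étale site as spaces

A scheme or algebraic space is regarded as its functor of points on the category of schemes, with a
scheme `S` corresponding to `uliftYoneda.{u + 1}.obj S`. (The universe lift makes the associated
sheaf for the big étale site available.) -/

/-- The functors of points. -/
abbrev PSh : Type (u + 2) := Scheme.{u}ᵒᵖ ⥤ Type (u + 1)

/-- A field `K` together with a morphism `Spec K ⟶ F`. -/
structure FieldPoint (F : PSh.{u}) : Type (u + 1) where
  /-- the field -/
  K : Type u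
  [field : Field K]
  /-- the `K`-valued point -/
  pt : F.obj (op (Spec (.of K)))

attribute [instance] FieldPoint.field

/-- `Spec K ⟶ F` and `Spec L ⟶ F` determine the same point of `F` if they agree over a common
extension field of `K` and `L`. -/
def FieldPoint.Equiv {F : PSh.{u}} (p q : FieldPoint F) : Prop :=
  ∃ (M : Type u) (_ : Field M) (i : p.K →+* M) (j : q.K →+* M),
    F.map (Spec.map (CommRingCat.ofHom i)).op p.pt = F.map (Spec.map (CommRingCat.ofHom j)).op q.pt

/-- The set `|F|` of points of `F`. -/
def Points (F : PSh.{u}) : Type (u + 1) :=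
  Quot (FieldPoint.Equiv (F := F))

/-- The map `|U| → |F|` induced by a morphism from a scheme `U` to `F`, given as an element of
`F(U)`. -/
def Points.ofScheme {F : PSh.{u}} {U : Scheme.{u}} (ξ : F.obj (op U)) (x : U) : Points F :=
  Quot.mk _ { K := U.residueField x, pt := F.map (U.fromSpecResidueField x).op ξ }

/-- The topology of `|F|`: a subset is open if and only if its preimage in `|U|` is open for every
morphism `U ⟶ F` from a scheme. If `F` is an algebraic space then it suffices to test this on an
étale (or smooth) atlas, so this is the usual topology. -/
instance (F : PSh.{u}) : TopologicalSpace (Points F) :=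
  ⨆ (U : Scheme.{u}) (ξ : F.obj (op U)),
    TopologicalSpace.coinduced (Points.ofScheme ξ) inferInstance

/-- The map `|F| → |G|` induced by a morphism `F ⟶ G`. -/
def Points.map {F G : PSh.{u}} (φ : F ⟶ G) : Points F → Points G :=
  Quot.map (fun p => { K := p.K, pt := φ.app _ p.pt }) <| by
    rintro p q ⟨M, _, i, j, h⟩
    refine ⟨M, inferInstance, i, j, ?_⟩
    have h' := congrArg (φ.app (op (Spec (.of M)))) h
    simpa only [NatTrans.naturality_apply] using h'

/-- A morphism `F ⟶ G` is universally closed if `|F ×_G S'| → |S'|` is a closed map for every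
scheme `S'` and every morphism `S' ⟶ G`. -/
def IsUniversallyClosed {F G : PSh.{u}} (φ : F ⟶ G) : Prop :=
  ∀ (S' : Scheme.{u}) (g : uliftYoneda.{u + 1}.obj S' ⟶ G),
    IsClosedMap (Points.map (pullback.snd φ g))

/-- Finite étale morphisms of schemes of constant degree `d`. -/
def finiteEtaleOfDegree (d : ℕ) : MorphismProperty Scheme.{u} :=
  fun _ S f => IsFinite f ∧ Etale f ∧ ∀ s : S, f.finrank s = d

/-- A morphism `F ⟶ G` is finite étale of degree `d` if it is representable by schemes and its base
change to any scheme is a finite étale morphism of schemes of degree `d`. -/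
def IsFiniteEtaleOfDegree {F G : PSh.{u}} (φ : F ⟶ G) (d : ℕ) : Prop :=
  (finiteEtaleOfDegree.{u} d).relative uliftYoneda.{u + 1} φ

/-! ### The space of connected components of the fibers -/

/-- Given `f : X ⟶ S` and `x : Spec K ⟶ X` lying over `s : Spec K ⟶ S`, the corresponding point of
the geometric fiber `X ×_S Spec K`. -/
def fiberPoint {X S : Scheme.{u}} (f : X ⟶ S) {K : Type u} [Field K] (x : Spec (.of K) ⟶ X)
    (s : Spec (.of K) ⟶ S) (h : x ≫ f = s) : ↥(pullback f s) :=
  pullback.lift x (𝟙 _) (by simpa using h) (default : Spec (.of K))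

/-- Two morphisms `a b : U ⟶ X` are related if they have the same composite with `f : X ⟶ S` and if,
for every geometric point `t` of `U`, with image `s` in `S`, their values at `t` lie in the same
connected component of the geometric fiber `X ×_S Spec K` of `f` over `s`. -/
def SameComponent {X S : Scheme.{u}} (f : X ⟶ S) {U : Scheme.{u}} (a b : U ⟶ X) : Prop :=
  a ≫ f = b ≫ f ∧
    ∀ (K : Type u) [Field K] [IsAlgClosed K] (t : Spec (.of K) ⟶ U) (s : Spec (.of K) ⟶ S)
      (ha : (t ≫ a) ≫ f = s) (hb : (t ≫ b) ≫ f = s),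
      connectedComponent (fiberPoint f (t ≫ a) s ha) =
        connectedComponent (fiberPoint f (t ≫ b) s hb)

lemma SameComponent.comp {X S : Scheme.{u}} {f : X ⟶ S} {U V : Scheme.{u}} {a b : U ⟶ X}
    (h : SameComponent f a b) (g : V ⟶ U) : SameComponent f (g ≫ a) (g ≫ b) := by
  obtain ⟨h₁, h₂⟩ := h
  refine ⟨by simp [h₁], fun K _ _ t s ha hb => ?_⟩
  have := h₂ K (t ≫ g) s (by simpa using ha) (by simpa using hb)
  simp only [Category.assoc] at this ⊢
  exact this

lemma sameComponent_equivalence {X S : Scheme.{u}} (f : X ⟶ S) (U : Scheme.{u}) :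
    Equivalence (SameComponent f (U := U)) where
  refl a := ⟨rfl, fun _ _ _ _ _ _ _ => rfl⟩
  symm := fun ⟨h, H⟩ => ⟨h.symm, fun K _ _ t s ha hb => (H K t s hb ha).symm⟩
  trans := fun ⟨h, H⟩ ⟨h', H'⟩ => ⟨h.trans h', fun K _ _ t s ha hb =>
    (H K t s ha (by rw [← ha, Category.assoc, Category.assoc, h])).trans (H' K t s _ hb)⟩

/-- The equivalence relation `SameComponent` on `X(U)`. -/
def componentSetoid {X S : Scheme.{u}} (f : X ⟶ S) (U : Scheme.{u}) : Setoid (U ⟶ X) :=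
  ⟨SameComponent f, sameComponent_equivalence f U⟩

/-- The presheaf quotient of `X` by the relation of lying in the same geometric component of a
fiber of `f : X ⟶ S`. -/
def componentPresheaf {X S : Scheme.{u}} (f : X ⟶ S) : PSh.{u} where
  obj U := ULift.{u + 1} (Quotient (componentSetoid f U.unop))
  map {U V} g := TypeCat.ofHom fun c => ULift.up <|
    Quotient.map (sa := componentSetoid f U.unop) (sb := componentSetoid f V.unop)
      (fun a => g.unop ≫ a) (fun _ _ h => SameComponent.comp h g.unop) c.down
  map_id U := by
    ext ⟨c⟩
    induction c using Quotient.ind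
    simp
  map_comp g h := by
    ext ⟨c⟩
    induction c using Quotient.ind
    simp
    rfl

/-- The morphism from the presheaf quotient to `S`. -/
def componentPresheafToBase {X S : Scheme.{u}} (f : X ⟶ S) :
    componentPresheaf f ⟶ uliftYoneda.{u + 1}.obj S where
  app U := TypeCat.ofHom fun c => ULift.up <|
    Quotient.lift (s := componentSetoid f U.unop) (fun a => a ≫ f) (fun _ _ h => h.1) c.down
  naturality U V g := by
    ext ⟨c⟩
    induction c using Quotient.ind
    exact congrArg ULift.up (Category.assoc _ _ _)

instance : Scheme.etaleTopology.{u}.Subcanonical :=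
  .of_le (show Scheme.etaleTopology.{u} ≤ Scheme.fppfTopology from
    Scheme.grothendieckTopology_monotone fun _ _ _ _ => ⟨inferInstance, inferInstance⟩)

lemma isSheaf_scheme (S : Scheme.{u}) :
    Presheaf.IsSheaf Scheme.etaleTopology.{u} (uliftYoneda.{u + 1}.obj S) :=
  (Scheme.etaleTopology.{u}.uliftYoneda.{u + 1}.obj S).property

/-- `π₀(X/S)`, for `f : X ⟶ S` a finitely presented smooth morphism: the quotient, as a sheaf for
the étale topology, of `X` by the relation of lying in the same geometric component of a fiber. -/
def piZero {X S : Scheme.{u}} (f : X ⟶ S) : PSh.{u} :=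
  sheafify Scheme.etaleTopology.{u} (componentPresheaf f)

/-- The structure morphism `π₀(X/S) ⟶ S`. -/
def piZeroToBase {X S : Scheme.{u}} (f : X ⟶ S) : piZero f ⟶ uliftYoneda.{u + 1}.obj S :=
  sheafifyLift _ (componentPresheafToBase f) (isSheaf_scheme S)

/-! ### Conditions on fibers -/

/-- All irreducible components have the same finite dimension. -/
def IsPureDimensional (Z : Type u) [TopologicalSpace Z] : Prop :=
  ∃ n : ℕ, ∀ C ∈ irreducibleComponents Z, topologicalKrullDim C = n

instance {X S : Scheme.{u}} (f : X ⟶ S) [LocallyOfFinitePresentation f] (s : S) :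
    LocallyOfFinitePresentation (f.fiberToSpecResidueField s) :=
  inferInstanceAs (LocallyOfFinitePresentation (pullback.snd f (S.fromSpecResidueField s)))

/-- The inclusion of the relative smooth locus, followed by `f`. -/
def smoothPart {X S : Scheme.{u}} (f : X ⟶ S) [LocallyOfFinitePresentation f] :
    (f.smoothLocus : Scheme.{u}) ⟶ S :=
  f.smoothLocus.ι ≫ f

end ComponentsInFamilies

end

noncomputable section

namespace ComponentsInFamilies

attribute [local simp] pullback.lift_fst pullback.lift_snd pullback.lift_fst_assoc
  pullback.lift_snd_assoc

/-! ### Hypersurface charts of smooth algebras -/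

open MvPolynomial TensorProduct

/-! Write Y for the smooth locus and g for its map to S. The proof rests on two openness statements
about components of geometric fibers of g.

(1) If a, b : T ⟶ Y agree over S, the set of points of T where they lie in the same component is
open (`isOpen_relLocus`). Locally Y is standard étale over affine space, hence an open part of a
hypersurface P = 0 on which a partial derivative of P is invertible. Over a field, two points are
separated by an idempotent exactly when P = F G with F vanishing at one and G at the other. Factors
of P have bounded degree, so the factorizations at all points of the bad locus assemble into a
single one over a product of fields, and this gives an idempotent there. As the chart is smooth, the
idempotent is already defined over the integral closure R' of the base in that product; the bad
locus is then the image of Spec R', which is closed because R' is integral. Sections in different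
charts are compared through a third point, since the components of smooth fibers are irreducible.

(2) If an open V ⊆ Y meets every component of the geometric fibers over s₀, the same holds over a
neighborhood of s₀ (`IsSmoothDense.exists_nhds`). Indeed V is then dense in the fiber of X, so on
that fiber the complement of V contains only points of transcendence degree less than the relative
dimension n. Noether normalization in families extends this bound to nearby points of the
complement, and closedness of f makes the neighborhood a full tube around the fiber. Generic points
of nearby fibers have transcendence degree exactly n, so they lie in V.

Universal closedness: a closed subset of a base change of π₀ pulls back to a closed W ⊆ Y which is a
union of components. If W misses the fiber over s, its complement contains that fiber, so by (2) it
meets all components nearby, and W misses those fibers too (`IsSmoothDense.isClosed_image`).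

Finite étaleness: smooth morphisms have sections étale locally, through any prescribed component
(`exists_etale_section`). Choose one through each of the d components of a fiber. By (2) they meet
all components of nearby fibers, and by counting they meet each exactly once
(`IsSmoothDense.exists_etale_frame`). By (1) the coincidence loci of these sections over the
self-product of the étale cover are clopen, and their idempotents glue d copies of the cover to a
finite étale algebra (`IsGluing.bijective_gluedBaseChange`). It represents π₀ locally
(`IsComponentChart.represents`), and the representing schemes glue over S. -/

/-- A presentation of an algebra as the complement of `g = 0` in the part of the hypersurface
`P = 0` which is étale over affine space by means of all the coordinates but one. -/
structure HypersurfacePresentation (A B : Type u) [CommRing A] [CommRing B] [Algebra A B] where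
  /-- the dimension -/
  n : ℕ
  /-- the equation -/
  P : MvPolynomial (Option (Fin n)) A
  /-- the inverted function -/
  g : MvPolynomial (Option (Fin n)) A
  /-- the coordinates -/
  x : Option (Fin n) → B
  aeval_P : aeval x P = 0
  isUnit_pderiv : IsUnit (aeval x (pderiv none P))
  isUnit_g : IsUnit (aeval x g)
  exists_mul_pow : ∀ b : B, ∃ (N : ℕ) (h : MvPolynomial (Option (Fin n)) A),
    b * aeval x g ^ N = aeval x h
  map_ne_zero : ∀ (K : Type u) [Field K] (φ : A →+* K), P.map φ ≠ 0
  exists_lift : ∀ (L : Type u) [CommRing L] [Algebra A L] (v : Option (Fin n) → L),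
    aeval v P = 0 → IsUnit (aeval v g) → ∃ ψ : B →ₐ[A] L, ∀ i, ψ (x i) = v i

lemma optionEquivLeft_pderiv_none {R σ : Type*} [CommRing R] (p : MvPolynomial (Option σ) R) :
    optionEquivLeft R σ (pderiv none p) = Polynomial.derivative (optionEquivLeft R σ p) := by
  classical
  induction p using MvPolynomial.induction_on with
  | C a => simp
  | add p q hp hq => simp [hp, hq]
  | mul_X p i hp =>
    rw [Derivation.leibniz, map_add]
    cases i with
    | none => simp [hp]; ring
    | some i => simp [hp, pderiv_X]; ring

/-- A standard étale algebra over A[X₁, …, Xₙ] adjoins a root of a monic f and inverts g, with f'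
becoming a unit. The root becomes the coordinate `none` and f becomes the equation P; monicity is
what keeps P nonzero over every field. -/
lemma exists_hypersurfacePresentation {A B : Type u} [CommRing A] [CommRing B] [Algebra A B]
    {n : ℕ} [Algebra (MvPolynomial (Fin n) A) B] [IsScalarTower A (MvPolynomial (Fin n) A) B]
    [Algebra.IsStandardEtale (MvPolynomial (Fin n) A) B] :
    Nonempty (HypersurfacePresentation A B) := by
  obtain ⟨Q⟩ := Algebra.IsStandardEtale.nonempty_standardEtalePresentation
    (R := MvPolynomial (Fin n) A) (S := B)
  let x : Option (Fin n) → B := fun i => i.elim Q.x fun i => algebraMap (MvPolynomial (Fin n) A) B (X i)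
  have hx (p : MvPolynomial (Option (Fin n)) A) :
      aeval x p = Polynomial.aeval Q.x (optionEquivLeft A (Fin n) p) := by
    have : (aeval x : _ →ₐ[A] B) = ((Polynomial.aeval Q.x : Polynomial (MvPolynomial (Fin n) A)
        →ₐ[MvPolynomial (Fin n) A] B).restrictScalars A).comp
        (optionEquivLeft A (Fin n)).toAlgHom := by
      ext i
      cases i <;> simp [x]
    exact congr($this p)
  have hx' (p) : aeval x ((optionEquivLeft A (Fin n)).symm p) = Polynomial.aeval Q.x p := by
    simp [hx]
  refine ⟨⟨n, (optionEquivLeft A (Fin n)).symm Q.f, (optionEquivLeft A (Fin n)).symm Q.g, x,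
    ?_, ?_, ?_, ?_, ?_, ?_⟩⟩
  · rw [hx', Q.hasMap.1]
  · rw [hx, optionEquivLeft_pderiv_none, AlgEquiv.apply_symm_apply]
    exact Q.hasMap.isUnit_derivative_f
  · rw [hx']
    exact Q.hasMap.2
  · intro b
    obtain ⟨p, N, h⟩ := Q.exists_mul_aeval_x_g_pow_eq_aeval_x b
    exact ⟨N, (optionEquivLeft A (Fin n)).symm p, by rw [hx', hx', h]⟩
  · intro K _ φ h
    -- The leading coefficient of the monic f is 1, so it survives every map to a field.
    have h1 : coeff (Finsupp.optionElim Q.f.natDegree 0) ((optionEquivLeft A (Fin n)).symm Q.f) = 1 := by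
      rw [← optionEquivLeft_coeff_coeff, AlgEquiv.apply_symm_apply]
      rw [Polynomial.coeff_natDegree, Q.monic_f]
      simp
    have h2 := congr(coeff (Finsupp.optionElim Q.f.natDegree 0) $h)
    rw [coeff_map, h1] at h2
    simp at h2
  · intro L _ _ v h1 h2
    let := (aeval (R := A) fun i => v (some i)).toRingHom.toAlgebra
    have : IsScalarTower A (MvPolynomial (Fin n) A) L := .of_algebraMap_eq' <| by
      ext; simp [RingHom.algebraMap_toAlgebra]
    have hv (p : MvPolynomial (Option (Fin n)) A) :
      aeval v p = Polynomial.aeval (v none) (optionEquivLeft A (Fin n) p) := by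
      have : (aeval v : _ →ₐ[A] L) = ((Polynomial.aeval (v none) : Polynomial (MvPolynomial (Fin n) A)
        →ₐ[MvPolynomial (Fin n) A] L).restrictScalars A).comp
        (optionEquivLeft A (Fin n)).toAlgHom := by
        ext i
        cases i <;> simp [RingHom.algebraMap_toAlgebra]
      exact congr($this p)
    rw [hv, AlgEquiv.apply_symm_apply] at h1 h2
    refine ⟨((Q.P.lift (v none) ⟨h1, h2⟩).comp Q.equivRing.toAlgHom).restrictScalars A, ?_⟩
    rintro (_ | i)
    · simpa [x] using Q.P.lift_X (v none) ⟨h1, h2⟩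
    · simp [x, RingHom.algebraMap_toAlgebra]


/-! ### Idempotents and factorizations of the equation -/

section

variable {A B : Type u} [CommRing A] [CommRing B] [Algebra A B]

/-- The `K`-algebra homomorphism `B ⊗ K → K` given by a `K`-valued point of `B`. -/
abbrev evalPoint {K : Type u} [CommRing K] [Algebra A K] (α : B →ₐ[A] K) : B ⊗[A] K →ₐ[A] K :=
  Algebra.TensorProduct.lift α (AlgHom.id A K) fun _ _ => .all _ _

/-- Two `K`-valued points of `B` are separated by an idempotent of `B ⊗ K`. -/
def Separated {K : Type u} [CommRing K] [Algebra A K] (α β : B →ₐ[A] K) : Prop :=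
  ∃ e : B ⊗[A] K, IsIdempotentElem e ∧ evalPoint α e = 1 ∧ evalPoint β e = 0

namespace HypersurfacePresentation

variable (H : HypersurfacePresentation A B)

/-- The evaluation at the coordinates of polynomials with coefficients in `K`. -/
def polyMap (K : Type u) [CommRing K] [Algebra A K] :
    MvPolynomial (Option (Fin H.n)) K →+* B ⊗[A] K :=
  eval₂Hom (Algebra.TensorProduct.includeRight : K →ₐ[A] B ⊗[A] K).toRingHom
    fun i => H.x i ⊗ₜ 1

@[simp]
lemma polyMap_C {K : Type u} [CommRing K] [Algebra A K] (k : K) : H.polyMap K (C k) = 1 ⊗ₜ k := by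
  simp [polyMap]

@[simp]
lemma polyMap_X {K : Type u} [CommRing K] [Algebra A K] (i) :
    H.polyMap K (X i) = H.x i ⊗ₜ 1 := by
  simp [polyMap]

lemma polyMap_map {K : Type u} [CommRing K] [Algebra A K] (p : MvPolynomial (Option (Fin H.n)) A) :
    H.polyMap K (p.map (algebraMap A K)) = aeval H.x p ⊗ₜ 1 := by
  have : (H.polyMap K).comp (MvPolynomial.map (algebraMap A K)) =
      (Algebra.TensorProduct.includeLeft (S := A) (B := K)).toRingHom.comp
        (aeval (R := A) H.x).toRingHom := by
    refine MvPolynomial.ringHom_ext (fun a => ?_) fun i => by simp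
    simp only [RingHom.comp_apply, map_C, polyMap_C, AlgHom.toRingHom_eq_coe, RingHom.coe_coe,
      algHom_C, Algebra.TensorProduct.includeLeft_apply]
    rw [Algebra.algebraMap_eq_smul_one, Algebra.algebraMap_eq_smul_one, smul_tmul]
  exact congr($this p)

/-- Multiplying by a power of the inverted function g clears denominators, so statements about B ⊗ K
reduce to polynomials over K. -/
lemma exists_tmul_mul_pow {K : Type u} [CommRing K] [Algebra A K] (e : B ⊗[A] K) :
    ∃ (N : ℕ) (h : MvPolynomial (Option (Fin H.n)) K),
      e * (aeval H.x H.g ⊗ₜ 1) ^ N = H.polyMap K h := by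
  induction e with
  | zero => exact ⟨0, 0, by simp⟩
  | tmul b k =>
    obtain ⟨N, h, hh⟩ := H.exists_mul_pow b
    refine ⟨N, C k * h.map (algebraMap A K), ?_⟩
    rw [map_mul, polyMap_map, ← hh, polyMap_C]
    simp [Algebra.TensorProduct.tmul_pow]
  | add e₁ e₂ h₁ h₂ =>
    obtain ⟨N₁, p₁, h₁⟩ := h₁
    obtain ⟨N₂, p₂, h₂⟩ := h₂
    refine ⟨N₁ + N₂, p₁ * (H.g.map (algebraMap A K)) ^ N₂ + p₂ * (H.g.map (algebraMap A K)) ^ N₁, ?_⟩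
    rw [map_add, map_mul, map_mul, map_pow, map_pow, polyMap_map, ← h₁, ← h₂]
    ring

lemma evalPoint_polyMap {K : Type u} [CommRing K] [Algebra A K] (α : B →ₐ[A] K)
    (h : MvPolynomial (Option (Fin H.n)) K) :
    evalPoint α (H.polyMap K h) = MvPolynomial.eval (fun i => α (H.x i)) h := by
  have : (evalPoint α).toRingHom.comp (H.polyMap K) = MvPolynomial.eval (fun i => α (H.x i)) :=
    MvPolynomial.ringHom_ext (by simp) (by simp)
  exact congr($this h)

lemma eval_map {K : Type u} [CommRing K] [Algebra A K] (α : B →ₐ[A] K) (p) :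
    MvPolynomial.eval (fun i => α (H.x i)) (p.map (algebraMap A K)) = α (aeval H.x p) := by
  rw [← evalPoint_polyMap, polyMap_map]
  simp

/-- A prime factor of the equation of the hypersurface determines a component of `B ⊗ K`. -/
lemma exists_ringHom_of_prime {K : Type u} [Field K] [Algebra A K]
    {F : MvPolynomial (Option (Fin H.n)) K} (hF : Prime F) (hP : F ∣ H.P.map (algebraMap A K))
    (hg : ¬ F ∣ H.g.map (algebraMap A K)) :
    ∃ (L : Type u) (_ : Field L) (Ψ : B ⊗[A] K →+* L), ∀ h, Ψ (H.polyMap K h) = 0 ↔ F ∣ h := by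
  have : (Ideal.span {F}).IsPrime := (Ideal.span_singleton_prime hF.ne_zero).mpr hF
  let q : MvPolynomial (Option (Fin H.n)) K →ₐ[K] FractionRing (MvPolynomial (Option (Fin H.n)) K ⧸ Ideal.span {F}) :=
    (IsScalarTower.toAlgHom K (MvPolynomial (Option (Fin H.n)) K ⧸ Ideal.span {F}) _).comp (Ideal.Quotient.mkₐ K _)
  have hq (p) : q p = 0 ↔ F ∣ p := by
    simp [q, Ideal.Quotient.eq_zero_iff_mem, Ideal.mem_span_singleton]
  have hqA (p : MvPolynomial (Option (Fin H.n)) A) :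
      aeval (fun i => q (X i)) p = q (p.map (algebraMap A K)) := by
    have : (aeval (R := A) fun i => q (X i)) = (q.restrictScalars A).comp
        (mapAlgHom (Algebra.ofId A K)) := by
      ext i
      simp
    exact congr($this p)
  -- The field is the fraction field of K[X]/(F). Its tautological point satisfies P = 0 because F
  -- divides P, and inverts g because F does not divide g.
  obtain ⟨ψ, hψ⟩ := H.exists_lift (FractionRing (MvPolynomial (Option (Fin H.n)) K ⧸ Ideal.span {F}))
    (fun i => q (X i)) (by rwa [hqA, hq]) (by rwa [hqA, isUnit_iff_ne_zero, ne_eq, hq])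
  let Ψ := Algebra.TensorProduct.lift ψ ((Algebra.ofId K (FractionRing (MvPolynomial (Option (Fin H.n)) K ⧸ Ideal.span {F}))).restrictScalars A) fun _ _ => .all _ _
  have hΨ (h : MvPolynomial (Option (Fin H.n)) K) : Ψ (H.polyMap K h) = q h := by
    have : Ψ.toRingHom.comp (H.polyMap K) = q.toRingHom := by
      refine MvPolynomial.ringHom_ext (fun a => ?_) fun i => by simp [Ψ, hψ]
      simp [Ψ, ← algebraMap_eq, Algebra.ofId_apply]
    exact congr($this h)
  exact ⟨_, inferInstance, Ψ.toRingHom, fun h => by rw [← hq, ← hΨ]; rfl⟩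

/-- If two points are separated by an idempotent, then the equation of the hypersurface factors. -/
lemma exists_factorization {K : Type u} [Field K] [Algebra A K] (α β : B →ₐ[A] K)
    (h : Separated α β) : ∃ F G : MvPolynomial (Option (Fin H.n)) K,
      H.P.map (algebraMap A K) = F * G ∧ MvPolynomial.eval (fun i => α (H.x i)) F = 0 ∧
        MvPolynomial.eval (fun i => β (H.x i)) G = 0 := by
  obtain ⟨e, he, h1, h0⟩ := h
  have hP0 := H.map_ne_zero K (algebraMap A K)
  have hα : MvPolynomial.eval (fun i => α (H.x i)) (H.P.map (algebraMap A K)) = 0 := by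
    rw [H.eval_map, H.aeval_P, map_zero]
  have hβ : MvPolynomial.eval (fun i => β (H.x i)) (H.P.map (algebraMap A K)) = 0 := by
    rw [H.eval_map, H.aeval_P, map_zero]
  -- F is an irreducible factor of P passing through α, and G is the complementary factor.
  obtain ⟨F, hF, ⟨G, hG⟩, hFα⟩ : ∃ F, Prime F ∧ F ∣ H.P.map (algebraMap A K) ∧
      MvPolynomial.eval (fun i => α (H.x i)) F = 0 := by
    obtain ⟨s, hs, u, hu⟩ := UniqueFactorizationMonoid.exists_prime_factors _ hP0
    have : MvPolynomial.eval (fun i => α (H.x i)) s.prod = 0 := by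
      rw [← hu, map_mul] at hα
      exact (mul_eq_zero.mp hα).resolve_right (u.isUnit.map _).ne_zero
    rw [← Multiset.prod_hom s (MvPolynomial.eval (fun i => α (H.x i)))] at this
    obtain ⟨F, hF, h⟩ := Multiset.mem_map.mp (Multiset.prod_eq_zero_iff.mp this)
    exact ⟨F, hs F hF, (Multiset.dvd_prod hF).trans ⟨_, hu.symm⟩, h⟩
  refine ⟨F, G, hG, hFα, ?_⟩
  -- Otherwise both α and β lie on F = 0. That locus has function field L, in which every idempotent
  -- is 0 or 1, so no idempotent can separate α from β.
  by_contra hGβ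
  have hFβ : MvPolynomial.eval (fun i => β (H.x i)) F = 0 := by
    rw [hG, map_mul] at hβ
    exact (mul_eq_zero.mp hβ).resolve_right hGβ
  obtain ⟨L, _, Ψ, hΨ⟩ := H.exists_ringHom_of_prime hF ⟨G, hG⟩ (by
    rintro ⟨g', hg'⟩
    have := H.eval_map α H.g
    rw [hg', map_mul, hFα, zero_mul] at this
    exact (H.isUnit_g.map α).ne_zero this.symm)
  -- A function vanishing generically on F = 0 vanishes at every point of F = 0 where g is
  -- invertible.
  have key (γ : B →ₐ[A] K) (hγ : MvPolynomial.eval (fun i => γ (H.x i)) F = 0) (e : B ⊗[A] K) (h : Ψ e = 0) :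
      evalPoint γ e = 0 := by
    obtain ⟨N, p, hp⟩ := H.exists_tmul_mul_pow e
    have hF : F ∣ p := by
      rw [← hΨ, ← hp, map_mul, h, zero_mul]
    obtain ⟨p', rfl⟩ := hF
    have := congr(evalPoint γ $hp)
    rw [evalPoint_polyMap, map_mul, map_mul, hγ, zero_mul, map_pow] at this
    refine (mul_eq_zero.mp this).resolve_right (pow_ne_zero _ ?_)
    simpa using (H.isUnit_g.map γ).ne_zero
  have : Ψ e * (Ψ e - 1) = 0 := by
    rw [mul_sub, ← map_mul, he.eq, mul_one, sub_self]
  rcases mul_eq_zero.mp this with h | h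
  · exact one_ne_zero (h1.symm.trans (key α hFα e h))
  · have := key β hFβ (1 - e) (by rw [map_sub, map_one, ← neg_sub, h, neg_zero])
    simp [h0] at this


/-- Every point of a standard étale algebra over affine space over a field has an irreducible open
neighbourhood. -/
lemma exists_isPreirreducible_basicOpen {K B : Type u} [Field K] [CommRing B] [Algebra K B]
    (H : HypersurfacePresentation K B) (q : PrimeSpectrum B) :
    ∃ G : B, G ∉ q.asIdeal ∧ IsPreirreducible (PrimeSpectrum.basicOpen G : Set (PrimeSpectrum B)) := by
  have hP0 := H.map_ne_zero K (RingHom.id K)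
  rw [MvPolynomial.map_id] at hP0
  obtain ⟨F, hF, ⟨G, hG⟩, hFq⟩ : ∃ F, Prime F ∧ F ∣ H.P ∧ aeval H.x F ∈ q.asIdeal := by
    obtain ⟨s, hs, u, hu⟩ := UniqueFactorizationMonoid.exists_prime_factors _ hP0
    have : s.prod ∈ q.asIdeal.comap (aeval (R := K) H.x) := by
      have hu' : s.prod = H.P * ↑u⁻¹ := by rw [← hu, Units.mul_inv_cancel_right]
      rw [hu', Ideal.mem_comap, map_mul, H.aeval_P, zero_mul]
      exact zero_mem _
    obtain ⟨F, hF, h⟩ := (Ideal.IsPrime.multiset_prod_mem_iff_exists_mem inferInstance s).mp this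
    exact ⟨F, hs F hF, (Multiset.dvd_prod hF).trans ⟨_, hu.symm⟩, h⟩
  -- The derivative of P = F G is invertible, so F and G cannot both vanish at q.
  have hGq : aeval H.x G ∉ q.asIdeal := by
    intro h
    refine q.2.ne_top (Ideal.eq_top_of_isUnit_mem _ ?_ H.isUnit_pderiv)
    rw [hG, Derivation.leibniz]
    simp only [smul_eq_mul, map_add, map_mul]
    exact add_mem (Ideal.mul_mem_right _ _ hFq) (Ideal.mul_mem_right _ _ h)
  have hGF : ¬ F ∣ G := by
    rintro ⟨G', rfl⟩
    exact hGq (by rw [map_mul]; exact Ideal.mul_mem_right _ _ hFq)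
  obtain ⟨L, _, Ψ, hΨ⟩ := H.exists_ringHom_of_prime hF
    (by rw [Algebra.algebraMap_self, MvPolynomial.map_id]; exact ⟨G, hG⟩) (by
    rw [Algebra.algebraMap_self, MvPolynomial.map_id]
    rintro ⟨g', hg'⟩
    refine q.2.ne_top (Ideal.eq_top_of_isUnit_mem _ ?_ H.isUnit_g)
    rw [hg', map_mul]
    exact Ideal.mul_mem_right _ _ hFq)
  let ψ : B →+* L := Ψ.comp (Algebra.TensorProduct.includeLeft (S := K)).toRingHom
  have hψ (h) : ψ (aeval H.x h) = 0 ↔ F ∣ h := by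
    have := H.polyMap_map (K := K) h
    rw [Algebra.algebraMap_self, MvPolynomial.map_id] at this
    rw [← hΨ, this]
    rfl
  -- On the locus where G is invertible the equation F G = 0 reduces to F = 0, so nothing nonzero is
  -- lost in passing to the function field.
  have key (b : B) (hb : ψ b = 0) : b * aeval H.x G = 0 := by
    obtain ⟨N, h, hh⟩ := H.exists_mul_pow b
    have : F ∣ h := by rw [← hψ, ← hh, map_mul, hb, zero_mul]
    obtain ⟨h', rfl⟩ := this
    refine (H.isUnit_g.pow N).mul_left_injective ?_
    change b * aeval H.x G * aeval H.x H.g ^ N = 0 * _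
    rw [mul_right_comm, hh, zero_mul, ← map_mul, mul_right_comm, ← hG, map_mul, H.aeval_P, zero_mul]
  refine ⟨aeval H.x G, hGq, ?_⟩
  rintro U V hU hV ⟨y, hyG, hyU⟩ ⟨z, hzG, hzV⟩
  obtain ⟨_, ⟨b, rfl⟩, hyb, hbU⟩ := PrimeSpectrum.isTopologicalBasis_basic_opens.exists_subset_of_mem_open hyU hU
  obtain ⟨_, ⟨c, rfl⟩, hzc, hcV⟩ := PrimeSpectrum.isTopologicalBasis_basic_opens.exists_subset_of_mem_open hzV hV
  have hb : ψ b ≠ 0 := fun h => (y.2.mul_notMem hyb hyG) (by rw [key b h]; exact zero_mem _)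
  have hc : ψ c ≠ 0 := fun h => (z.2.mul_notMem hzc hzG) (by rw [key c h]; exact zero_mem _)
  have hG' : ψ (aeval H.x G) ≠ 0 := by rwa [ne_eq, hψ]
  -- The kernel of ψ is the generic point: it lies in every nonempty open subset of the locus where
  -- G is invertible.
  let w : PrimeSpectrum B := PrimeSpectrum.comap ψ ⊥
  have hw (b : B) (h : ψ b ≠ 0) : b ∉ w.asIdeal := fun h' => h (by simpa [w] using h')
  exact ⟨w, hw _ hG', hbU (hw _ hb), hcV (hw _ hc)⟩

end HypersurfacePresentation

/-! ### Closedness of the locus where two sections are separated -/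

/-- A family of polynomials of bounded degree is a polynomial with coefficients in the product. -/
lemma exists_mvPolynomial_pi {σ ι : Type*} [Finite σ] (K : ι → Type*) [∀ i, CommRing (K i)]
    (F : ∀ i, MvPolynomial σ (K i)) (D : ℕ) (hF : ∀ i, (F i).totalDegree ≤ D) :
    ∃ p : MvPolynomial σ (∀ i, K i), ∀ i, p.map (Pi.evalRingHom K i) = F i := by
  classical
  -- The degree bound confines all exponents to one finite box, so the sum over the box is a
  -- polynomial.
  refine ⟨∑ m ∈ Finset.Iic (Finsupp.equivFunOnFinite.symm fun _ => D : σ →₀ ℕ),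
    monomial m fun i => coeff m (F i), fun i => ?_⟩
  ext m
  simp only [map_sum, map_monomial, Pi.evalRingHom_apply, coeff_sum, coeff_monomial,
    Finset.sum_ite_eq', Finset.mem_Iic]
  split_ifs with h
  · rfl
  · by_contra h0
    refine h fun j => ?_
    have : m ∈ (F i).support := by rw [mem_support_iff]; exact fun h => h0 h.symm
    exact (monomial_le_degreeOf j this).trans ((degreeOf_le_totalDegree _ _).trans (hF i))

lemma mvPolynomial_pi_ext {σ ι : Type*} {K : ι → Type*} [∀ i, CommRing (K i)]
    {p q : MvPolynomial σ (∀ i, K i)}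
    (h : ∀ i, p.map (Pi.evalRingHom K i) = q.map (Pi.evalRingHom K i)) : p = q := by
  ext m i
  have := congr(coeff m $(h i))
  rw [coeff_map, coeff_map] at this
  exact this

/-- By the Leibniz rule ∂P = ∂F · G + F · ∂G. The two terms have product zero, since F G = P
vanishes, and their sum is a unit; dividing by it gives complementary idempotents. The base A' is
arbitrary, which permits infinite products of fields. -/
lemma HypersurfacePresentation.exists_idempotent (H : HypersurfacePresentation A B)
    {A' : Type u} [CommRing A'] [Algebra A A'] (F G : MvPolynomial (Option (Fin H.n)) A')
    (hFG : H.P.map (algebraMap A A') = F * G) :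
    ∃ e : B ⊗[A] A', IsIdempotentElem e ∧ ∀ c : B →ₐ[A] A',
      (MvPolynomial.eval (fun i => c (H.x i)) F = 0 → evalPoint c e = 1) ∧
      (MvPolynomial.eval (fun i => c (H.x i)) G = 0 → evalPoint c e = 0) := by
  let u := H.isUnit_pderiv.map
    (Algebra.TensorProduct.includeLeft (R := A) (S := A) (A := B) (B := A'))
  let m := H.polyMap A'
  have hm : m (pderiv none F * G) + m (F * pderiv none G) = u.unit := by
    rw [← map_add, IsUnit.unit_spec, Algebra.TensorProduct.includeLeft_apply, ← H.polyMap_map,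
      ← pderiv_map, hFG, Derivation.leibniz, smul_eq_mul, smul_eq_mul]
    congr 1
    ring
  have hm0 : m (F * G) = 0 := by
    rw [← hFG, polyMap_map, H.aeval_P, zero_tmul]
  refine ⟨m (pderiv none F * G) * ↑u.unit⁻¹, ?_, fun c => ⟨fun h => ?_, fun h => ?_⟩⟩
  · have h1 : m (pderiv none F * G) * m (F * pderiv none G) = 0 := by
      rw [← map_mul, show pderiv none F * G * (F * pderiv none G) =
        F * G * (pderiv none F * pderiv none G) by ring, map_mul, hm0, zero_mul]
    have h2 : m (pderiv none F * G) * m (pderiv none F * G) = m (pderiv none F * G) * u.unit := by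
      rw [← hm, mul_add, h1, add_zero]
    change m (pderiv none F * G) * ↑u.unit⁻¹ * (m (pderiv none F * G) * ↑u.unit⁻¹) = _
    rw [mul_mul_mul_comm, h2, mul_assoc, Units.mul_inv_cancel_left]
  · have h1 : evalPoint c (m (F * pderiv none G)) = 0 := by
      rw [evalPoint_polyMap, map_mul, h, zero_mul]
    have h2 := congr(evalPoint c $hm)
    rw [map_add, h1, add_zero] at h2
    rw [map_mul, h2, ← map_mul, Units.mul_inv, map_one]
  · have h1 : evalPoint c (m (pderiv none F * G)) = 0 := by
      rw [evalPoint_polyMap, map_mul, h, mul_zero]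
    rw [map_mul, h1, zero_mul]

/-- Idempotents of a smooth algebra are defined over the integral closure of the base. -/
lemma exists_idempotent_integralClosure [Algebra.Smooth A B] {A' : Type u} [CommRing A']
    [Algebra A A'] (e : B ⊗[A] A') (he : IsIdempotentElem e) :
    ∃ e' : B ⊗[A] integralClosure A A', IsIdempotentElem e' ∧
      Algebra.TensorProduct.map (.id A B) (integralClosure A A').val e' = e := by
  -- Idempotents are roots of X² - X, and integral closure commutes with smooth base change.
  have heint : IsIntegral B e := ⟨.X ^ 2 - .X, by monicity!, by simp [sq, he.eq]⟩
  obtain ⟨e', he'⟩ := (TensorProduct.toIntegralClosure_bijective_of_smooth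
    (R := A) (S := B) (B := A')).2 ⟨e, heint⟩
  have hinj : Function.Injective (Algebra.TensorProduct.map (.id A B)
      (integralClosure A A').val) :=
    Module.Flat.lTensor_preserves_injective_linearMap (M := B)
      (integralClosure A A').val.toLinearMap Subtype.val_injective
  replace he' : Algebra.TensorProduct.map (.id A B) (integralClosure A A').val e' = e :=
    congrArg Subtype.val he'
  exact ⟨e', hinj (by rw [map_mul, he', he.eq]), he'⟩

/-- The separating idempotent over A' descends to the integral closure of A in A', hence to any R' ⊆
A' containing it, and can then be specialized along every χ out of R'. Its values at the two
sections are checked after the injection ι. -/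
lemma separated_comp_of_separated [Algebra.Smooth A B] {R R' A' : Type u} [CommRing R]
    [Algebra A R] [CommRing R'] [Algebra A R'] [CommRing A'] [Algebra A A'] (a b : B →ₐ[A] R)
    (ρ : R →ₐ[A] R') (ι : R' →ₐ[A] A') (hι : Function.Injective ι)
    (hmem : ∀ x ∈ integralClosure A A', x ∈ ι.range)
    (h : Separated ((ι.comp ρ).comp a) ((ι.comp ρ).comp b)) {k : Type u} [CommRing k]
    [Algebra A k] (χ : R' →ₐ[A] k) : Separated ((χ.comp ρ).comp a) ((χ.comp ρ).comp b) := by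
  obtain ⟨e, he, hea, heb⟩ := h
  obtain ⟨e', hide', he'⟩ := exists_idempotent_integralClosure e he
  obtain ⟨j, hj⟩ : ∃ j : integralClosure A A' →ₐ[A] R', ι.comp j = (integralClosure A A').val := by
    refine ⟨((AlgEquiv.ofInjective ι hι).symm : ι.range →ₐ[A] R').comp
      (Subalgebra.inclusion hmem), ?_⟩
    ext x
    exact congrArg Subtype.val
      ((AlgEquiv.ofInjective ι hι).apply_symm_apply (Subalgebra.inclusion hmem x))
  have hcomm (c : B →ₐ[A] R) : ι.comp (Algebra.TensorProduct.lift (ρ.comp c) j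
      (fun _ _ => .all _ _)) = (evalPoint ((ι.comp ρ).comp c)).comp
        (Algebra.TensorProduct.map (.id A B) (integralClosure A A').val) := by
    ext x
    · simp
    · simpa using congr($hj x)
  have hcomm' (c : B →ₐ[A] R) : (evalPoint ((χ.comp ρ).comp c)).comp
      (Algebra.TensorProduct.map (.id A B) (χ.comp j)) =
      χ.comp (Algebra.TensorProduct.lift (ρ.comp c) j (fun _ _ => .all _ _)) := by
    ext x <;> simp
  refine ⟨Algebra.TensorProduct.map (.id A B) (χ.comp j) e', hide'.map _, ?_, ?_⟩
  · have h1 : Algebra.TensorProduct.lift (ρ.comp a) j (fun _ _ => .all _ _) e' = 1 :=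
      hι (by rw [map_one, ← hea, ← he']; exact congr($(hcomm a) e'))
    exact congr($(hcomm' a) e').trans (by simp [h1])
  · have h1 : Algebra.TensorProduct.lift (ρ.comp b) j (fun _ _ => .all _ _) e' = 0 :=
      hι (by rw [map_zero, ← heb, ← he']; exact congr($(hcomm b) e'))
    exact congr($(hcomm' b) e').trans (by simp [h1])

lemma exists_isAlgClosed_ker_eq {R : Type u} [CommRing R] (q : PrimeSpectrum R) :
    ∃ (k : Type u) (_ : Field k) (_ : IsAlgClosed k) (χ : R →+* k), RingHom.ker χ = q.asIdeal := by
  refine ⟨AlgebraicClosure q.asIdeal.ResidueField, inferInstance, inferInstance,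
    (algebraMap q.asIdeal.ResidueField _).comp (algebraMap R q.asIdeal.ResidueField), ?_⟩
  ext x
  rw [RingHom.mem_ker, RingHom.comp_apply, map_eq_zero_iff _ (RingHom.injective _),
    Ideal.algebraMap_residueField_eq_zero]

/-- The set of points at which two sections of a standard étale algebra over affine space lie in
different components of the geometric fiber is closed. -/
theorem HypersurfacePresentation.isClosed_separated (H : HypersurfacePresentation A B)
    [Algebra.Smooth A B] {R : Type u} [CommRing R] [Algebra A R] (a b : B →ₐ[A] R) :
    IsClosed {p : PrimeSpectrum R | ∃ (K : Type u) (_ : Field K) (_ : IsAlgClosed K)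
      (_ : Algebra A K) (φ : R →ₐ[A] K), RingHom.ker φ = p.asIdeal ∧
        Separated (φ.comp a) (φ.comp b)} := by
  set Z := {p : PrimeSpectrum R | ∃ (K : Type u) (_ : Field K) (_ : IsAlgClosed K)
      (_ : Algebra A K) (φ : R →ₐ[A] K), RingHom.ker φ = p.asIdeal ∧
        Separated (φ.comp a) (φ.comp b)} with hZ
  have hex (p : Z) := p.2
  choose K _ _ _ φ hker hsep using hex
  choose F G hFG hFa hGb using fun p => H.exists_factorization _ _ (hsep p)
  have hne (p) := H.map_ne_zero (K p) (algebraMap A (K p))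
  -- A factor of P has at most the total degree of P. This bound is uniform in p, so the
  -- factorizations over the various K p form one factorization over their product.
  obtain ⟨F', hF'⟩ := exists_mvPolynomial_pi K F H.P.totalDegree fun p =>
    (totalDegree_le_of_dvd_of_isDomain ⟨_, hFG p⟩ (hne p)).trans
      (Finset.sup_mono (support_map_subset _ _))
  obtain ⟨G', hG'⟩ := exists_mvPolynomial_pi K G H.P.totalDegree fun p =>
    (totalDegree_le_of_dvd_of_isDomain ⟨F p, by rw [hFG p, mul_comm]⟩ (hne p)).trans
      (Finset.sup_mono (support_map_subset _ _))
  have hFG' : H.P.map (algebraMap A (∀ p, K p)) = F' * G' := mvPolynomial_pi_ext fun p => by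
    rw [map_mul, hF', hG', ← hFG, MvPolynomial.map_map]
    rfl
  have heval (v : Option (Fin H.n) → ∀ p, K p) (p : MvPolynomial (Option (Fin H.n)) (∀ p, K p)) (i) :
      MvPolynomial.eval v p i = MvPolynomial.eval (fun j => v j i) (p.map (Pi.evalRingHom K i)) := by
    have : (Pi.evalRingHom K i).comp (MvPolynomial.eval v) =
        (MvPolynomial.eval (fun j => v j i)).comp (MvPolynomial.map (Pi.evalRingHom K i)) :=
      MvPolynomial.ringHom_ext (by simp) (by simp)
    exact congr($this p)
  obtain ⟨e, he, hee⟩ := H.exists_idempotent F' G' hFG'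
  let Φ : R →ₐ[A] (∀ p, K p) := AlgHom.pi φ
  let := Φ.toRingHom.toAlgebra
  have : IsScalarTower A R (∀ p, K p) := .of_algebraMap_eq' Φ.comp_algebraMap.symm
  let R' := integralClosure R (∀ p, K p)
  let ρ : R →ₐ[A] R' := IsScalarTower.toAlgHom A R R'
  let ι : R' →ₐ[A] (∀ p, K p) := R'.val.restrictScalars A
  have hsepR : Separated ((ι.comp ρ).comp a) ((ι.comp ρ).comp b) := by
    refine ⟨e, he, (hee _).1 ?_, (hee _).2 ?_⟩
    · ext i
      rw [heval, hF']
      exact hFa i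
    · ext i
      rw [heval, hG']
      exact hGb i
  -- The bad locus is the image of Spec R'. A bad point comes from its own projection of the product
  -- to a field; conversely the idempotent, being defined over R', separates the sections at every
  -- prime of R'.
  have hZ' : Z = Set.range (PrimeSpectrum.comap (algebraMap R R')) := by
    ext p
    constructor
    · intro hp
      let χ : R' →+* K ⟨p, hp⟩ := (Pi.evalRingHom K ⟨p, hp⟩).comp R'.val.toRingHom
      refine ⟨PrimeSpectrum.comap χ ⊥, ?_⟩
      ext x
      rw [← hker ⟨p, hp⟩]
      rfl
    · rintro ⟨q, rfl⟩
      obtain ⟨k, _, _, χ', hχ'⟩ := exists_isAlgClosed_ker_eq q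
      let := (χ'.comp (algebraMap A R')).toAlgebra
      let χ : R' →ₐ[A] k := { χ' with commutes' := fun _ => rfl }
      refine ⟨k, inferInstance, inferInstance, inferInstance, χ.comp ρ, ?_, ?_⟩
      · ext x
        change ρ x ∈ RingHom.ker χ' ↔ _
        rw [hχ']
        rfl
      · exact separated_comp_of_separated a b ρ ι Subtype.val_injective
          (fun x hx => ⟨⟨x, hx.tower_top⟩, rfl⟩) hsepR χ
  rw [hZ']
  exact (PrimeSpectrum.isClosedMap_comap_of_isIntegral _
    (algebraMap_isIntegral_iff.mpr inferInstance)).isClosed_range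

end

/-! ### Locally irreducible spaces -/

section Topology

variable {Z : Type*} [TopologicalSpace Z]

/-- A component C meeting an irreducible open U is contained in the closure of U, because C ∩ U is
dense in C. That closure is irreducible, so it equals C and U ⊆ C. -/
lemma isOpen_irreducibleComponent (h : ∀ z : Z, ∃ U, IsOpen U ∧ z ∈ U ∧ IsPreirreducible U) (z : Z) :
    IsOpen (irreducibleComponent z) := by
  rw [isOpen_iff_forall_mem_open]
  intro w hw
  obtain ⟨U, hU, hwU, hUi⟩ := h w
  refine ⟨U, ?_, hU, hwU⟩
  have h1 : irreducibleComponent z ⊆ closure (irreducibleComponent z ∩ U) :=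
    subset_closure_inter_of_isPreirreducible_of_isOpen isIrreducible_irreducibleComponent.2 hU
      ⟨w, hw, hwU⟩
  have h2 : irreducibleComponent z ⊆ closure U :=
    h1.trans (closure_mono Set.inter_subset_right)
  have h3 : closure U = irreducibleComponent z :=
    eq_irreducibleComponent (isPreirreducible_iff_closure.mpr hUi) h2
  exact h3 ▸ subset_closure

lemma connectedComponent_eq_irreducibleComponent
    (h : ∀ z : Z, ∃ U, IsOpen U ∧ z ∈ U ∧ IsPreirreducible U) (z : Z) :
    connectedComponent z = irreducibleComponent z :=
  (IsClopen.connectedComponent_subset ⟨isClosed_irreducibleComponent,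
    isOpen_irreducibleComponent h z⟩ mem_irreducibleComponent).antisymm
      irreducibleComponent_subset_connectedComponent

lemma connectedComponent_eq_of_mem {s : Set Z} (hs : IsPreirreducible s) {x y : Z} (hx : x ∈ s)
    (hy : y ∈ s) : connectedComponent x = connectedComponent y :=
  (connectedComponent_eq (hs.isPreconnected.subset_connectedComponent hx hy))

lemma connectedComponent_map_eq {Z' : Type*} [TopologicalSpace Z'] {m : Z → Z'} (hm : Continuous m)
    {x y : Z} (h : connectedComponent x = connectedComponent y) :
    connectedComponent (m x) = connectedComponent (m y) :=
  (connectedComponent_eq (hm.image_connectedComponent_subset x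
    ⟨y, h ▸ mem_connectedComponent, rfl⟩))

end Topology

/-! ### Smooth morphisms are locally standard étale over affine space -/

lemma exists_chart_Spec {A : Type u} [CommRing A] {Y : Scheme.{u}} (f : Y ⟶ Spec (.of A)) [Smooth f]
    (y : Y) : ∃ (B : Type u) (_ : CommRing B) (_ : Algebra A B) (i : Spec (.of B) ⟶ Y),
      IsOpenImmersion i ∧ y ∈ Set.range i ∧ i ≫ f = Spec.map (CommRingCat.ofHom (algebraMap A B)) ∧
      Algebra.Smooth A B ∧ ∃ (n : ℕ) (_ : Algebra (MvPolynomial (Fin n) A) B),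
        IsScalarTower A (MvPolynomial (Fin n) A) B ∧
        Algebra.IsStandardEtale (MvPolynomial (Fin n) A) B := by
  obtain ⟨_, ⟨U, hU, rfl⟩, hyU, -⟩ :=
    Y.isBasis_affineOpens.exists_subset_of_mem_open (Set.mem_univ y) isOpen_univ
  replace hU : IsAffineOpen U := hU
  let φ : CommRingCat.of A ⟶ Γ(Y, U) := Spec.preimage (hU.fromSpec ≫ f)
  have hφ : Spec.map φ = hU.fromSpec ≫ f := Spec.map_preimage _
  have : Smooth (Spec.map φ) := by rw [hφ]; infer_instance
  have hsm : φ.hom.Smooth := (HasRingHomProperty.Spec_iff (P := @Smooth)).mp this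
  let := φ.hom.toAlgebra
  have : Algebra.Smooth A Γ(Y, U) := hsm
  let p := hU.primeIdealOf ⟨y, hyU⟩
  obtain ⟨g, hg, n, _, hn, het⟩ := Algebra.IsSmoothAt.exists_isStandardEtale_mvPolynomial (R := A)
    (p := p.asIdeal)
  have : Algebra.Smooth A (Localization.Away g) :=
    have : Algebra.Smooth Γ(Y, U) (Localization.Away g) := inferInstance
    .comp A Γ(Y, U) _
  refine ⟨Localization.Away g, inferInstance, inferInstance,
    Spec.map (CommRingCat.ofHom (algebraMap Γ(Y, U) (Localization.Away g))) ≫ hU.fromSpec,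
    ?_, ?_, ?_, inferInstance, n, ‹_›, hn, het⟩
  · infer_instance
  · have : p ∈ Set.range (Spec.map (CommRingCat.ofHom (algebraMap Γ(Y, U) (Localization.Away g)))) := by
      have := PrimeSpectrum.localization_away_comap_range (Localization.Away g) g
      exact this.symm ▸ hg
    obtain ⟨q, hq⟩ := this
    refine ⟨q, ?_⟩
    rw [Scheme.Hom.comp_apply, hq]
    exact hU.fromSpec_primeIdealOf ⟨y, hyU⟩
  · rw [Category.assoc, ← hφ, ← Spec.map_comp]
    rfl

lemma exists_chart {Y S : Scheme.{u}} (f : Y ⟶ S) [Smooth f] {A : Type u} [CommRing A]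
    (j : Spec (.of A) ⟶ S) [IsOpenImmersion j] (y : Y) (hy : f y ∈ Set.range j) :
    ∃ (B : Type u) (_ : CommRing B) (_ : Algebra A B) (i : Spec (.of B) ⟶ Y),
      IsOpenImmersion i ∧ y ∈ Set.range i ∧
      i ≫ f = Spec.map (CommRingCat.ofHom (algebraMap A B)) ≫ j ∧
      Algebra.Smooth A B ∧ ∃ (n : ℕ) (_ : Algebra (MvPolynomial (Fin n) A) B),
        IsScalarTower A (MvPolynomial (Fin n) A) B ∧
        Algebra.IsStandardEtale (MvPolynomial (Fin n) A) B := by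
  obtain ⟨a, ha⟩ := hy
  obtain ⟨z, hz, -⟩ := Scheme.Pullback.exists_preimage_pullback y a ha.symm
  obtain ⟨B, _, _, i, hi, ⟨w, hw⟩, hif, hsm, hn⟩ := exists_chart_Spec (pullback.snd f j) z
  refine ⟨B, _, _, i ≫ pullback.fst f j, inferInstance, ⟨w, ?_⟩, ?_, hsm, hn⟩
  · rw [Scheme.Hom.comp_apply, hw, hz]
  · rw [Category.assoc, pullback.condition, reassoc_of% hif]

lemma exists_isOpen_isPreirreducible {K : Type u} [Field K] {Z : Scheme.{u}}
    (f : Z ⟶ Spec (.of K)) [Smooth f] (z : Z) :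
    ∃ U : Set Z, IsOpen U ∧ z ∈ U ∧ IsPreirreducible U := by
  obtain ⟨B, _, _, i, hi, ⟨q, rfl⟩, -, -, n, _, _, _⟩ := exists_chart_Spec f z
  obtain ⟨H⟩ := exists_hypersurfacePresentation (A := K) (B := B) (n := n)
  obtain ⟨G, hG, hirr⟩ := H.exists_isPreirreducible_basicOpen q
  exact ⟨i '' (PrimeSpectrum.basicOpen G : Set (PrimeSpectrum B)),
    i.isOpenEmbedding.isOpenMap _ (PrimeSpectrum.basicOpen G).isOpen, ⟨q, hG, rfl⟩,
    hirr.image _ i.continuous.continuousOn⟩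

/-! ### Points of schemes over algebraically closed fields -/

section

variable {K : Type u} [Field K] {Z : Scheme.{u}} (f : Z ⟶ Spec (.of K))

lemma isOpen_connectedComponent_of_smooth [Smooth f] (z : Z) : IsOpen (connectedComponent z) := by
  rw [connectedComponent_eq_irreducibleComponent (exists_isOpen_isPreirreducible f)]
  exact isOpen_irreducibleComponent (exists_isOpen_isPreirreducible f) z

lemma isPreirreducible_connectedComponent_of_smooth [Smooth f] (z : Z) :
    IsPreirreducible (connectedComponent z) := by
  rw [connectedComponent_eq_irreducibleComponent (exists_isOpen_isPreirreducible f)]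
  exact isIrreducible_irreducibleComponent.2

lemma exists_isClosed_mem_of_isOpen [LocallyOfFiniteType f] {U : Set Z} (hU : IsOpen U)
    (hne : U.Nonempty) : ∃ z ∈ U, IsClosed {z} := by
  have : JacobsonSpace Z := LocallyOfFiniteType.jacobsonSpace f
  obtain ⟨z, hz, hz'⟩ := nonempty_inter_closedPoints hne hU.isLocallyClosed
  exact ⟨z, hz, hz'⟩

/-- By the Jacobson property a nonempty open subset contains a closed point, and closed points are
rational over an algebraically closed field. -/
lemma exists_point_mem_of_isOpen [IsAlgClosed K] [LocallyOfFiniteType f] {U : Set Z} (hU : IsOpen U)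
    (hne : U.Nonempty) : ∃ z : Spec (.of K) ⟶ Z, z ≫ f = 𝟙 _ ∧ ∀ p, z p ∈ U := by
  obtain ⟨z, hz, hz'⟩ := exists_isClosed_mem_of_isOpen f hU hne
  exact ⟨pointOfClosedPoint f z hz', by simp, fun p => by simpa⟩

/-- Irreducible open subsets of a scheme over an algebraically closed field remain irreducible after
extension of the field. -/
lemma isPreirreducible_preimage_of_isPullback [IsAlgClosed K] [LocallyOfFiniteType f] {L : Type u}
    [Field L] {Z' : Scheme.{u}} {m : Z' ⟶ Z} {f' : Z' ⟶ Spec (.of L)}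
    {i : Spec (.of L) ⟶ Spec (.of K)}
    (h : IsPullback m f' f i) {U : Set Z} (hU : IsOpen U) (hU' : IsPreirreducible U) :
    IsPreirreducible (m ⁻¹' U) := by
  have : UniversallyOpen m := MorphismProperty.of_isPullback h.flip inferInstance
  -- Since m is open, it is enough that the fibers over a dense subset of U are irreducible. The
  -- K-rational points are dense, and the fiber over such a point is Spec L.
  refine hU'.preimage_of_dense_isPreirreducible_fiber m m.isOpenMap ?_
  rw [Set.subset_def]
  intro x hx
  rw [mem_closure_iff]
  intro V hV hxV
  obtain ⟨z, hz, hzV⟩ := exists_point_mem_of_isOpen f (hV.inter hU) ⟨x, hxV, hx⟩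
  refine ⟨z default, (hzV _).1, (hzV _).2, ?_⟩
  have hpb : IsPullback (pullback.fst m z) (pullback.snd m z) m z := IsPullback.of_hasPullback _ _
  have h2 := hpb.flip.paste_vert h
  have hz2 : IsIso (z ≫ f) := by rw [hz]; infer_instance
  have : IsIso (pullback.fst m z ≫ f') := h2.isIso_snd_of_isIso
  have hsub : Subsingleton ↥(pullback m z) :=
    (pullback.fst m z ≫ f').isOpenEmbedding.injective.subsingleton
  have hr : m ⁻¹' {z default} = Set.range (pullback.fst m z) := by
    rw [Scheme.Pullback.range_fst]
    congr 1
    ext w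
    constructor
    · rintro rfl; exact ⟨_, rfl⟩
    · rintro ⟨p, rfl⟩; rw [Subsingleton.elim p default]; rfl
  rw [Set.mem_ofPred_eq, hr]
  exact (Set.subsingleton_range _).isPreirreducible

end

/-! ### The relation on geometric points -/

/-- Two points with values in a field lie in the same component of a fiber. -/
def Rel {Y S : Scheme.{u}} (f : Y ⟶ S) {K : Type u} [Field K] (x y : Spec (.of K) ⟶ Y) : Prop :=
  ∃ h : x ≫ f = y ≫ f, connectedComponent (fiberPoint f x (x ≫ f) rfl) =
    connectedComponent (fiberPoint f y (x ≫ f) h.symm)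

lemma rel_iff {Y S : Scheme.{u}} {f : Y ⟶ S} {K : Type u} [Field K] {x y : Spec (.of K) ⟶ Y}
    {s : Spec (.of K) ⟶ S} (hx : x ≫ f = s) (hy : y ≫ f = s) :
    Rel f x y ↔ connectedComponent (fiberPoint f x s hx) =
      connectedComponent (fiberPoint f y s hy) := by
  subst hx
  exact ⟨fun ⟨_, h⟩ => h, fun h => ⟨hy.symm, h⟩⟩

lemma sameComponent_iff {Y S : Scheme.{u}} {f : Y ⟶ S} {U : Scheme.{u}} {a b : U ⟶ Y} :
    SameComponent f a b ↔ a ≫ f = b ≫ f ∧ ∀ (K : Type u) [Field K] [IsAlgClosed K]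
      (t : Spec (.of K) ⟶ U), Rel f (t ≫ a) (t ≫ b) := by
  refine and_congr_right fun h => ⟨fun H K _ _ t => ?_, fun H K _ _ t s ha hb => ?_⟩
  · exact (rel_iff rfl (by simp [h])).mpr (H K t _ _ _)
  · exact (rel_iff ha hb).mp (H K t)

namespace Rel

variable {Y S : Scheme.{u}} {f : Y ⟶ S} {K : Type u} [Field K] {x y z : Spec (.of K) ⟶ Y}

lemma comp_eq (h : Rel f x y) : x ≫ f = y ≫ f := h.1

lemma refl (f : Y ⟶ S) (x : Spec (.of K) ⟶ Y) : Rel f x x := ⟨rfl, rfl⟩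

lemma symm (h : Rel f x y) : Rel f y x :=
  (rel_iff rfl h.1).mpr ((rel_iff h.1 rfl).mp h).symm

lemma trans (h : Rel f x y) (h' : Rel f y z) : Rel f x z := by
  rw [rel_iff rfl (h.1.trans h'.1).symm]
  exact ((rel_iff rfl h.1.symm).mp h).trans ((rel_iff h.1.symm (h.1.trans h'.1).symm).mp h')

/-- A commutative square induces a continuous map of geometric fibers, also when the field is
enlarged, and continuous maps preserve connected components. -/
lemma map {Y' S' : Scheme.{u}} {f' : Y' ⟶ S'} {L : Type u} [Field L]
    {x' y' : Spec (.of L) ⟶ Y'} (h : Rel f' x' y') (i : Spec (.of L) ⟶ Spec (.of K))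
    (p : Y' ⟶ Y) (q : S' ⟶ S) (hpq : p ≫ f = f' ≫ q) (hx : x' ≫ p = i ≫ x) (hy : y' ≫ p = i ≫ y)
    (hxy : x ≫ f = y ≫ f) : Rel f x y := by
  rw [rel_iff rfl hxy.symm]
  let m : pullback f' (x' ≫ f') ⟶ pullback f (x ≫ f) :=
    pullback.lift (pullback.fst _ _ ≫ p) (pullback.snd _ _ ≫ i) (by
      rw [Category.assoc, hpq, pullback.condition_assoc, Category.assoc, Category.assoc,
        ← hpq, reassoc_of% hx])
  have hx' : m (fiberPoint f' x' (x' ≫ f') rfl) = fiberPoint f x (x ≫ f) rfl := by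
    have : pullback.lift x' (𝟙 _) (by simp) ≫ m = i ≫ pullback.lift x (𝟙 _) (by simp) := by
      apply pullback.hom_ext <;> simp [m, hx]
    exact congr($this default).trans (by
      rw [Scheme.Hom.comp_apply, Subsingleton.elim (i default) default]; rfl)
  have hy' : m (fiberPoint f' y' (x' ≫ f') h.1.symm) = fiberPoint f y (x ≫ f) hxy.symm := by
    have : pullback.lift y' (𝟙 _) (by simp [h.1]) ≫ m =
        i ≫ pullback.lift y (𝟙 _) (by simp [hxy]) := by
      apply pullback.hom_ext <;> simp [m, hy]
    exact congr($this default).trans (by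
      rw [Scheme.Hom.comp_apply, Subsingleton.elim (i default) default]; rfl)
  rw [← hx', ← hy']
  exact connectedComponent_map_eq m.continuous h.2

/-- The geometric fibers of a base change are those of f itself, so there is also a map back from
the fiber of f to that of f'. -/
lemma of_isPullback {Y' S' : Scheme.{u}} {f' : Y' ⟶ S'} {p : Y' ⟶ Y} {q : S' ⟶ S}
    (hpb : IsPullback p f' f q) {x' y' : Spec (.of K) ⟶ Y'} (hxy : x' ≫ f' = y' ≫ f')
    (h : Rel f (x' ≫ p) (y' ≫ p)) : Rel f' x' y' := by
  rw [rel_iff rfl hxy.symm]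
  let m : pullback f ((x' ≫ p) ≫ f) ⟶ pullback f' (x' ≫ f') :=
    pullback.lift (hpb.lift (pullback.fst _ _) (pullback.snd _ _ ≫ x' ≫ f') (by
      rw [pullback.condition]
      simp [hpb.w])) (pullback.snd _ _) (by simp)
  have hx' : m (fiberPoint f (x' ≫ p) _ rfl) = fiberPoint f' x' _ rfl := by
    have : pullback.lift (x' ≫ p) (𝟙 _) (by simp) ≫ m = pullback.lift x' (𝟙 _) (by simp) := by
      apply pullback.hom_ext
      · apply hpb.hom_ext <;> simp [m]
      · simp [m]
    exact congr($this default)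
  have hy' : m (fiberPoint f (y' ≫ p) _ h.1.symm) = fiberPoint f' y' _ hxy.symm := by
    have : pullback.lift (y' ≫ p) (𝟙 _) (by simp [h.1]) ≫ m =
        pullback.lift y' (𝟙 _) (by simp [hxy]) := by
      apply pullback.hom_ext
      · apply hpb.hom_ext <;> simp [m, hxy]
      · simp [m]
    exact congr($this default)
  rw [← hx', ← hy']
  exact connectedComponent_map_eq m.continuous h.2

lemma iff_of_isPullback {Y' S' : Scheme.{u}} {f' : Y' ⟶ S'} {p : Y' ⟶ Y} {q : S' ⟶ S}
    (hpb : IsPullback p f' f q) {x' y' : Spec (.of K) ⟶ Y'} (hxy : x' ≫ f' = y' ≫ f') :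
    Rel f' x' y' ↔ Rel f (x' ≫ p) (y' ≫ p) :=
  ⟨fun h => h.map (𝟙 _) p q hpb.w (by simp) (by simp) (by
    rw [Category.assoc, Category.assoc, hpb.w, reassoc_of% hxy]), of_isPullback hpb hxy⟩

/-- Independence of the algebraically closed field. The component over K is open and irreducible,
hence its preimage over L is still irreducible and in particular connected. -/
lemma comp_iff [Smooth f] [IsAlgClosed K] {L : Type u} [Field L]
    (i : Spec (.of L) ⟶ Spec (.of K)) (hxy : x ≫ f = y ≫ f) :
    Rel f (i ≫ x) (i ≫ y) ↔ Rel f x y := by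
  refine ⟨fun h => h.map i (𝟙 _) (𝟙 _) (by simp) (by simp) (by simp) hxy, fun h => ?_⟩
  have hx1 : i ≫ x ≫ f = (i ≫ x) ≫ f := by simp
  have hy1 : (i ≫ y) ≫ f = (i ≫ x) ≫ f := by simp [hxy]
  rw [rel_iff rfl hy1]
  let m : pullback f ((i ≫ x) ≫ f) ⟶ pullback f (x ≫ f) :=
    pullback.lift (pullback.fst _ _) (pullback.snd _ _ ≫ i) (by simp [pullback.condition])
  have hm : IsPullback m (pullback.snd _ _) (pullback.snd f (x ≫ f)) i := by
    refine IsPullback.of_right (t := IsPullback.of_hasPullback f (x ≫ f)) ?_ (by simp [m])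
    have := IsPullback.of_hasPullback f ((i ≫ x) ≫ f)
    simpa [m] using this
  have hx' : m (fiberPoint f (i ≫ x) _ rfl) = fiberPoint f x _ rfl := by
    have : pullback.lift (i ≫ x) (𝟙 _) (by simp) ≫ m = i ≫ pullback.lift x (𝟙 _) (by simp) := by
      apply pullback.hom_ext <;> simp [m]
    exact congr($this default).trans (by
      rw [Scheme.Hom.comp_apply, Subsingleton.elim (i default) default]; rfl)
  have hy' : m (fiberPoint f (i ≫ y) _ hy1) = fiberPoint f y _ hxy.symm := by
    have : pullback.lift (i ≫ y) (𝟙 _) (by simp [hxy]) ≫ m =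
        i ≫ pullback.lift y (𝟙 _) (by simp [hxy]) := by
      apply pullback.hom_ext <;> simp [m]
    exact congr($this default).trans (by
      rw [Scheme.Hom.comp_apply, Subsingleton.elim (i default) default]; rfl)
  let C := connectedComponent (fiberPoint f x (x ≫ f) rfl)
  refine connectedComponent_eq_of_mem (s := m ⁻¹' C)
    (isPreirreducible_preimage_of_isPullback _ hm (isOpen_connectedComponent_of_smooth
      (pullback.snd f (x ≫ f)) _) (isPreirreducible_connectedComponent_of_smooth
      (pullback.snd f (x ≫ f)) _)) ?_ ?_
  · rw [Set.mem_preimage, hx']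
    exact mem_connectedComponent
  · rw [Set.mem_preimage, hy', ← connectedComponent_eq_iff_mem]
    exact h.2.symm

end Rel

/-! ### Geometric points -/

lemma exists_geometricPoint {T : Scheme.{u}} (t : T) : ∃ (K : Type u) (_ : Field K)
    (_ : IsAlgClosed K) (τ : Spec (.of K) ⟶ T), ∀ p, τ p = t := by
  refine ⟨AlgebraicClosure (T.residueField t), inferInstance, inferInstance,
    Spec.map (CommRingCat.ofHom (algebraMap (T.residueField t) _)) ≫ T.fromSpecResidueField t, ?_⟩
  intro p
  rw [Scheme.Hom.comp_apply]
  exact T.fromSpecResidueField_apply t _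

/-- Two field-valued points with the same image meet in a point of the fiber product; M is an
algebraic closure of its residue field. -/
lemma exists_common_geometricPoint {T : Scheme.{u}} {K L : Type u} [Field K] [Field L]
    (p : Spec (.of K) ⟶ T) (q : Spec (.of L) ⟶ T) (h : p default = q default) :
    ∃ (M : Type u) (_ : Field M) (_ : IsAlgClosed M) (i : Spec (.of M) ⟶ Spec (.of K))
      (j : Spec (.of M) ⟶ Spec (.of L)), i ≫ p = j ≫ q := by
  obtain ⟨z, -⟩ := Scheme.Pullback.exists_preimage_pullback _ _ h
  obtain ⟨M, _, _, τ, -⟩ := exists_geometricPoint z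
  exact ⟨M, _, inferInstance, τ ≫ pullback.fst _ _, τ ≫ pullback.snd _ _, by
    simp [pullback.condition]⟩

section

variable {Y S T : Scheme.{u}} (f : Y ⟶ S) (a b : T ⟶ Y)

/-- The set of points at which two sections lie in the same component of the geometric fiber. -/
def relLocus : Set T :=
  {t | ∃ (K : Type u) (_ : Field K) (_ : IsAlgClosed K) (τ : Spec (.of K) ⟶ T),
    τ default = t ∧ Rel f (τ ≫ a) (τ ≫ b)}

variable {f a b}

/-- Two geometric points over the same t are dominated by a third, and `Rel.comp_iff` moves the
relation between them. Membership can therefore be tested at any single geometric point. -/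
lemma mem_relLocus_iff [Smooth f] (hab : a ≫ f = b ≫ f) {K : Type u} [Field K] [IsAlgClosed K]
    (τ : Spec (.of K) ⟶ T) : τ default ∈ relLocus f a b ↔ Rel f (τ ≫ a) (τ ≫ b) := by
  refine ⟨fun ⟨L, _, _, σ, h, hσ⟩ => ?_, fun h => ⟨K, _, inferInstance, τ, rfl, h⟩⟩
  obtain ⟨M, _, _, i, j, hij⟩ := exists_common_geometricPoint σ τ h
  rw [← Rel.comp_iff i (by simp [hab]), reassoc_of% hij, reassoc_of% hij] at hσ
  exact (Rel.comp_iff j (by simp [hab])).mp hσ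

lemma preimage_relLocus [Smooth f] (hab : a ≫ f = b ≫ f) {T' : Scheme.{u}} (g : T' ⟶ T) :
    g ⁻¹' (relLocus f a b) = relLocus f (g ≫ a) (g ≫ b) := by
  ext t
  obtain ⟨K, _, _, τ, hτ⟩ := exists_geometricPoint t
  rw [← hτ default, mem_relLocus_iff (by simp [hab]), Set.mem_preimage, ← Scheme.Hom.comp_apply,
    mem_relLocus_iff hab]
  simp

lemma sameComponent_iff_relLocus [Smooth f] (hab : a ≫ f = b ≫ f) :
    SameComponent f a b ↔ relLocus f a b = Set.univ := by
  rw [sameComponent_iff, and_iff_right hab, Set.eq_univ_iff_forall]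
  refine ⟨fun h t => ?_, fun h K _ _ τ => (mem_relLocus_iff hab τ).mp (h _)⟩
  obtain ⟨K, _, _, τ, hτ⟩ := exists_geometricPoint t
  exact ⟨K, _, inferInstance, τ, hτ _, h K τ⟩

end

/-! ### Openness of the locus where two sections share a component -/

open TensorProduct

lemma rel_iff_of_sections {K : Type u} [Field K] {Z : Scheme.{u}} {f : Z ⟶ Spec (.of K)}
    {x y : Spec (.of K) ⟶ Z} (hx : x ≫ f = 𝟙 _) (hy : y ≫ f = 𝟙 _) :
    Rel f x y ↔ connectedComponent (x default) = connectedComponent (y default) := by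
  rw [rel_iff hx hy]
  let i : Z ⟶ pullback f (𝟙 _) := pullback.lift (𝟙 _) f (by simp)
  have hfst (x : Spec (.of K) ⟶ Z) (hx : x ≫ f = 𝟙 _) :
      pullback.fst f (𝟙 _) (fiberPoint f x _ hx) = x default := by
    have : pullback.lift x (𝟙 _) (by simpa using hx) ≫ pullback.fst f (𝟙 _) = x := by simp
    exact congr($this default)
  have hi (x : Spec (.of K) ⟶ Z) (hx : x ≫ f = 𝟙 _) :
      i (x default) = fiberPoint f x _ hx := by
    have : x ≫ i = pullback.lift x (𝟙 _) (by simpa using hx) := by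
      apply pullback.hom_ext <;> simp [i, hx]
    exact congr($this default)
  constructor
  · intro h
    rw [← hfst x hx, ← hfst y hy]
    exact connectedComponent_map_eq (pullback.fst f (𝟙 _)).continuous h
  · intro h
    rw [← hi x hx, ← hi y hy]
    exact connectedComponent_map_eq i.continuous h

lemma rel_iff_of_isPullback {Y S Z : Scheme.{u}} {f : Y ⟶ S} {K : Type u} [Field K]
    {s : Spec (.of K) ⟶ S} {p : Z ⟶ Y} {q : Z ⟶ Spec (.of K)} (hpb : IsPullback p q f s)
    {x y : Spec (.of K) ⟶ Z} (hx : x ≫ q = 𝟙 _) (hy : y ≫ q = 𝟙 _) :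
    Rel f (x ≫ p) (y ≫ p) ↔ connectedComponent (x default) = connectedComponent (y default) := by
  rw [← rel_iff_of_sections hx hy, Rel.iff_of_isPullback hpb (hx.trans hy.symm)]

/-- Components of a smooth fiber are clopen, so in the affine fiber Spec (B ⊗ K) they are cut out by
idempotents. This translates the algebraic criterion into the geometric relation. -/
lemma separated_iff {A B K : Type u} [CommRing A] [CommRing B] [Algebra A B] [Algebra.Smooth A B]
    [Field K] [Algebra A K] (α β : B →ₐ[A] K) :
    Separated α β ↔ ¬ Rel (Spec.map (CommRingCat.ofHom (algebraMap A B)))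
      (Spec.map (CommRingCat.ofHom α.toRingHom)) (Spec.map (CommRingCat.ofHom β.toRingHom)) := by
  have hpb := isPullback_SpecMap_of_isPushout _ _ _ _ (CommRingCat.isPushout_tensorProduct A B K)
  have hsm : Smooth (Spec.map (CommRingCat.ofHom (algebraMap A B))) := by
    rw [HasRingHomProperty.Spec_iff (P := @Smooth)]
    exact RingHom.smooth_algebraMap.mpr inferInstance
  have : Smooth (Spec.map (CommRingCat.ofHom
      (Algebra.TensorProduct.includeRight : K →ₐ[A] B ⊗[A] K).toRingHom)) :=
    MorphismProperty.of_isPullback hpb hsm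
  have h1 (α : B →ₐ[A] K) : Spec.map (CommRingCat.ofHom (evalPoint α).toRingHom) ≫ Spec.map (CommRingCat.ofHom
      (Algebra.TensorProduct.includeRight : K →ₐ[A] B ⊗[A] K).toRingHom) = 𝟙 _ := by
    rw [← Spec.map_comp, ← Spec.map_id]
    congr 1
    ext x
    simp
  have h2 (α : B →ₐ[A] K) : Spec.map (CommRingCat.ofHom (evalPoint α).toRingHom) ≫ Spec.map (CommRingCat.ofHom
      (Algebra.TensorProduct.includeLeft : B →ₐ[A] B ⊗[A] K).toRingHom) =
      Spec.map (CommRingCat.ofHom α.toRingHom) := by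
    rw [← Spec.map_comp]
    congr 1
    ext x
    simp
  have := rel_iff_of_isPullback hpb (h1 α) (h1 β)
  erw [h2, h2] at this
  rw [this]
  have hmem (α : B →ₐ[A] K) (e : B ⊗[A] K) :
      Spec.map (CommRingCat.ofHom (evalPoint α).toRingHom) default ∈
        (PrimeSpectrum.basicOpen e : Set (PrimeSpectrum (B ⊗[A] K))) ↔ evalPoint α e ≠ 0 := by
    have : (default : Spec (.of K)) = (⊥ : PrimeSpectrum K) := Subsingleton.elim _ _
    rw [this]
    exact Iff.rfl
  constructor
  · rintro ⟨e, he, h1, h0⟩ h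
    have hcl := PrimeSpectrum.isClopen_iff.mpr ⟨e, he, rfl⟩
    have ha := (hmem α e).mpr (by rw [h1]; exact one_ne_zero)
    have := hcl.connectedComponent_subset ha
    have hb := this (h.symm ▸ mem_connectedComponent)
    exact (hmem β e).mp hb h0
  · intro h
    obtain ⟨e, he, hC⟩ := PrimeSpectrum.isClopen_iff.mp ⟨isClosed_connectedComponent,
      isOpen_connectedComponent_of_smooth (Spec.map (CommRingCat.ofHom
      (Algebra.TensorProduct.includeRight : K →ₐ[A] B ⊗[A] K).toRingHom))
      (Spec.map (CommRingCat.ofHom (evalPoint α).toRingHom) default)⟩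
    have h3 (α : B →ₐ[A] K) : evalPoint α e = 0 ∨ evalPoint α e = 1 := by
      exact IsIdempotentElem.iff_eq_zero_or_one.mp (he.map (evalPoint α))
    refine ⟨e, he, (h3 α).resolve_left ((hmem α e).mp ?_), not_not.mp fun h0 => h ?_⟩
    · exact hC ▸ mem_connectedComponent
    · refine connectedComponent_eq ?_
      exact hC ▸ (hmem β e).mpr h0

/-- The locus at which two sections lie in the same component is open, for a standard étale algebra
over affine space. -/
lemma isOpen_relLocus_of_hypersurfacePresentation_affine {A B R : Type u} [CommRing A] [CommRing B]
    [Algebra A B] [Algebra.Smooth A B] (H : HypersurfacePresentation A B) [CommRing R] [Algebra A R]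
    (a b : B →ₐ[A] R) :
    IsOpen (relLocus (Spec.map (CommRingCat.ofHom (algebraMap A B)))
      (Spec.map (CommRingCat.ofHom a.toRingHom)) (Spec.map (CommRingCat.ofHom b.toRingHom))) := by
  have hsm : Smooth (Spec.map (CommRingCat.ofHom (algebraMap A B))) := by
    rw [HasRingHomProperty.Spec_iff (P := @Smooth)]
    exact RingHom.smooth_algebraMap.mpr inferInstance
  rw [← isClosed_compl_iff]
  have hab : Spec.map (CommRingCat.ofHom a.toRingHom) ≫ Spec.map (CommRingCat.ofHom (algebraMap A B)) =
      Spec.map (CommRingCat.ofHom b.toRingHom) ≫ Spec.map (CommRingCat.ofHom (algebraMap A B)) := by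
    rw [← Spec.map_comp, ← Spec.map_comp]
    congr 1
    ext x
    simp
  have key (K : Type u) [Field K] [IsAlgClosed K] [Algebra A K] (φ : R →ₐ[A] K) :
      Spec.map (CommRingCat.ofHom φ.toRingHom) default ∈ relLocus (Spec.map (CommRingCat.ofHom (algebraMap A B)))
      (Spec.map (CommRingCat.ofHom a.toRingHom)) (Spec.map (CommRingCat.ofHom b.toRingHom)) ↔
      ¬ Separated (φ.comp a) (φ.comp b) := by
    rw [mem_relLocus_iff hab, separated_iff, not_not, ← Spec.map_comp, ← Spec.map_comp]
    rfl
  have key2 (K : Type u) [Field K] (φ : R →+* K) (p : PrimeSpectrum R)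
      (hφ : RingHom.ker φ = p.asIdeal) : Spec.map (CommRingCat.ofHom φ) default = p := by
    have : (default : Spec (.of K)) = (⊥ : PrimeSpectrum K) := Subsingleton.elim _ _
    rw [this]
    refine PrimeSpectrum.ext ?_
    ext x
    rw [← hφ]
    rfl
  refine (congrArg IsClosed (Set.ext fun p : PrimeSpectrum R => ?_)).mpr (H.isClosed_separated a b)
  constructor
  · intro hp
    obtain ⟨K, _, _, φ', hφ⟩ := exists_isAlgClosed_ker_eq p
    let := (φ'.comp (algebraMap A R)).toAlgebra
    let φ : R →ₐ[A] K := { φ' with commutes' := fun _ => rfl }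
    refine ⟨K, _, inferInstance, inferInstance, φ, hφ, ?_⟩
    rw [← key2 K φ' p hφ] at hp
    exact not_not.mp (fun h => hp ((key K φ).mpr h))
  · rintro ⟨K, _, _, _, φ, hφ, hs⟩ hp
    rw [← key2 K φ p hφ] at hp
    exact (key K φ).mp hp hs

lemma isOpen_of_forall_affine {T : Scheme.{u}} {V : Set T}
    (h : ∀ (R : Type u) [CommRing R] (j : Spec (.of R) ⟶ T) [IsOpenImmersion j],
      IsOpen (j ⁻¹' V)) : IsOpen V := by
  rw [isOpen_iff_forall_mem_open]
  intro t ht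
  obtain ⟨_, ⟨U, hU, rfl⟩, hyU, -⟩ :=
    T.isBasis_affineOpens.exists_subset_of_mem_open (Set.mem_univ t) isOpen_univ
  replace hU : IsAffineOpen U := hU
  refine ⟨hU.fromSpec '' (hU.fromSpec ⁻¹' V), Set.image_preimage_subset _ _,
    hU.fromSpec.isOpenEmbedding.isOpenMap _ (h Γ(T, U) hU.fromSpec), hU.primeIdealOf ⟨t, hyU⟩, ?_,
      hU.fromSpec_primeIdealOf ⟨t, hyU⟩⟩
  exact (congrArg (· ∈ V) (hU.fromSpec_primeIdealOf ⟨t, hyU⟩)).mpr ht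

lemma isOpen_relLocus_of_hypersurfacePresentation {A B : Type u} [CommRing A] [CommRing B]
    [Algebra A B] [Algebra.Smooth A B] (H : HypersurfacePresentation A B) {T : Scheme.{u}}
    (a b : T ⟶ Spec (.of B)) (hab : a ≫ Spec.map (CommRingCat.ofHom (algebraMap A B)) =
      b ≫ Spec.map (CommRingCat.ofHom (algebraMap A B))) :
    IsOpen (relLocus (Spec.map (CommRingCat.ofHom (algebraMap A B))) a b) := by
  have hsm : Smooth (Spec.map (CommRingCat.ofHom (algebraMap A B))) := by
    rw [HasRingHomProperty.Spec_iff (P := @Smooth)]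
    exact RingHom.smooth_algebraMap.mpr inferInstance
  refine isOpen_of_forall_affine fun R _ j _ => ?_
  rw [preimage_relLocus hab]
  let α := Spec.preimage (j ≫ a)
  let β := Spec.preimage (j ≫ b)
  have hα : Spec.map α = j ≫ a := Spec.map_preimage _
  have hβ : Spec.map β = j ≫ b := Spec.map_preimage _
  have h1 : CommRingCat.ofHom (algebraMap A B) ≫ α = CommRingCat.ofHom (algebraMap A B) ≫ β := by
    apply Spec.map_injective
    rw [Spec.map_comp, Spec.map_comp, hα, hβ, Category.assoc, Category.assoc, hab]
  let := (α.hom.comp (algebraMap A B)).toAlgebra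
  have := isOpen_relLocus_of_hypersurfacePresentation_affine H (R := R)
    { α.hom with commutes' := fun _ => rfl } { β.hom with commutes' := fun x => congr($(h1.symm) x) }
  rw [← hα, ← hβ]
  exact this

lemma isPullback_id_of_mono {U S S' : Scheme.{u}} (g : U ⟶ S') (j : S' ⟶ S) [Mono j] :
    IsPullback (𝟙 U) g (g ≫ j) j := by
  refine IsPullback.of_isLimit' ⟨by simp⟩ (PullbackCone.IsLimit.mk _ (fun s => s.fst)
    (by simp) (fun s => ?_) fun s m h _ => by simpa using h)
  rw [← cancel_mono j, Category.assoc, s.condition]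

/-- Components of smooth fibers are irreducible, so the trace of a component on an open subscheme is
irreducible and cannot break up. For merely connected components this would fail. -/
lemma Rel.of_isOpenImmersion {Y S U S' : Scheme.{u}} {f : Y ⟶ S} [Smooth f] {i : U ⟶ Y}
    [IsOpenImmersion i] {g : U ⟶ S'} {j : S' ⟶ S} [Mono j] (h : i ≫ f = g ≫ j) {K : Type u}
    [Field K] {x y : Spec (.of K) ⟶ U} (hxy : Rel f (x ≫ i) (y ≫ i)) : Rel g x y := by
  have hg : x ≫ g = y ≫ g := by
    rw [← cancel_mono j, Category.assoc, Category.assoc, ← h, ← Category.assoc, hxy.1,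
      Category.assoc]
  refine Rel.of_isPullback (isPullback_id_of_mono g j) hg ?_
  rw [Category.comp_id, Category.comp_id, ← h, rel_iff (Category.assoc _ _ _).symm (by
    rw [← Category.assoc, hxy.1])]
  let s := (x ≫ i) ≫ f
  let m : pullback (i ≫ f) s ⟶ pullback f s :=
    pullback.lift (pullback.fst _ _ ≫ i) (pullback.snd _ _) (by
      rw [Category.assoc, pullback.condition])
  have hm : IsPullback (pullback.fst _ _) m i (pullback.fst f s) := by
    refine IsPullback.of_bot (t := IsPullback.of_hasPullback f s) ?_ (by simp [m])
    have := IsPullback.of_hasPullback (i ≫ f) s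
    simpa [m] using this
  have : IsOpenImmersion m := MorphismProperty.of_isPullback hm inferInstance
  have hmp (x : Spec (.of K) ⟶ U) (hx : x ≫ i ≫ f = s) (hx' : (x ≫ i) ≫ f = s) :
      m (fiberPoint (i ≫ f) x s hx) = fiberPoint f (x ≫ i) s hx' := by
    have : pullback.lift x (𝟙 _) (by simpa using hx) ≫ m =
        pullback.lift (x ≫ i) (𝟙 _) (by simpa using hx) := by
      apply pullback.hom_ext <;> simp [m]
    exact congr($this default)
  refine connectedComponent_eq_of_mem (s := m ⁻¹' (connectedComponent (fiberPoint f (x ≫ i) s rfl)))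
    ((isPreirreducible_connectedComponent_of_smooth (pullback.snd f s) _).preimage
      m.isOpenEmbedding) ?_ ?_
  · rw [Set.mem_preimage, hmp x _ rfl]
    exact mem_connectedComponent
  · rw [Set.mem_preimage, hmp y _ hxy.1.symm, ← connectedComponent_eq_iff_mem]
    exact hxy.2.symm

lemma Rel.iff_of_isOpenImmersion {Y S U S' : Scheme.{u}} {f : Y ⟶ S} [Smooth f] {i : U ⟶ Y}
    [IsOpenImmersion i] {g : U ⟶ S'} {j : S' ⟶ S} [Mono j] (h : i ≫ f = g ≫ j) {K : Type u}
    [Field K] {x y : Spec (.of K) ⟶ U} : Rel f (x ≫ i) (y ≫ i) ↔ Rel g x y :=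
  ⟨.of_isOpenImmersion h, fun hxy => hxy.map (𝟙 _) i j h (by simp) (by simp) (by
    rw [Category.assoc, Category.assoc, h, ← Category.assoc, hxy.1, Category.assoc])⟩

lemma relLocus_eq_of_isOpenImmersion {Y S U S' T : Scheme.{u}} {f : Y ⟶ S} [Smooth f] {i : U ⟶ Y}
    [IsOpenImmersion i] {g : U ⟶ S'} {j : S' ⟶ S} [Mono j] (h : i ≫ f = g ≫ j) (a b : T ⟶ U) :
    relLocus f (a ≫ i) (b ≫ i) = relLocus g a b := by
  unfold relLocus
  simp only [← Category.assoc, Rel.iff_of_isOpenImmersion h]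

/-- If two points lie in the same component of the fiber, then the component contains a point in the
intersection of given neighbourhoods. -/
lemma Rel.exists_mem {Y S : Scheme.{u}} {f : Y ⟶ S} [Smooth f] {K : Type u} [Field K]
    [IsAlgClosed K] {x y : Spec (.of K) ⟶ Y} (h : Rel f x y) (U V : Y.Opens) (hx : x default ∈ U)
    (hy : y default ∈ V) : ∃ z : Spec (.of K) ⟶ Y, z default ∈ U ⊓ V ∧ Rel f x z ∧ Rel f y z := by
  let s := x ≫ f
  let C := connectedComponent (fiberPoint f x s rfl)
  have hC : IsOpen C := isOpen_connectedComponent_of_smooth (pullback.snd f s) _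
  have hfst (x : Spec (.of K) ⟶ Y) (hx : x ≫ f = s) :
      pullback.fst f s (fiberPoint f x s hx) = x default := by
    have : pullback.lift x (𝟙 _) (by simpa using hx) ≫ pullback.fst f s = x := by simp
    exact congr($this default)
  -- The common component is irreducible, so its nonempty open parts inside U and V intersect.
  obtain ⟨w, hwC, hwU, hwV⟩ := isPreirreducible_connectedComponent_of_smooth (pullback.snd f s)
    (fiberPoint f x s rfl) (pullback.fst f s ⁻¹ᵁ U) (pullback.fst f s ⁻¹ᵁ V)
    (pullback.fst f s ⁻¹ᵁ U).2 (pullback.fst f s ⁻¹ᵁ V).2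
    ⟨_, mem_connectedComponent, by
      change pullback.fst f s _ ∈ U
      rwa [hfst]⟩
    ⟨fiberPoint f y s h.1.symm, h.2 ▸ mem_connectedComponent, by
      change pullback.fst f s _ ∈ V
      rwa [hfst]⟩
  obtain ⟨z, hz, hzm⟩ := exists_point_mem_of_isOpen (pullback.snd f s)
    (hC.inter ((pullback.fst f s ⁻¹ᵁ U).2.inter (pullback.fst f s ⁻¹ᵁ V).2)) ⟨w, hwC, hwU, hwV⟩
  have hzs : (z ≫ pullback.fst f s) ≫ f = s := by
    rw [Category.assoc, pullback.condition, reassoc_of% hz]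
  have hxz : Rel f x (z ≫ pullback.fst f s) := by
    rw [rel_iff rfl hzs]
    have : z default = fiberPoint f (z ≫ pullback.fst f s) s hzs := by
      have : z = pullback.lift (z ≫ pullback.fst f s) (𝟙 _) (by simpa using hzs) := by
        apply pullback.hom_ext <;> simp [hz]
      exact congr($this default)
    rw [← this]
    exact connectedComponent_eq (hzm _).1
  exact ⟨z ≫ pullback.fst f s, ⟨(hzm default).2.1, (hzm default).2.2⟩, hxz, h.symm.trans hxz⟩

/-- At a given point a and b may lie in different charts U and U'. Let T' consist of the points t
near it together with a point c of U ∩ U' in the fiber over t. On T' both sections are compared with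
c, each inside one chart, and transitivity compares them with each other. Since T' is smooth over T,
the image of the resulting open set is open. -/
theorem isOpen_relLocus {Y S T : Scheme.{u}} {f : Y ⟶ S} [Smooth f] {a b : T ⟶ Y}
    (hab : a ≫ f = b ≫ f) : IsOpen (relLocus f a b) := by
  rw [isOpen_iff_forall_mem_open]
  rintro t ⟨K, _, _, τ, rfl, hτ⟩
  obtain ⟨_, ⟨W, hW, rfl⟩, hsW, -⟩ :=
    S.isBasis_affineOpens.exists_subset_of_mem_open (Set.mem_univ (f (a (τ default)))) isOpen_univ
  replace hW : IsAffineOpen W := hW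
  have hr : Set.range hW.fromSpec = W := hW.range_fromSpec
  obtain ⟨A, _, _, i, _, hai, hif, _, n, _, _, _⟩ := exists_chart f hW.fromSpec (a (τ default))
    (by rw [hr]; exact hsW)
  obtain ⟨A', _, _, i', _, hai', hif', _, n', _, _, _⟩ := exists_chart f hW.fromSpec (b (τ default))
    (by
      rw [hr]
      have : f (b (τ default)) = f (a (τ default)) := congr($hab.symm (τ default))
      rw [this]
      exact hsW)
  obtain ⟨H⟩ := exists_hypersurfacePresentation (A := Γ(S, W)) (B := A) (n := n)
  obtain ⟨H'⟩ := exists_hypersurfacePresentation (A := Γ(S, W)) (B := A') (n := n')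
  let U := i.opensRange
  let U' := i'.opensRange
  let N := a ⁻¹ᵁ U ⊓ b ⁻¹ᵁ U'
  let T' := pullback (N.ι ≫ a ≫ f) ((U ⊓ U').ι ≫ f)
  let p : T' ⟶ T := pullback.fst _ _ ≫ N.ι
  let c : T' ⟶ Y := pullback.snd _ _ ≫ (U ⊓ U').ι
  have hpc : p ≫ a ≫ f = c ≫ f := by simpa [p, c] using pullback.condition
  have hN (w : T') : p w ∈ N := (pullback.fst (N.ι ≫ a ≫ f) ((U ⊓ U').ι ≫ f) w).2
  have hc (w : T') : c w ∈ U ⊓ U' := (pullback.snd (N.ι ≫ a ≫ f) ((U ⊓ U').ι ≫ f) w).2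
  have hG : IsOpen (relLocus f (p ≫ a) c) := by
    let a₁ : T' ⟶ Spec (.of A) := IsOpenImmersion.lift i (p ≫ a) (by
      rintro _ ⟨w, rfl⟩; exact (hN w).1)
    let c₁ : T' ⟶ Spec (.of A) := IsOpenImmersion.lift i c (by
      rintro _ ⟨w, rfl⟩; exact (hc w).1)
    have ha₁ : a₁ ≫ i = p ≫ a := IsOpenImmersion.lift_fac _ _ _
    have hc₁ : c₁ ≫ i = c := IsOpenImmersion.lift_fac _ _ _
    rw [← ha₁, ← hc₁, relLocus_eq_of_isOpenImmersion hif]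
    refine isOpen_relLocus_of_hypersurfacePresentation H _ _ ?_
    rw [← cancel_mono hW.fromSpec, Category.assoc, Category.assoc, ← hif, reassoc_of% ha₁,
      reassoc_of% hc₁, hpc]
  have hG' : IsOpen (relLocus f (p ≫ b) c) := by
    let b₁ : T' ⟶ Spec (.of A') := IsOpenImmersion.lift i' (p ≫ b) (by
      rintro _ ⟨w, rfl⟩; exact (hN w).2)
    let c₁ : T' ⟶ Spec (.of A') := IsOpenImmersion.lift i' c (by
      rintro _ ⟨w, rfl⟩; exact (hc w).2)
    have hb₁ : b₁ ≫ i' = p ≫ b := IsOpenImmersion.lift_fac _ _ _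
    have hc₁ : c₁ ≫ i' = c := IsOpenImmersion.lift_fac _ _ _
    rw [← hb₁, ← hc₁, relLocus_eq_of_isOpenImmersion hif']
    refine isOpen_relLocus_of_hypersurfacePresentation H' _ _ ?_
    rw [← cancel_mono hW.fromSpec, Category.assoc, Category.assoc, ← hif', reassoc_of% hb₁,
      reassoc_of% hc₁, ← hab, hpc]
  refine ⟨p '' (relLocus f (p ≫ a) c ∩ relLocus f (p ≫ b) c), ?_, p.isOpenMap _ (hG.inter hG'), ?_⟩
  · rintro _ ⟨w, ⟨hw, hw'⟩, rfl⟩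
    obtain ⟨L, _, _, σ, hσ⟩ := exists_geometricPoint w
    rw [← hσ default] at hw hw' ⊢
    rw [mem_relLocus_iff (by simp [hpc])] at hw
    rw [mem_relLocus_iff (by simp [← hab, hpc])] at hw'
    rw [← Scheme.Hom.comp_apply, mem_relLocus_iff hab]
    simpa using hw.trans hw'.symm
  -- The original point lies in the image because the common component of the two points meets U ∩
  -- U'.
  · obtain ⟨z, hz, haz, hbz⟩ := hτ.exists_mem U U' hai hai'
    have hsub (z : Spec (.of K)) : z = default := Subsingleton.elim _ _
    let z₁ : Spec (.of K) ⟶ ↑(U ⊓ U') := IsOpenImmersion.lift (U ⊓ U').ι z (by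
      rintro _ ⟨w, rfl⟩; rw [hsub w, Scheme.Opens.range_ι]; exact hz)
    let τ₁ : Spec (.of K) ⟶ N := IsOpenImmersion.lift N.ι τ (by
      rintro _ ⟨w, rfl⟩; rw [hsub w, Scheme.Opens.range_ι]; exact ⟨hai, hai'⟩)
    have hz₁ : z₁ ≫ (U ⊓ U').ι = z := IsOpenImmersion.lift_fac _ _ _
    have hτ₁ : τ₁ ≫ N.ι = τ := IsOpenImmersion.lift_fac _ _ _
    let σ : Spec (.of K) ⟶ T' := pullback.lift τ₁ z₁ (by
      rw [reassoc_of% hτ₁, reassoc_of% hz₁, ← haz.1, Category.assoc])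
    have hσp : σ ≫ p = τ := by simp [σ, p, hτ₁]
    have hσc : σ ≫ c = z := by simp [σ, c, hz₁]
    refine ⟨σ default, ⟨?_, ?_⟩, congr($hσp default)⟩
    · rw [mem_relLocus_iff (by simp [hpc]), hσc, reassoc_of% hσp]
      exact haz
    · rw [mem_relLocus_iff (by simp [← hab, hpc]), hσc, reassoc_of% hσp]
      exact hbz

/-! ### Transcendence degrees of residue field extensions -/

/-- The elements `b i` are algebraically independent modulo the ideal `q`, over the image of `A`. -/
def IndepMod {A B : Type*} [CommRing A] [CommRing B] (φ : A →+* B) (q : Ideal B) {n : ℕ}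
    (b : Fin n → B) : Prop :=
  ∀ F : MvPolynomial (Fin n) A, F.eval₂ φ b ∈ q → ∀ m, φ (F.coeff m) ∈ q

/-- A strict generization within a fiber gains one independent element. Expand a relation in powers
of h: its constant term lies in q because h does, so its coefficients vanish. What remains is a
multiple of h, which can be cancelled because h ∉ q', and the degree drops. -/
lemma IndepMod.cons {A B : Type*} [CommRing A] [CommRing B] {φ : A →+* B} {q q' : Ideal B}
    [hq' : q'.IsPrime] {n : ℕ} {b : Fin n → B} (hb : IndepMod φ q b) (hle : q' ≤ q)
    (hcomap : q.comap φ = q'.comap φ) {h : B} (hh : h ∈ q) (hh' : h ∉ q') :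
    IndepMod φ q' (Fin.cons h b : Fin (n + 1) → B) := by
  have hmem (a : A) : φ a ∈ q ↔ φ a ∈ q' := by
    rw [← Ideal.mem_comap, hcomap, Ideal.mem_comap]
  have key : ∀ (N : ℕ) (P : Polynomial (MvPolynomial (Fin n) A)), P.natDegree < N →
      P.eval₂ (MvPolynomial.eval₂Hom φ b) h ∈ q' → ∀ i m, φ ((P.coeff i).coeff m) ∈ q' := by
    intro N
    induction N with
    | zero => intro P hP; exact absurd hP (Nat.not_lt_zero _)
    | succ N ih =>
      intro P hP hPq
      have hdecomp : P.eval₂ (MvPolynomial.eval₂Hom φ b) h =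
          P.divX.eval₂ (MvPolynomial.eval₂Hom φ b) h * h + (P.coeff 0).eval₂ φ b := by
        conv_lhs => rw [← P.divX_mul_X_add]
        simp [Polynomial.eval₂_add, Polynomial.eval₂_mul]
      have h0 : (P.coeff 0).eval₂ φ b ∈ q := by
        have := hle hPq
        rw [hdecomp] at this
        exact (q.add_mem_iff_right (q.mul_mem_left _ hh)).mp this
      have h0' := hb _ h0
      have h0'' : (P.coeff 0).eval₂ φ b ∈ q' := by
        rw [MvPolynomial.eval₂_eq]
        exact q'.sum_mem fun m _ => q'.mul_mem_right _ ((hmem _).mp (h0' m))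
      rw [hdecomp, q'.add_mem_iff_left h0''] at hPq
      have hdiv := (hq'.mem_or_mem hPq).resolve_right hh'
      rintro (_ | i) m
      · exact (hmem _).mp (h0' m)
      · rw [← Polynomial.coeff_divX]
        by_cases hdeg : P.natDegree = 0
        · have : P.divX = 0 := by
            rw [Polynomial.divX_eq_zero_iff]
            exact Polynomial.eq_C_of_natDegree_eq_zero hdeg
          simp [this]
        · refine ih _ ?_ hdiv i m
          rw [Polynomial.natDegree_divX_eq_natDegree_tsub_one]
          omega
  intro F hF m
  have := key _ (MvPolynomial.finSuccEquiv A n F) (Nat.lt_succ_self _) ?_ (m 0) (Finsupp.tail m)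
  · rwa [MvPolynomial.finSuccEquiv_coeff_coeff, Finsupp.cons_tail] at this
  · convert hF using 1
    have : ((Polynomial.eval₂RingHom (MvPolynomial.eval₂Hom φ b) h).comp
      (MvPolynomial.finSuccEquiv A n).toRingEquiv.toRingHom) =
        MvPolynomial.eval₂Hom φ (Fin.cons h b : Fin (n + 1) → B) := by
      ext i
      · simp [MvPolynomial.finSuccEquiv_apply]
      · refine Fin.cases ?_ (fun i => ?_) i
        · simp [MvPolynomial.finSuccEquiv_apply]
        · simp [MvPolynomial.finSuccEquiv_apply]
    exact DFunLike.congr_fun this F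

lemma exists_mul_C_eq_map {A k σ : Type*} [CommRing A] [Field k] (α : A →+* k)
    (hα : ∀ x : k, ∃ a b, α b ≠ 0 ∧ x * α b = α a) (G : MvPolynomial σ k) :
    ∃ (F : MvPolynomial σ A) (b : A), α b ≠ 0 ∧ G * MvPolynomial.C (α b) = F.map α := by
  induction G using MvPolynomial.induction_on with
  | C x =>
    obtain ⟨a, b, hb, h⟩ := hα x
    exact ⟨MvPolynomial.C a, b, hb, by simp [← h]⟩
  | add p q hp hq =>
    obtain ⟨F, b, hb, h⟩ := hp
    obtain ⟨F', b', hb', h'⟩ := hq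
    refine ⟨F * MvPolynomial.C b' + F' * MvPolynomial.C b, b * b', by simp [hb, hb'], ?_⟩
    simp only [map_mul, map_add, MvPolynomial.map_C, ← h, ← h']
    ring
  | mul_X p i hp =>
    obtain ⟨F, b, hb, h⟩ := hp
    refine ⟨F * MvPolynomial.X i, b, hb, ?_⟩
    simp only [map_mul, MvPolynomial.map_X, ← h]
    ring

/-- The transcendence degree of the extension `κ(x) / κ(f x)`. -/
def relTrdeg {X S : Scheme.{u}} (f : X ⟶ S) (x : X) : Cardinal.{u} :=
  letI := (f.residueFieldMap x).hom.toAlgebra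
  Algebra.trdeg (S.residueField (f x)) (X.residueField x)

lemma relTrdeg_comp {X Y S : Scheme.{u}} (f : X ⟶ Y) (g : Y ⟶ S) (x : X) :
    relTrdeg (f ≫ g) x = relTrdeg g (f x) + relTrdeg f x := by
  let := (f.residueFieldMap x).hom.toAlgebra
  let := (g.residueFieldMap (f x)).hom.toAlgebra
  let : Algebra (S.residueField (g (f x))) (X.residueField x) :=
    ((f ≫ g).residueFieldMap x).hom.toAlgebra
  have : IsScalarTower (S.residueField (g (f x))) (Y.residueField (f x)) (X.residueField x) :=
    .of_algebraMap_eq' (by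
      simp only [RingHom.algebraMap_toAlgebra, ← CommRingCat.hom_comp, ← Scheme.residueFieldMap_comp]
      rfl)
  exact (trdeg_add_eq (S.residueField (g (f x))) (Y.residueField (f x))).symm

lemma relTrdeg_eq_zero {X S : Scheme.{u}} (f : X ⟶ S) [LocallyQuasiFinite f] (x : X) :
    relTrdeg f x = 0 := by
  have h : LocallyQuasiFinite (Spec.map (f.residueFieldMap x) ≫ S.fromSpecResidueField (f x)) := by
    rw [Scheme.Hom.SpecMap_residueFieldMap_fromSpecResidueField]
    infer_instance
  have h' := LocallyQuasiFinite.of_comp (Spec.map (f.residueFieldMap x)) (S.fromSpecResidueField (f x))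
  rw [HasRingHomProperty.Spec_iff (P := @LocallyQuasiFinite)] at h'
  let := (f.residueFieldMap x).hom.toAlgebra
  have : Algebra.QuasiFinite (S.residueField (f x)) (X.residueField x) := h'
  have : Module.Finite (S.residueField (f x)) (X.residueField x) := .of_quasiFinite
  exact trdeg_eq_zero

instance isPrime_asIdeal {R : CommRingCat.{u}} (p : Spec R) : p.asIdeal.IsPrime := p.isPrime

/-- The value of an element of `R` at a point of `Spec R`. -/
def evalSpec {R : CommRingCat.{u}} (p : Spec R) : R →+* (Spec R).residueField p :=
  (Scheme.Spec.residueFieldIso R p).inv.hom.comp (algebraMap R p.asIdeal.ResidueField)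

lemma evalSpec_eq_zero_iff {R : CommRingCat.{u}} (p : Spec R) (a : R) :
    evalSpec p a = 0 ↔ a ∈ p.asIdeal := by
  have : Function.Injective (Scheme.Spec.residueFieldIso R p).inv.hom := RingHom.injective _
  rw [evalSpec, RingHom.comp_apply, map_eq_zero_iff _ this]
  exact Ideal.algebraMap_residueField_eq_zero

lemma exists_mul_evalSpec_eq {R : CommRingCat.{u}} (p : Spec R) (x : (Spec R).residueField p) :
    ∃ a b : R, evalSpec p b ≠ 0 ∧ x * evalSpec p b = evalSpec p a := by
  let e := (Scheme.Spec.residueFieldIso R p).commRingCatIsoToRingEquiv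
  obtain ⟨x, rfl⟩ := e.symm.surjective x
  obtain ⟨a, b, hb, rfl⟩ := IsFractionRing.div_surjective (A := R ⧸ p.asIdeal) x
  obtain ⟨a, rfl⟩ := Ideal.Quotient.mk_surjective a
  obtain ⟨b, rfl⟩ := Ideal.Quotient.mk_surjective b
  have hb0 : b ∉ p.asIdeal := by
    rw [← Ideal.Quotient.eq_zero_iff_mem]
    exact nonZeroDivisors.ne_zero hb
  refine ⟨a, b, (evalSpec_eq_zero_iff p b).not.mpr hb0, ?_⟩
  have key (c : R) : evalSpec p c = e.symm (algebraMap (R ⧸ p.asIdeal) p.asIdeal.ResidueField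
    (Ideal.Quotient.mk _ c)) := rfl
  rw [key, key, ← map_mul, div_mul_cancel₀]
  simpa using hb0

lemma residueFieldMap_evalSpec {A B : CommRingCat.{u}} (φ : A ⟶ B) (q : Spec B) (a : A) :
    ((Spec.map φ).residueFieldMap q).hom (evalSpec (Spec.map φ q) a) = evalSpec q (φ.hom a) := by
  have key {R : CommRingCat.{u}} (p : Spec R) (c : R) : evalSpec p c =
      (Spec R).Γevaluation p ((Scheme.ΓSpecIso R).inv c) :=
    congr($(Scheme.Spec.algebraMap_residueFieldIso_inv R p).hom c)
  rw [key, key]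
  refine (Scheme.Γevaluation_naturality_apply _ _ _).trans (congrArg _ ?_)
  exact congr($(Scheme.ΓSpecIso_inv_naturality φ).hom a).symm

/-- A relation over the residue field of the base becomes, after clearing denominators, a relation
over A modulo q. -/
lemma IndepMod.le_relTrdeg {A B : CommRingCat.{u}} {φ : A ⟶ B}
    {q : Spec B} {n : ℕ} {b : Fin n → B} (hb : IndepMod φ.hom q.asIdeal b) :
    n ≤ relTrdeg (Spec.map φ) q := by
  let := ((Spec.map φ).residueFieldMap q).hom.toAlgebra
  have hind : AlgebraicIndependent ((Spec A).residueField (Spec.map φ q)) (evalSpec q ∘ b) := by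
    rw [algebraicIndependent_iff]
    intro G hG
    obtain ⟨F, c, hc, h⟩ := exists_mul_C_eq_map (evalSpec (Spec.map φ q))
      (exists_mul_evalSpec_eq _) G
    have hF : F.eval₂ φ.hom b ∈ q.asIdeal := by
      rw [← evalSpec_eq_zero_iff, MvPolynomial.hom_eval₂]
      have h' := congrArg (MvPolynomial.aeval (evalSpec q ∘ b)) h
      rw [map_mul, hG, zero_mul, MvPolynomial.aeval_def, MvPolynomial.eval₂_map] at h'
      rw [h']
      congr 1
      ext a
      exact (residueFieldMap_evalSpec φ q a).symm
    have hF0 : F.map (evalSpec (Spec.map φ q)) = 0 := by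
      ext m
      rw [MvPolynomial.coeff_map, MvPolynomial.coeff_zero, evalSpec_eq_zero_iff]
      exact hb F hF m
    rw [hF0] at h
    exact (mul_eq_zero.mp h).resolve_right (by simpa using hc)
  have := hind.lift_cardinalMk_le_trdeg
  rw [Cardinal.mk_fin, Cardinal.lift_natCast, Cardinal.lift_id'] at this
  exact this

lemma isAlgebraic_of_forall_mul_mem {k K : Type*} [Field k] [Field K] [Algebra k K]
    (B : Subalgebra k K) (h : ∀ x : K, ∃ a ∈ B, ∃ b ∈ B, b ≠ 0 ∧ x * b = a) :
    Algebra.IsAlgebraic B K := by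
  refine ⟨fun x => ?_⟩
  obtain ⟨a, ha, b, hb, hb0, h⟩ := h x
  refine ⟨Polynomial.C ⟨b, hb⟩ * Polynomial.X - Polynomial.C ⟨a, ha⟩, fun h0 => hb0 ?_, ?_⟩
  · have := congrArg (fun p => (p.coeff 1).1) h0
    simpa [Polynomial.coeff_C] using this
  · rw [map_sub, map_mul, Polynomial.aeval_C, Polynomial.aeval_C, Polynomial.aeval_X, sub_eq_zero,
      mul_comm]
    exact h

/-- The residue field consists of fractions of polynomials, so it is algebraic over the algebra
generated by the n coordinate values. -/
lemma relTrdeg_mvPolynomial_le {A : CommRingCat.{u}} (n : ℕ)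
    (q : Spec (.of (MvPolynomial (Fin n) A))) :
    relTrdeg (Spec.map (CommRingCat.ofHom (MvPolynomial.C : A →+* MvPolynomial (Fin n) A))) q
      ≤ n := by
  set φ := CommRingCat.ofHom (MvPolynomial.C : A →+* MvPolynomial (Fin n) A)
  let := ((Spec.map φ).residueFieldMap q).hom.toAlgebra
  let s : Set ((Spec (.of (MvPolynomial (Fin n) A))).residueField q) :=
    Set.range fun i => evalSpec q (MvPolynomial.X i)
  have hs (F : MvPolynomial (Fin n) A) :
      evalSpec q F ∈ Algebra.adjoin ((Spec A).residueField (Spec.map φ q)) s := by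
    induction F using MvPolynomial.induction_on with
    | C a =>
      have := residueFieldMap_evalSpec φ q a
      exact this ▸ Subalgebra.algebraMap_mem _ _
    | add F G hF hG => exact (map_add (evalSpec q) F G) ▸ add_mem hF hG
    | mul_X F i hF =>
      exact (map_mul (evalSpec q) F _) ▸ mul_mem hF (Algebra.subset_adjoin ⟨i, rfl⟩)
  have : Algebra.IsAlgebraic (Algebra.adjoin ((Spec A).residueField (Spec.map φ q)) s)
      ((Spec (.of (MvPolynomial (Fin n) A))).residueField q) := by
    refine isAlgebraic_of_forall_mul_mem _ fun x => ?_
    obtain ⟨a, b, hb, h⟩ := exists_mul_evalSpec_eq q x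
    exact ⟨_, hs a, _, hs b, hb, h⟩
  refine (Algebra.IsAlgebraic.trdeg_le_cardinalMk _ s).trans ?_
  simpa using Cardinal.mk_range_le_lift (f := fun i => evalSpec q (MvPolynomial.X i))

/-! ### Quasi-finite morphisms to affine spaces -/

open TensorProduct in
lemma exists_algebraMap_smul_eq_one_tmul {A k C : Type*} [CommRing A] [Field k] [Algebra A k]
    [CommRing C] [Algebra A C] (hα : ∀ x : k, ∃ a b : A, algebraMap A k b ≠ 0 ∧
      x * algebraMap A k b = algebraMap A k a) (x : k ⊗[A] C) :
    ∃ (b : A) (c : C), algebraMap A k b ≠ 0 ∧ algebraMap A k b • x = 1 ⊗ₜ c := by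
  induction x using TensorProduct.induction_on with
  | zero => exact ⟨1, 0, by simp, by simp⟩
  | tmul k c =>
    obtain ⟨a, b, hb, h⟩ := hα k
    refine ⟨b, a • c, hb, ?_⟩
    rw [smul_tmul', smul_eq_mul, mul_comm, h, Algebra.algebraMap_eq_smul_one, smul_tmul]
  | add x y hx hy =>
    obtain ⟨b, c, hb, h⟩ := hx
    obtain ⟨b', c', hb', h'⟩ := hy
    refine ⟨b * b', b' • c + b • c', by simp [hb, hb'], ?_⟩
    rw [tmul_add, ← smul_tmul, ← smul_tmul, ← algebraMap_smul k b' (1 : k),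
      ← algebraMap_smul k b (1 : k), ← smul_tmul', ← smul_tmul', ← h, ← h', smul_smul, smul_smul,
      ← map_mul, ← map_mul, mul_comm b' b, ← smul_add]

lemma exists_mul_algebraMap_residueField_eq {A : Type*} [CommRing A] (p : Ideal A) [p.IsPrime]
    (x : p.ResidueField) : ∃ a b : A, algebraMap A p.ResidueField b ≠ 0 ∧
      x * algebraMap A p.ResidueField b = algebraMap A p.ResidueField a := by
  obtain ⟨a, b, hb, rfl⟩ := IsFractionRing.div_surjective (A := A ⧸ p) x
  obtain ⟨a, rfl⟩ := Ideal.Quotient.mk_surjective a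
  obtain ⟨b, rfl⟩ := Ideal.Quotient.mk_surjective b
  have hb0 : algebraMap A p.ResidueField b ≠ 0 := by
    rw [Ne, Ideal.algebraMap_residueField_eq_zero, ← Ideal.Quotient.eq_zero_iff_mem]
    exact nonZeroDivisors.ne_zero hb
  exact ⟨a, b, hb0, div_mul_cancel₀ _ hb0⟩

lemma isPreimmersion_SpecMap_residueField {A : Type u} [CommRing A] (p : Ideal A) [hp : p.IsPrime] :
    IsPreimmersion (Spec.map (CommRingCat.ofHom (algebraMap A p.ResidueField))) := by
  let x : Spec (.of A) := (⟨p, hp⟩ : PrimeSpectrum A)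
  have h := Scheme.Spec.map_residueFieldIso_inv_eq_fromSpecResidueField (.of A) x
  have h' : Spec.map (CommRingCat.ofHom (algebraMap A p.ResidueField)) =
      Spec.map (Scheme.Spec.residueFieldIso (.of A) x).hom ≫
        (Spec (.of A)).fromSpecResidueField x := by
    rw [← h, ← Spec.map_comp_assoc, Iso.inv_hom_id, Spec.map_id, Category.id_comp]
  rw [h']
  infer_instance

lemma range_SpecMap_residueField {A : Type u} [CommRing A] (p : Ideal A) [hp : p.IsPrime] :
    Set.range (Spec.map (CommRingCat.ofHom (algebraMap A p.ResidueField))) =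
      {(⟨p, hp⟩ : PrimeSpectrum A)} := by
  rw [Set.range_unique]
  refine congrArg _ (PrimeSpectrum.ext ?_)
  ext x
  exact (by simp : algebraMap A p.ResidueField x ∈ (⊥ : Ideal _) ↔ x ∈ p)

open TensorProduct in
-- Noether normalization over k with coordinates coming from C itself. Each coordinate becomes the
-- image of an element of C after multiplication by a nonzero constant, and such a rescaling is an
-- automorphism of the polynomial ring.
lemma exists_finite_injective_aeval_one_tmul {A k C : Type*} [CommRing A] [Field k] [Algebra A k]
    [CommRing C] [Algebra A C] [Algebra.FiniteType A C] [Nontrivial (k ⊗[A] C)]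
    (hα : ∀ x : k, ∃ a b : A, algebraMap A k b ≠ 0 ∧ x * algebraMap A k b = algebraMap A k a) :
    ∃ (m : ℕ) (c : Fin m → C), Function.Injective
      (MvPolynomial.aeval (R := k) fun i => (1 : k) ⊗ₜ[A] c i) ∧
      (MvPolynomial.aeval (R := k) fun i => (1 : k) ⊗ₜ[A] c i).toRingHom.Finite := by
  obtain ⟨m, g, hginj, hgfin⟩ := exists_finite_inj_algHom_of_fg k (k ⊗[A] C)
  have H (i) : ∃ (u : k) (c : C), u ≠ 0 ∧ u • g (MvPolynomial.X i) = 1 ⊗ₜ c :=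
    let ⟨b, c, hb, hc⟩ := exists_algebraMap_smul_eq_one_tmul hα (g (MvPolynomial.X i))
    ⟨_, c, hb, hc⟩
  choose u c hu hc using H
  let σ : MvPolynomial (Fin m) k →ₐ[k] MvPolynomial (Fin m) k :=
    MvPolynomial.aeval fun i => u i • MvPolynomial.X i
  let σ' : MvPolynomial (Fin m) k →ₐ[k] MvPolynomial (Fin m) k :=
    MvPolynomial.aeval fun i => (u i)⁻¹ • MvPolynomial.X i
  have h₁ : g.comp σ = MvPolynomial.aeval fun i => (1 : k) ⊗ₜ[A] c i := by
    ext i; simp [σ, hc]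
  have h₂ : σ'.comp σ = AlgHom.id _ _ := by
    ext1 i; simp [σ, σ', hu]
  have h₃ : σ.comp σ' = AlgHom.id _ _ := by
    ext1 i; simp [σ, σ', hu]
  refine ⟨m, c, ?_, ?_⟩ <;> rw [← h₁]
  · exact hginj.comp (Function.LeftInverse.injective (g := σ') fun x => DFunLike.congr_fun h₂ x)
  · refine RingHom.Finite.of_comp_finite (f := σ'.toRingHom) ?_
    have : (g.comp σ).comp σ' = g := by rw [AlgHom.comp_assoc, h₃, AlgHom.comp_id]
    exact (congrArg (fun h : MvPolynomial (Fin m) k →ₐ[k] k ⊗[A] C => h.toRingHom.Finite) this).mpr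
      hgfin

lemma quasiFiniteAt_of_isDiscrete {X Y : Scheme.{u}} (f : X ⟶ Y) [LocallyOfFiniteType f] (x : X)
    (h : _root_.IsDiscrete (f ⁻¹' {f x})) : f.QuasiFiniteAt x := by
  rw [Scheme.Hom.quasiFiniteAt_iff_isOpen_singleton_asFiber]
  have := h.to_subtype
  have : DiscreteTopology (f.fiber (f x)) := (f.fiberHomeo (f x)).isEmbedding.discreteTopology
  exact isOpen_discrete _

lemma comap_injective_of_forall_exists_mul {R R' : Type*} [CommRing R] [CommRing R'] (φ : R →+* R')
    (h : ∀ r : R', ∃ u : R', IsUnit u ∧ r * u ∈ φ.range) :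
    Function.Injective (PrimeSpectrum.comap φ) := by
  have key (P P' : PrimeSpectrum R') (hP : PrimeSpectrum.comap φ P = PrimeSpectrum.comap φ P')
      (r : R') (hr : r ∈ P.asIdeal) : r ∈ P'.asIdeal := by
    obtain ⟨u, hu, s, hs⟩ := h r
    have : s ∈ (PrimeSpectrum.comap φ P).asIdeal := by
      change φ s ∈ P.asIdeal
      rw [hs]; exact P.asIdeal.mul_mem_right _ hr
    rw [hP] at this
    change φ s ∈ P'.asIdeal at this
    rw [hs] at this
    exact (Ideal.mul_unit_mem_iff_mem _ hu).mp this
  exact fun P P' hP => PrimeSpectrum.ext (Ideal.ext fun r => ⟨key P P' hP r, key P' P hP.symm r⟩)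

open TensorProduct in
/-- A form of Noether normalization in families. -/
lemma exists_quasiFiniteAt_indepMod {A C : Type u} [CommRing A] [CommRing C] [Algebra A C]
    [Algebra.FiniteType A C] (Q₀ : Spec (.of C)) :
    ∃ (m : ℕ) (c : Fin m → C) (Q : Spec (.of C)),
      (Spec.map (CommRingCat.ofHom (MvPolynomial.aeval (R := A) c).toRingHom)).QuasiFiniteAt Q₀ ∧
      Q.asIdeal.comap (algebraMap A C) = Q₀.asIdeal.comap (algebraMap A C) ∧
      IndepMod (algebraMap A C) Q.asIdeal c := by
  set p : PrimeSpectrum A := PrimeSpectrum.comap (algebraMap A C) Q₀ with hpdef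
  let k := p.asIdeal.ResidueField
  have hα := exists_mul_algebraMap_residueField_eq p.asIdeal
  let ι : C →ₐ[A] k ⊗[A] C := Algebra.TensorProduct.includeRight
  let j := Spec.map (CommRingCat.ofHom ι.toRingHom)
  have hpb := isPullback_SpecMap_of_isPushout _ _ _ _ (CommRingCat.isPushout_tensorProduct A k C)
  have hj : IsPreimmersion j :=
    MorphismProperty.of_isPullback (P := @IsPreimmersion) hpb
      (isPreimmersion_SpecMap_residueField p.asIdeal)
  have hrange : Set.range j = {Q | Q.asIdeal.comap (algebraMap A C) = p.asIdeal} := by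
    rw [show j = hpb.isoPullback.hom ≫ pullback.snd _ _ from hpb.isoPullback_hom_snd.symm, Scheme.Hom.comp_base, TopCat.coe_comp,
      hpb.isoPullback.hom.surjective.range_comp, Scheme.Pullback.range_snd]
    ext Q
    rw [range_SpecMap_residueField]
    exact PrimeSpectrum.ext_iff
  obtain ⟨P₀, -⟩ : Q₀ ∈ Set.range j := hrange.ge rfl
  have : Nontrivial (k ⊗[A] C) := PrimeSpectrum.nonempty_iff_nontrivial.mp ⟨P₀⟩
  obtain ⟨m, c, hginj, hgfin⟩ := exists_finite_injective_aeval_one_tmul (C := C) hα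
  set g : MvPolynomial (Fin m) k →ₐ[k] k ⊗[A] C := MvPolynomial.aeval fun i => 1 ⊗ₜ c i
  have hsq : g.toRingHom.comp (MvPolynomial.map (algebraMap A k)) =
      ι.toRingHom.comp (MvPolynomial.aeval (R := A) c).toRingHom := by
    ext i
    · simp [g, ι]
    · simp [g, ι]
  have hsurj : Function.Surjective (PrimeSpectrum.comap g.toRingHom) :=
    RingHom.IsIntegral.comap_surjective hgfin.to_isIntegral hginj
  -- The witness Q is a point of the fiber lying over the generic point of affine space over k,
  -- where the coordinates are algebraically independent.
  obtain ⟨P, hP⟩ := hsurj ⟨⊥, Ideal.isPrime_bot⟩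
  have hP' : (j P).asIdeal.comap (algebraMap A C) = p.asIdeal := hrange.le ⟨P, rfl⟩
  refine ⟨m, c, j P, ?_, hP', ?_⟩
  · set γ := Spec.map (CommRingCat.ofHom (MvPolynomial.aeval (R := A) c).toRingHom)
    have : LocallyOfFiniteType γ := by
      rw [HasRingHomProperty.Spec_iff (P := @LocallyOfFiniteType)]
      refine RingHom.FiniteType.of_comp_finiteType (f := algebraMap A (MvPolynomial (Fin m) A)) ?_
      rw [CommRingCat.hom_ofHom, AlgHom.toRingHom_eq_coe, AlgHom.comp_algebraMap]
      exact RingHom.finiteType_algebraMap.mpr inferInstance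
    apply quasiFiniteAt_of_isDiscrete
    let γ' := Spec.map (CommRingCat.ofHom g.toRingHom)
    let κ := Spec.map (CommRingCat.ofHom (MvPolynomial.map (σ := Fin m) (algebraMap A k)))
    have hcomm : j ≫ γ = γ' ≫ κ := by
      simp only [j, γ, γ', κ, ← Spec.map_comp, ← CommRingCat.ofHom_comp]
      rw [← hsq]
    have : IsFinite γ' := by
      rw [IsFinite.SpecMap_iff]; exact hgfin
    have hκ : Function.Injective κ := by
      apply comap_injective_of_forall_exists_mul
      intro G
      obtain ⟨F, b, hb, h⟩ := exists_mul_C_eq_map (algebraMap A k) hα G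
      exact ⟨_, (IsUnit.mk0 _ hb).map MvPolynomial.C, F, h.symm⟩
    -- All points of the γ-fiber of Q₀ lie over p. There γ is a finite map followed by the injection
    -- κ, so its fibers are discrete.
    have h₁ : _root_.IsDiscrete (γ' ⁻¹' (κ ⁻¹' {γ Q₀})) :=
      γ'.isDiscrete_preimage (Set.Subsingleton.isDiscrete
        (Set.subsingleton_singleton.preimage hκ))
    refine (h₁.image j.isEmbedding.isInducing).mono ?_
    intro Q hQ
    have hQp : Q ∈ Set.range j := by
      rw [hrange]
      have := congrArg (PrimeSpectrum.comap (MvPolynomial.C (σ := Fin m) (R := A))) hQ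
      have h' (Q : Spec (.of C)) : (PrimeSpectrum.comap (MvPolynomial.C (σ := Fin m) (R := A)) (γ Q))
        = PrimeSpectrum.comap (algebraMap A C) Q := by
        rw [← (MvPolynomial.aeval (R := A) c).comp_algebraMap]; rfl
      erw [h', h'] at this
      exact congrArg PrimeSpectrum.asIdeal this
    obtain ⟨Q, rfl⟩ := hQp
    refine ⟨Q, ?_, rfl⟩
    rw [Set.mem_preimage, Set.mem_preimage, ← Scheme.Hom.comp_apply, ← hcomm]
    exact hQ
  · intro F hF e
    have h0 : F.map (algebraMap A k) ∈ (PrimeSpectrum.comap g.toRingHom P).asIdeal := by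
      have := DFunLike.congr_fun hsq F
      change g.toRingHom _ ∈ P.asIdeal
      rw [RingHom.comp_apply] at this
      rw [this]
      exact hF
    rw [hP] at h0
    have h1 := congrArg (MvPolynomial.coeff e) ((Submodule.mem_bot _).mp h0)
    rw [MvPolynomial.coeff_map, MvPolynomial.coeff_zero, Ideal.algebraMap_residueField_eq_zero,
      ← hP'] at h1
    exact h1

/-! ### Fiberwise dense open subsets -/

/-- `f` is smooth of relative dimension `n` near `x`. -/
def HasRelDim {X S : Scheme.{u}} (f : X ⟶ S) (n : ℕ) (x : X) : Prop :=
  ∃ U : X.Opens, x ∈ U ∧ SmoothOfRelativeDimension n (U.ι ≫ f)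

/-- `x` is the generic point of an irreducible component of its fiber. -/
def IsFiberGeneric {X S : Scheme.{u}} (f : X ⟶ S) (x : X) : Prop :=
  ∀ x', x' ⤳ x → f x' = f x → x' = x

lemma relTrdeg_apply_of_locallyQuasiFinite {U X S : Scheme.{u}} (i : U ⟶ X) [LocallyQuasiFinite i]
    (f : X ⟶ S) (x : U) : relTrdeg f (i x) = relTrdeg (i ≫ f) x := by
  rw [relTrdeg_comp, relTrdeg_eq_zero i, add_zero]

lemma relTrdeg_comp_of_locallyQuasiFinite {U X S : Scheme.{u}} (f : U ⟶ X)
    (j : X ⟶ S) [LocallyQuasiFinite j] (x : U) : relTrdeg (f ≫ j) x = relTrdeg f x := by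
  rw [relTrdeg_comp, relTrdeg_eq_zero j, zero_add]

lemma exists_etale_eq_comp {A B : CommRingCat.{u}} (ψ : A ⟶ B) {n : ℕ}
    (h : ψ.hom.IsStandardSmoothOfRelativeDimension n) :
    ∃ φ : CommRingCat.of (MvPolynomial (Fin n) A) ⟶ B, Etale (Spec.map φ) ∧
      Spec.map ψ = Spec.map φ ≫ Spec.map (CommRingCat.ofHom MvPolynomial.C) := by
  obtain ⟨g, hgC, hg⟩ := h.exists_etale_mvPolynomial
  refine ⟨CommRingCat.ofHom g, ?_, ?_⟩
  · rw [HasRingHomProperty.Spec_iff (P := @Etale)]; exact hg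
  · rw [← Spec.map_comp, ← CommRingCat.ofHom_comp, hgC, CommRingCat.ofHom_hom]

lemma HasRelDim.exists_chart {X S : Scheme.{u}} {f : X ⟶ S} {n : ℕ} {x : X}
    (h : HasRelDim f n x) : ∃ (A B : CommRingCat.{u}) (j : Spec A ⟶ S) (i : Spec B ⟶ X)
      (φ : CommRingCat.of (MvPolynomial (Fin n) A) ⟶ B) (y : Spec B), IsOpenImmersion j ∧
      IsOpenImmersion i ∧ Etale (Spec.map φ) ∧ i y = x ∧
      i ≫ f = Spec.map φ ≫ Spec.map (CommRingCat.ofHom MvPolynomial.C) ≫ j := by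
  obtain ⟨U, hx, hU⟩ := h
  obtain ⟨V, hV, W, hW, hxW, e, he⟩ :=
    SmoothOfRelativeDimension.exists_isStandardSmoothOfRelativeDimension (n := n) (f := U.ι ≫ f)
      ⟨x, hx⟩
  obtain ⟨φ, hφ, hφ'⟩ := exists_etale_eq_comp _ he
  obtain ⟨y, hy⟩ : (⟨x, hx⟩ : U) ∈ Set.range hW.fromSpec := by
    rw [hW.range_fromSpec]; exact hxW
  refine ⟨_, _, hV.fromSpec, hW.fromSpec ≫ U.ι, φ, y, inferInstance, inferInstance, hφ, ?_, ?_⟩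
  · rw [Scheme.Hom.comp_apply, hy]; rfl
  · rw [Category.assoc, ← hV.SpecMap_appLE_fromSpec _ hW e, hφ', Category.assoc]

instance {X S : Scheme.{u}} (f : X ⟶ S) [Etale f] : LocallyQuasiFinite f where
  quasiFinite_appLE {U} hU {V} hV e := by
    have h : (f.appLE U V e).hom.Etale :=
      HasRingHomProperty.appLE @Etale f inferInstance ⟨U, hU⟩ ⟨V, hV⟩ e
    let := (f.appLE U V e).hom.toAlgebra
    have : Algebra.Etale Γ(S, U) Γ(X, V) := h
    exact inferInstanceAs (Algebra.QuasiFinite Γ(S, U) Γ(X, V))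

/-- Near x the morphism is étale over n-dimensional affine space, and étale maps do not change the
transcendence degree. -/
lemma HasRelDim.relTrdeg_le {X S : Scheme.{u}} {f : X ⟶ S} {n : ℕ} {x : X}
    (h : HasRelDim f n x) : relTrdeg f x ≤ n := by
  obtain ⟨A, B, j, i, φ, y, _, _, _, rfl, h'⟩ := h.exists_chart
  rw [relTrdeg_apply_of_locallyQuasiFinite, h', ← relTrdeg_apply_of_locallyQuasiFinite,
    relTrdeg_comp_of_locallyQuasiFinite]
  exact relTrdeg_mvPolynomial_le n _

/-- Étale maps are flat, so generizations lift along the chart and the image of x in affine space is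
generic in its fiber. There the n coordinates are algebraically independent. -/
lemma HasRelDim.relTrdeg_eq {X S : Scheme.{u}} {f : X ⟶ S} {n : ℕ} {x : X}
    (h : HasRelDim f n x) (hx : IsFiberGeneric f x) : relTrdeg f x = n := by
  refine h.relTrdeg_le.antisymm ?_
  obtain ⟨A, B, j, i, φ, y, _, _, _, rfl, h'⟩ := h.exists_chart
  rw [relTrdeg_apply_of_locallyQuasiFinite, h', ← relTrdeg_apply_of_locallyQuasiFinite,
    relTrdeg_comp_of_locallyQuasiFinite]
  have hgen : IsFiberGeneric (Spec.map (CommRingCat.ofHom (MvPolynomial.C (R := A) (σ := Fin n))))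
      (Spec.map φ y) := by
    intro w hw hw'
    obtain ⟨y', hy', rfl⟩ := Flat.generalizingMap (Spec.map φ) hw
    rw [hx (i y') (hy'.map i.continuous) ?_ |> i.injective]
    rw [← Scheme.Hom.comp_apply, ← Scheme.Hom.comp_apply, h', Scheme.Hom.comp_apply,
      Scheme.Hom.comp_apply, hw']
    simp
  generalize Spec.map φ y = w at hgen
  let p := w.asIdeal.comap (MvPolynomial.C (R := A) (σ := Fin n))
  have hw : w.asIdeal.IsPrime := w.isPrime
  have hp : p.IsPrime := Ideal.comap_isPrime _ _
  -- P consists of the polynomials with all coefficients in p; it is the generic point of the fiber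
  -- of affine space over p.
  let P : Ideal (MvPolynomial (Fin n) A) := RingHom.ker (MvPolynomial.map (Ideal.Quotient.mk p))
  have hP : P.IsPrime := RingHom.ker_isPrime _
  have hmem (F : MvPolynomial (Fin n) A) : F ∈ P ↔ ∀ e, MvPolynomial.C (F.coeff e) ∈ w.asIdeal := by
    rw [RingHom.mem_ker, MvPolynomial.ext_iff]
    refine forall_congr' fun e => ?_
    rw [MvPolynomial.coeff_map, MvPolynomial.coeff_zero, Ideal.Quotient.eq_zero_iff_mem]
    exact Ideal.mem_comap
  have hPw : P ≤ w.asIdeal := by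
    intro F hF
    rw [F.as_sum]
    refine Ideal.sum_mem _ fun e _ => ?_
    rw [MvPolynomial.monomial_eq]
    exact Ideal.mul_mem_right _ _ ((hmem F).mp hF e)
  have hPcomap : P.comap MvPolynomial.C = p := by
    refine le_antisymm (Ideal.comap_mono hPw) fun a ha => ?_
    rw [Ideal.mem_comap, RingHom.mem_ker, MvPolynomial.map_C, Ideal.Quotient.eq_zero_iff_mem.mpr ha,
      map_zero]
  have hw : P = w.asIdeal := congrArg PrimeSpectrum.asIdeal
    (hgen (⟨P, hP⟩ : PrimeSpectrum _) ((PrimeSpectrum.le_iff_specializes _ _).mp hPw)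
      (PrimeSpectrum.ext hPcomap))
  apply IndepMod.le_relTrdeg (b := MvPolynomial.X)
  intro F hF e
  refine (hmem F).mp ?_ e
  rw [hw]
  convert hF
  exact F.eval₂_eta.symm

lemma exists_isFiberGeneric {X S : Scheme.{u}} (f : X ⟶ S) (x : X) :
    ∃ η, η ⤳ x ∧ f η = f x ∧ IsFiberGeneric f η := by
  let z := f.asFiber x
  obtain ⟨η, hη⟩ := QuasiSober.sober (isIrreducible_irreducibleComponent (x := z))
    isClosed_irreducibleComponent
  have hz : η ⤳ z := by
    rw [specializes_iff_mem_closure, hη]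
    exact mem_irreducibleComponent
  have hf (z' : f.fiber (f x)) : f (f.fiberι _ z') = f x :=
    (f.range_fiberι (f x)).le ⟨z', rfl⟩
  refine ⟨f.fiberι _ η, ?_, hf _, ?_⟩
  · have := hz.map (f.fiberι _).continuous
    simpa [z] using this
  · intro x' hx' hfx'
    obtain ⟨z', rfl⟩ : x' ∈ Set.range (f.fiberι (f x)) := by
      rw [f.range_fiberι]; exact hfx'.trans (hf _)
    have hz' : z' ⤳ η := (f.fiberι (f x)).isEmbedding.isInducing.specializes_iff.mp hx'
    have : closure {z'} = closure {η} := by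
      refine Eq.trans ?_ hη.def.symm
      refine eq_irreducibleComponent isIrreducible_singleton.closure.isPreirreducible ?_
      rw [← hη.def]; exact specializes_iff_closure_subset.mp hz'
    exact congrArg _ ((hz'.antisymm (specializes_iff_closure_subset.mpr this.le)).eq)

lemma exists_finiteType_chart {X S : Scheme.{u}} (f : X ⟶ S) [LocallyOfFiniteType f] (x : X) :
    ∃ (A B : CommRingCat.{u}) (j : Spec A ⟶ S) (i : Spec B ⟶ X) (φ : A ⟶ B) (y : Spec B),
      IsOpenImmersion j ∧ IsOpenImmersion i ∧ φ.hom.FiniteType ∧ i y = x ∧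
      Spec.map φ ≫ j = i ≫ f := by
  obtain ⟨_, ⟨U, hU, rfl⟩, hxU, -⟩ := S.isBasis_affineOpens.exists_subset_of_mem_open
    (Set.mem_univ (f x)) isOpen_univ
  obtain ⟨_, ⟨W, hW, rfl⟩, hxW, hWU⟩ := X.isBasis_affineOpens.exists_subset_of_mem_open
    (show x ∈ f ⁻¹ᵁ U from hxU) (f ⁻¹ᵁ U).isOpen
  replace hU : IsAffineOpen U := hU
  replace hW : IsAffineOpen W := hW
  obtain ⟨y, hy⟩ : x ∈ Set.range hW.fromSpec := by rw [hW.range_fromSpec]; exact hxW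
  exact ⟨_, _, hU.fromSpec, hW.fromSpec, f.appLE U W hWU, y, inferInstance, inferInstance,
    HasRingHomProperty.appLE @LocallyOfFiniteType f inferInstance ⟨U, hU⟩ ⟨W, hW⟩ hWU, hy,
    hU.SpecMap_appLE_fromSpec f hW hWU⟩

/-- Noether normalization of Z at x₀ gives a map to affine m-space which is quasi-finite at x₀,
hence near x₀. It bounds the transcendence degree on nearby points of Z by m, and the hypothesis on
generizations forces m < n. -/
lemma exists_nhds_relTrdeg_lt {X S : Scheme.{u}} (f : X ⟶ S) [LocallyOfFiniteType f] {Z : Set X}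
    (hZ : IsClosed Z) {x₀ : X} (hx₀ : x₀ ∈ Z) {n : ℕ}
    (H : ∀ z ∈ Z, f z = f x₀ → ∃ ξ, ξ ⤳ z ∧ ξ ≠ z ∧ f ξ = f z ∧ relTrdeg f ξ ≤ n) :
    ∃ N : Set X, IsOpen N ∧ x₀ ∈ N ∧ ∀ z ∈ Z, z ∈ N → relTrdeg f z < n := by
  obtain ⟨A, C₀, j, i, φ, x₁, _, _, hft, rfl, hcomm⟩ := exists_finiteType_chart f x₀
  let I : Ideal C₀ := PrimeSpectrum.vanishingIdeal (i ⁻¹' Z)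
  have hI : PrimeSpectrum.zeroLocus (I : Set C₀) = i ⁻¹' Z := by
    rw [PrimeSpectrum.zeroLocus_vanishingIdeal_eq_closure]
    exact (hZ.preimage i.continuous).closure_eq
  let π : C₀ ⟶ .of (C₀ ⧸ I) := CommRingCat.ofHom (Ideal.Quotient.mk I)
  have hπ : Set.range (Spec.map π) = i ⁻¹' Z := by
    rw [← hI]
    refine (range_comap_of_surjective _ _ Ideal.Quotient.mk_surjective).trans ?_
    simp [Ideal.mk_ker]
  have : IsClosedImmersion (Spec.map π) :=
    IsClosedImmersion.spec_of_surjective _ Ideal.Quotient.mk_surjective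
  obtain ⟨Q₀, rfl⟩ : x₁ ∈ Set.range (Spec.map π) := hπ.ge hx₀
  let := (φ ≫ π).hom.toAlgebra
  have hft' : Algebra.FiniteType A (C₀ ⧸ I) :=
    hft.comp_surjective (g := π.hom) Ideal.Quotient.mk_surjective
  obtain ⟨m, c, Q, hqf, hQ, hc⟩ := exists_quasiFiniteAt_indepMod (A := A) Q₀
  have hfi (q : Spec C₀) : f (i q) = j (Spec.map φ q) := by
    rw [← Scheme.Hom.comp_apply, ← hcomm, Scheme.Hom.comp_apply]
  -- The m coordinates are independent at Q. A function vanishing at Q but not at its proper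
  -- generization ξ adds one more, so m + 1 is at most the transcendence degree at ξ, hence at most
  -- n.
  have hmn : m < n := by
    choose c' hc' using fun k => Ideal.Quotient.mk_surjective (c k)
    have hind : IndepMod φ.hom (Spec.map π Q).asIdeal c' := by
      intro F hF e
      refine hc F ?_ e
      have : π.hom (F.eval₂ φ.hom c') ∈ Q.asIdeal := hF
      rw [MvPolynomial.hom_eval₂] at this
      rw [show c = ⇑π.hom ∘ c' from (funext hc').symm]
      exact this
    have hQx : Spec.map φ (Spec.map π Q) = Spec.map φ (Spec.map π Q₀) := PrimeSpectrum.ext hQ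
    obtain ⟨ξ, hξ, hne, hfξ, hle⟩ := H (i (Spec.map π Q)) (hπ.le ⟨Q, rfl⟩) (by rw [hfi, hfi, hQx])
    obtain ⟨q, rfl⟩ : ξ ∈ Set.range i := hξ.mem_open i.isOpenEmbedding.isOpen_range ⟨_, rfl⟩
    have hq : q ⤳ Spec.map π Q := i.isEmbedding.isInducing.specializes_iff.mp hξ
    have hlt : q.asIdeal ≤ (Spec.map π Q).asIdeal := (PrimeSpectrum.le_iff_specializes _ _).mpr hq
    obtain ⟨h, hh, hh'⟩ : ∃ h ∈ (Spec.map π Q).asIdeal, h ∉ q.asIdeal := by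
      by_contra! hcon
      exact hne (congrArg i (PrimeSpectrum.ext (le_antisymm hlt hcon)))
    have hcomap : (Spec.map π Q).asIdeal.comap φ.hom = q.asIdeal.comap φ.hom := by
      rw [hfi, hfi] at hfξ
      exact congrArg PrimeSpectrum.asIdeal (j.injective hfξ).symm
    have := (hind.cons hlt hcomap hh hh').le_relTrdeg
    rw [← relTrdeg_comp_of_locallyQuasiFinite (Spec.map φ) j, hcomm,
      ← relTrdeg_apply_of_locallyQuasiFinite] at this
    exact_mod_cast this.trans hle
  set γ := Spec.map (CommRingCat.ofHom (MvPolynomial.aeval (R := A) c).toRingHom)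
  have hγ : γ ≫ Spec.map (CommRingCat.ofHom (MvPolynomial.C (R := A) (σ := Fin m))) =
      Spec.map π ≫ Spec.map φ := by
    rw [← Spec.map_comp, ← Spec.map_comp, ← CommRingCat.ofHom_comp]
    congr 1
    ext a
    simp [RingHom.algebraMap_toAlgebra]
  have : LocallyOfFiniteType γ := by
    rw [HasRingHomProperty.Spec_iff (P := @LocallyOfFiniteType)]
    refine RingHom.FiniteType.of_comp_finiteType (f := algebraMap A (MvPolynomial (Fin m) A)) ?_
    rw [CommRingCat.hom_ofHom, AlgHom.toRingHom_eq_coe, AlgHom.comp_algebraMap]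
    exact RingHom.finiteType_algebraMap.mpr inferInstance
  obtain ⟨O, hO, hOγ⟩ := (Spec.map π).isEmbedding.isInducing.isOpen_iff.mp γ.quasiFiniteLocus.isOpen
  refine ⟨i '' O, i.isOpenEmbedding.isOpenMap _ hO, ⟨_, ?_, rfl⟩, ?_⟩
  · rw [← Set.mem_preimage, hOγ]; exact hqf
  rintro _ hzZ ⟨q, hqO, rfl⟩
  obtain ⟨Q', rfl⟩ : q ∈ Set.range (Spec.map π) := hπ.ge hzZ
  have hQ' : Q' ∈ γ.quasiFiniteLocus := hOγ.le hqO
  rw [relTrdeg_apply_of_locallyQuasiFinite, ← hcomm, relTrdeg_comp_of_locallyQuasiFinite,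
    relTrdeg_apply_of_locallyQuasiFinite, ← hγ]
  obtain ⟨Q', rfl⟩ : Q' ∈ Set.range γ.quasiFiniteLocus.ι := by simpa using hQ'
  rw [relTrdeg_apply_of_locallyQuasiFinite, ← Category.assoc, ← relTrdeg_apply_of_locallyQuasiFinite]
  exact (relTrdeg_mvPolynomial_le m _).trans_lt (by exact_mod_cast hmn)

open TopologicalSpace in
-- The closure of V is a finite union of irreducible closed sets, and those which meet V already
-- cover it. The generic point of such a piece lies in V.
lemma exists_specializes_of_mem_closure {Z : Type*} [TopologicalSpace Z] [NoetherianSpace Z]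
    [QuasiSober Z] {V : Set Z} (hV : IsOpen V) {z : Z} (hz : z ∈ closure V) : ∃ ξ ∈ V, ξ ⤳ z := by
  obtain ⟨T, hTfin, hTcl, hTirr, hT⟩ :=
    NoetherianSpace.exists_finite_set_isClosed_irreducible (isClosed_closure (s := V))
  have hsub : closure V ⊆ ⋃₀ {t ∈ T | (t ∩ V).Nonempty} := by
    refine closure_minimal (fun v hv => ?_) ?_
    · obtain ⟨t, ht, hvt⟩ := hT.le (subset_closure hv)
      exact ⟨t, ⟨ht, v, hvt, hv⟩, hvt⟩
    · rw [Set.sUnion_eq_biUnion]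
      have : {t ∈ T | (t ∩ V).Nonempty}.Finite := hTfin.subset (Set.sep_subset _ _)
      exact this.isClosed_biUnion fun t ht => hTcl t ht.1
  obtain ⟨t, ⟨ht, hne⟩, hzt⟩ := hsub hz
  obtain ⟨ξ, hξ⟩ := QuasiSober.sober (hTirr t ht) (hTcl t ht)
  refine ⟨ξ, (hξ.mem_open_set_iff hV).mpr hne, ?_⟩
  rw [specializes_iff_mem_closure, hξ]
  exact hzt

lemma exists_specializes_of_mem_closure_fiber {X S : Scheme.{u}} (f : X ⟶ S) [LocallyOfFiniteType f]
    {V : Set X} (hV : IsOpen V) {s : S} {z : X} (hz : z ∈ closure (V ∩ f ⁻¹' {s})) (hzs : f z = s) :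
    ∃ ξ ∈ V, ξ ⤳ z ∧ f ξ = s := by
  obtain ⟨z, rfl⟩ : z ∈ Set.range (f.fiberι s) := by rw [f.range_fiberι]; exact hzs
  have hemb := (f.fiberι s).isEmbedding
  have hz' : z ∈ closure (f.fiberι s ⁻¹' V) := by
    rw [hemb.isInducing.closure_eq_preimage_closure_image, Set.mem_preimage,
      Set.image_preimage_eq_inter_range, f.range_fiberι]
    exact hz
  have : LocallyOfFiniteType (f.fiberToSpecResidueField s) :=
    inferInstanceAs (LocallyOfFiniteType (pullback.snd f (S.fromSpecResidueField s)))
  have : IsLocallyNoetherian (f.fiber s) :=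
    LocallyOfFiniteType.isLocallyNoetherian (f.fiberToSpecResidueField s)
  obtain ⟨W, hW, hzW⟩ : ∃ W : (f.fiber s).Opens, IsAffineOpen W ∧ z ∈ W := by
    obtain ⟨_, ⟨W, hW, rfl⟩, hzW, -⟩ := (f.fiber s).isBasis_affineOpens.exists_subset_of_mem_open
      (Set.mem_univ z) isOpen_univ
    exact ⟨W, hW, hzW⟩
  have : IsNoetherianRing Γ(f.fiber s, W) := IsLocallyNoetherian.component_noetherian ⟨W, hW⟩
  have : TopologicalSpace.NoetherianSpace W := noetherianSpace_of_isAffineOpen W hW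
  have : QuasiSober W := (W.ι.isOpenEmbedding).quasiSober
  have hV' : IsOpen (f.fiberι s ⁻¹' V) := hV.preimage (f.fiberι s).continuous
  have hz'' : (⟨z, hzW⟩ : W) ∈ closure (W.ι ⁻¹' (f.fiberι s ⁻¹' V)) := by
    rw [W.ι.isOpenEmbedding.isEmbedding.isInducing.closure_eq_preimage_closure_image,
      Set.image_preimage_eq_inter_range, Set.inter_comm]
    exact W.ι.isOpenEmbedding.isOpen_range.inter_closure ⟨⟨_, rfl⟩, hz'⟩
  obtain ⟨ξ, hξV, hξ⟩ := exists_specializes_of_mem_closure (hV'.preimage W.ι.continuous) hz''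
  refine ⟨f.fiberι s (W.ι ξ), hξV, ?_, (f.range_fiberι s).le ⟨_, rfl⟩⟩
  exact (hξ.map W.ι.continuous).map (f.fiberι s).continuous

/-- The set `V` is dense in the fiber of `f` over `s`. -/
def FiberDense {X S : Scheme.{u}} (f : X ⟶ S) (V : Set X) (s : S) : Prop :=
  f ⁻¹' {s} ⊆ closure (V ∩ f ⁻¹' {s})

lemma HasRelDim.isOpen {X S : Scheme.{u}} (f : X ⟶ S) (n : ℕ) : IsOpen {x | HasRelDim f n x} := by
  rw [isOpen_iff_forall_mem_open]
  rintro x ⟨U, hx, hU⟩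
  exact ⟨U, fun x' hx' => ⟨U, hx', hU⟩, U.isOpen, hx⟩

lemma HasRelDim.exists_isOpen_image {X S : Scheme.{u}} {f : X ⟶ S} {n : ℕ} {x : X}
    (h : HasRelDim f n x) {Y : Set X} (hY : IsOpen Y) (hx : x ∈ Y) :
    ∃ M : Set S, IsOpen M ∧ f x ∈ M ∧ ∀ s ∈ M, ∃ y ∈ Y, f y = s ∧ HasRelDim f n y := by
  obtain ⟨U, hxU, hU⟩ := h
  have : Smooth (U.ι ≫ f) := SmoothOfRelativeDimension.smooth n _
  refine ⟨(U.ι ≫ f) '' (U.ι ⁻¹' Y), (U.ι ≫ f).isOpenMap _ (hY.preimage U.ι.continuous),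
    ⟨⟨x, hxU⟩, hx, rfl⟩, ?_⟩
  rintro _ ⟨y, hy, rfl⟩
  exact ⟨U.ι y, hy, rfl, U, y.2, hU⟩

lemma HasRelDim.of_specializes {X S : Scheme.{u}} {f : X ⟶ S} {n : ℕ} {x x' : X}
    (h : HasRelDim f n x) (hx : x' ⤳ x) : HasRelDim f n x' :=
  hx.mem_open (HasRelDim.isOpen f n) h

lemma HasRelDim.eq {X S : Scheme.{u}} {f : X ⟶ S} {n m : ℕ} {x : X}
    (h : HasRelDim f n x) (h' : HasRelDim f m x) : n = m := by
  obtain ⟨η, hη, -, hgen⟩ := exists_isFiberGeneric f x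
  exact_mod_cast ((h.of_specializes hη).relTrdeg_eq hgen).symm.trans
    ((h'.of_specializes hη).relTrdeg_eq hgen)

/-- If an open subset of a proper family whose fibers are generically smooth and equidimensional is
dense in one fiber, then it is dense in all nearby fibers. -/
theorem exists_nhds_fiberDense {X S : Scheme.{u}} (f : X ⟶ S) [LocallyOfFiniteType f]
    (hf : IsClosedMap f) {Y V : Set X} (hYo : IsOpen Y) (hVo : IsOpen V) (hVY : V ⊆ Y)
    (hY : ∀ s, FiberDense f Y s) (hdim : ∀ s, ∃ n, ∀ y ∈ Y, f y = s → HasRelDim f n y)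
    {s₀ : S} (hV : FiberDense f V s₀) :
    ∃ M : Set S, IsOpen M ∧ s₀ ∈ M ∧ ∀ s ∈ M, FiberDense f V s := by
  by_cases hs₀ : s₀ ∈ Set.range f
  swap
  -- When the fiber over s₀ is empty, the nearby fibers are empty as well, since f has closed image.
  · refine ⟨(Set.range f)ᶜ, hf.isClosed_range.isOpen_compl, hs₀, fun s hs x hx => ?_⟩
    exact absurd ⟨x, hx⟩ hs
  obtain ⟨x₀, hx₀⟩ := hs₀
  obtain ⟨v, -, hvV, hv⟩ : (Set.univ ∩ (V ∩ f ⁻¹' {s₀})).Nonempty :=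
    mem_closure_iff.mp (hV hx₀) _ isOpen_univ trivial
  obtain ⟨n, hn⟩ := hdim s₀
  obtain ⟨M₁, hM₁, hsM₁, H₁⟩ := (hn v (hVY hvV) hv).exists_isOpen_image hYo (hVY hvV)
  -- The relative dimension n of the fiber over s₀ persists nearby: smooth maps are open, so nearby
  -- fibers contain a point of relative dimension n, and the dimension is constant in each fiber.
  have hrel (s) (hs : s ∈ M₁) (y) (hy : y ∈ Y) (hys : f y = s) : HasRelDim f n y := by
    obtain ⟨y', hy', hys', hdy'⟩ := H₁ s hs
    obtain ⟨m, hm⟩ := hdim s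
    obtain rfl : n = m := hdy'.eq (hm y' hy' hys')
    exact hm y hy hys
  have H (x : X) (hx : x ∈ Vᶜ ∩ f ⁻¹' {s₀}) :
      ∃ N : Set X, IsOpen N ∧ x ∈ N ∧ ∀ z ∈ Vᶜ, z ∈ N → relTrdeg f z < n := by
    obtain ⟨hxV, rfl⟩ := hx
    refine exists_nhds_relTrdeg_lt f hVo.isClosed_compl hxV fun z hz hzx => ?_
    obtain ⟨ξ, hξV, hξz, hξ⟩ := exists_specializes_of_mem_closure_fiber f hVo (hV hzx) hzx
    refine ⟨ξ, hξz, fun h => hz (h ▸ hξV), hξ.trans hzx.symm, ?_⟩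
    exact (hn ξ (hVY hξV) hξ).relTrdeg_le
  choose! N hNo hxN hN using H
  let N' := ⋃ x ∈ Vᶜ ∩ f ⁻¹' {s₀}, N x
  have hN' : IsOpen N' := isOpen_biUnion hNo
  -- Closedness of f turns the pointwise neighborhoods N x into a neighborhood of the entire fiber.
  have hcl : IsClosed (f '' (Vᶜ ∩ N'ᶜ)) := hf _ (hVo.isClosed_compl.inter hN'.isClosed_compl)
  refine ⟨M₁ ∩ (f '' (Vᶜ ∩ N'ᶜ))ᶜ, hM₁.inter hcl.isOpen_compl, ⟨hv ▸ hsM₁, ?_⟩, ?_⟩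
  · rintro ⟨x, ⟨hxV, hxN'⟩, hx⟩
    exact hxN' (Set.mem_biUnion (show x ∈ Vᶜ ∩ f ⁻¹' {s₀} from ⟨hxV, hx⟩) (hxN x ⟨hxV, hx⟩))
  · rintro s ⟨hsM₁, hsN⟩ x hx
    rw [mem_closure_iff]
    intro O hO hxO
    by_contra hemp
    obtain ⟨y, hyO, hyY, hys⟩ := mem_closure_iff.mp (hY s hx) O hO hxO
    -- If V were not dense, some generic point η of the fiber would avoid V. Its transcendence
    -- degree is n by smoothness, but less than n because it lies near the complement of V over s₀.
    obtain ⟨η, hηy, hη, hgen⟩ := exists_isFiberGeneric f y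
    have hηs : f η = s := hη.trans hys
    have hηV : η ∉ V := fun h => hemp ⟨η, hηy.mem_open hO hyO, h, hηs⟩
    have hηN : η ∈ N' := by
      by_contra h
      exact hsN ⟨η, ⟨hηV, h⟩, hηs⟩
    obtain ⟨x', hx', hηx'⟩ := Set.mem_iUnion₂.mp hηN
    have h₁ := hN x' hx' η hηV hηx'
    rw [(hrel s hsM₁ η (hηy.mem_open hYo hyY) hηs).relTrdeg_eq hgen] at h₁
    exact lt_irrefl _ h₁

lemma respectsIso_smooth : MorphismProperty.RespectsIso (@Smooth.{u}) :=
  MorphismProperty.IsStableUnderBaseChange.respectsIso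

lemma respectsIso_smoothOfRelativeDimension (n : ℕ) :
    MorphismProperty.RespectsIso (@SmoothOfRelativeDimension.{u} n) :=
  have : MorphismProperty.IsStableUnderBaseChange (@SmoothOfRelativeDimension.{u} n) :=
    smoothOfRelativeDimension_isStableUnderBaseChange n
  MorphismProperty.IsStableUnderBaseChange.respectsIso

/-! ### Base change of density and of relative dimension -/

lemma fiberDense_iff {X S : Scheme.{u}} {f : X ⟶ S} {V : Set X} {s : S} :
    FiberDense f V s ↔ Dense (f.fiberι s ⁻¹' V) := by
  rw [FiberDense, ← f.range_fiberι, ← Set.image_preimage_eq_inter_range, dense_iff_closure_eq,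
    (f.fiberι s).isEmbedding.isInducing.closure_eq_preimage_closure_image, ← Set.univ_subset_iff,
    ← Set.image_subset_iff, Set.image_univ]

lemma FiberDense.preimage {X S X' S' : Scheme.{u}} {f : X ⟶ S} {f' : X' ⟶ S'} {p : X' ⟶ X}
    {g : S' ⟶ S} (h : IsPullback p f' f g) {V : Set X} {s : S'} (hV : FiberDense f V (g s)) :
    FiberDense f' (p ⁻¹' V) s := by
  rw [fiberDense_iff] at hV ⊢
  have hpb := isPullback_fiberToSpecResidueField_of_isPullback h s
  set m := pullback.map f' (S'.fromSpecResidueField s) f (S.fromSpecResidueField (g s)) p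
    (Spec.map (g.residueFieldMap s)) g h.w.symm (by simp)
  have hK : UniversallyOpen (Spec.map (g.residueFieldMap s)) :=
    inferInstanceAs (UniversallyOpen (Spec.map (CommRingCat.ofHom (g.residueFieldMap s).hom)))
  have hm : UniversallyOpen m := MorphismProperty.of_isPullback hpb.flip hK
  have hm' : m ≫ f.fiberι (g s) = f'.fiberι s ≫ p := pullback.lift_fst _ _ _
  have := hV.preimage m.isOpenMap
  have heq : m ⁻¹' (f.fiberι (g s) ⁻¹' V) = f'.fiberι s ⁻¹' (p ⁻¹' V) :=
    congrArg (fun h : f'.fiber s ⟶ X => h ⁻¹' V) hm'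
  exact heq ▸ this

lemma HasRelDim.of_isPullback {X S X' S' : Scheme.{u}} {f : X ⟶ S} {f' : X' ⟶ S'} {p : X' ⟶ X}
    {g : S' ⟶ S} (h : IsPullback p f' f g) {n : ℕ} {x : X'} (hx : HasRelDim f n (p x)) :
    HasRelDim f' n x := by
  obtain ⟨U, hxU, hU⟩ := hx
  refine ⟨p ⁻¹ᵁ U, hxU, ?_⟩
  have := smoothOfRelativeDimension_isStableUnderBaseChange n
  exact MorphismProperty.of_isPullback (P := @SmoothOfRelativeDimension n)
    ((isPullback_morphismRestrict p U).paste_vert h) hU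

lemma hasRelDim_of_isOpenImmersion {U X S : Scheme.{u}} (i : U ⟶ X) [IsOpenImmersion i] (f : X ⟶ S)
    (n : ℕ) [SmoothOfRelativeDimension n (i ≫ f)] (x : U) : HasRelDim f n (i x) := by
  refine ⟨i.opensRange, ⟨x, rfl⟩, ?_⟩
  have : i.isoOpensRange.inv ≫ i ≫ f = i.opensRange.ι ≫ f := by simp
  rw [← this]
  have := respectsIso_smoothOfRelativeDimension.{u} n
  exact (MorphismProperty.cancel_left_of_respectsIso (@SmoothOfRelativeDimension n) _ _).mpr ‹_›

lemma exists_smoothOfRelativeDimension {A B : CommRingCat.{u}} (ψ : A ⟶ B)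
    (h : ψ.hom.IsStandardSmooth) : ∃ n, SmoothOfRelativeDimension n (Spec.map ψ) := by
  obtain ⟨_, _, _, _, ⟨P⟩⟩ := h
  let := ψ.hom.toAlgebra
  have h : ψ.hom.IsStandardSmoothOfRelativeDimension P.dimension := ⟨_, _, _, ‹_›, P, rfl⟩
  refine ⟨P.dimension, ?_⟩
  rw [HasRingHomProperty.Spec_iff (P := @SmoothOfRelativeDimension P.dimension)]
  exact RingHom.locally_of RingHom.isStandardSmoothOfRelativeDimension_respectsIso _ h

lemma smooth_smoothLocus_ι_comp {X S : Scheme.{u}} (f : X ⟶ S) [LocallyOfFinitePresentation f] :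
    Smooth (f.smoothLocus.ι ≫ f) := by
  rw [← Scheme.Hom.smoothLocus_eq_top_iff, ← Scheme.Hom.preimage_smoothLocus_eq]
  simp

lemma exists_hasRelDim {X S : Scheme.{u}} (f : X ⟶ S) [LocallyOfFinitePresentation f] {x : X}
    (hx : x ∈ f.smoothLocus) : ∃ n, HasRelDim f n x := by
  have := smooth_smoothLocus_ι_comp f
  obtain ⟨U, hU, V, hV, hxV, e, he⟩ :=
    Smooth.exists_isStandardSmooth (f.smoothLocus.ι ≫ f) ⟨x, hx⟩
  obtain ⟨n, hn⟩ := exists_smoothOfRelativeDimension _ he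
  refine ⟨n, ?_⟩
  obtain ⟨y, hy⟩ : (⟨x, hx⟩ : f.smoothLocus) ∈ Set.range hV.fromSpec := by
    rw [hV.range_fromSpec]; exact hxV
  have : SmoothOfRelativeDimension n ((hV.fromSpec ≫ f.smoothLocus.ι) ≫ f) := by
    rw [Category.assoc, ← hU.SpecMap_appLE_fromSpec _ hV e]
    exact inferInstanceAs (SmoothOfRelativeDimension (n + 0) _)
  have := hasRelDim_of_isOpenImmersion (hV.fromSpec ≫ f.smoothLocus.ι) f n y
  rwa [Scheme.Hom.comp_apply, hy] at this

lemma mem_smoothLocus_of_smooth {U X S : Scheme.{u}} (i : U ⟶ X) [IsOpenImmersion i] (f : X ⟶ S)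
    [LocallyOfFinitePresentation f] [Smooth (i ≫ f)] (x : U) : i x ∈ f.smoothLocus := by
  have : x ∈ i ⁻¹ᵁ f.smoothLocus := by
    rw [Scheme.Hom.preimage_smoothLocus_eq, Scheme.Hom.smoothLocus_eq_top]
    trivial
  exact this

/-- The fibral criterion: a flat finitely presented algebra with smooth fiber is smooth at q, and
smoothness spreads to a basic open neighborhood. -/
lemma exists_smooth_of_smooth_fiber {A B : CommRingCat.{u}} (φ : A ⟶ B)
    (hfp : φ.hom.FinitePresentation) (hfl : φ.hom.Flat) (q : Spec B)
    (h : Smooth ((Spec.map φ).fiberToSpecResidueField (Spec.map φ q))) :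
    ∃ r : B, r ∉ q.asIdeal ∧
      Smooth (Spec.map (CommRingCat.ofHom (algebraMap B (Localization.Away r))) ≫ Spec.map φ) := by
  algebraize [φ.hom]
  have := respectsIso_smooth.{u}
  have hq : q.asIdeal.IsPrime := q.isPrime
  let p : PrimeSpectrum A := PrimeSpectrum.comap (algebraMap A B) q
  have : q.asIdeal.LiesOver p.asIdeal := ⟨rfl⟩
  have : Algebra.FormallySmooth p.asIdeal.ResidueField (p.asIdeal.Fiber B) := by
    rw [← RingHom.formallySmooth_algebraMap]
    refine RingHom.Smooth.formallySmooth ?_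
    rw [← CommRingCat.hom_ofHom (algebraMap p.asIdeal.ResidueField (p.asIdeal.Fiber B)),
      ← HasRingHomProperty.Spec_iff (P := @Smooth),
      ← MorphismProperty.arrow_mk_iso_iff (P := @Smooth)
      (Spec.fiberToSpecResidueFieldIso A B p)]
    exact h
  have : Algebra.IsSmoothAt A q.asIdeal := .of_formallySmooth_fiber p.asIdeal _
  obtain ⟨r, hr, hsm⟩ := Algebra.IsSmoothAt.exists_notMem_smooth A q.asIdeal
  refine ⟨r, hr, ?_⟩
  rw [← Spec.map_comp, HasRingHomProperty.Spec_iff (P := @Smooth)]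
  have : (algebraMap B (Localization.Away r)).comp φ.hom = algebraMap A (Localization.Away r) :=
    (IsScalarTower.algebraMap_eq A B (Localization.Away r)).symm
  rw [CommRingCat.hom_comp, CommRingCat.hom_ofHom, this]
  exact RingHom.smooth_algebraMap.mpr hsm

lemma smooth_fiber_of_chart {X S : Scheme.{u}} (f : X ⟶ S) [LocallyOfFinitePresentation f]
    {A B : CommRingCat.{u}} (φ : A ⟶ B) (i : Spec B ⟶ X) (j : Spec A ⟶ S) [IsOpenImmersion i]
    [IsOpenImmersion j] (h : Spec.map φ ≫ j = i ≫ f) (p : Spec A)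
    (hi : ∀ z : f.fiber (j p), f.fiberι _ z ∈ Set.range i →
      z ∈ (f.fiberToSpecResidueField (j p)).smoothLocus) :
    Smooth ((Spec.map φ).fiberToSpecResidueField p) := by
  let m : (Spec.map φ).fiber p ⟶ f.fiber (j p) :=
    pullback.map _ _ _ _ i (Spec.map (j.residueFieldMap p)) j h (by simp)
  have hm : IsOpenImmersion m := inferInstanceAs (IsOpenImmersion (pullback.map _ _ _ _ _ _ _ _ _))
  have hm₁ : m ≫ f.fiberι (j p) = (Spec.map φ).fiberι p ≫ i := pullback.lift_fst _ _ _
  have hm₂ : m ≫ f.fiberToSpecResidueField (j p) =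
      (Spec.map φ).fiberToSpecResidueField p ≫ Spec.map (j.residueFieldMap p) :=
    pullback.lift_snd _ _ _
  have : Smooth (m ≫ f.fiberToSpecResidueField (j p)) := by
    rw [← Scheme.Hom.smoothLocus_eq_top_iff, ← Scheme.Hom.preimage_smoothLocus_eq, ← top_le_iff]
    intro z _
    refine hi (m z) ⟨(Spec.map φ).fiberι p z, ?_⟩
    rw [← Scheme.Hom.comp_apply, ← Scheme.Hom.comp_apply, hm₁]
  rw [hm₂] at this
  have hiso := respectsIso_smooth.{u}
  exact (MorphismProperty.cancel_right_of_respectsIso @Smooth _ _).mp this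

/-- For a flat morphism, smoothness at a point can be checked in the fiber. -/
lemma fiberι_mem_smoothLocus {X S : Scheme.{u}} (f : X ⟶ S) [LocallyOfFinitePresentation f] [Flat f]
    {s : S} {z : f.fiber s} (hz : z ∈ (f.fiberToSpecResidueField s).smoothLocus) :
    f.fiberι s z ∈ f.smoothLocus := by
  obtain ⟨O, hO, hOz⟩ := (f.fiberι s).isEmbedding.isInducing.isOpen_iff.mp
    (f.fiberToSpecResidueField s).smoothLocus.isOpen
  have hs : f (f.fiberι s z) = s := (f.range_fiberι s).le ⟨z, rfl⟩
  obtain ⟨_, ⟨U, hU, rfl⟩, hxU, -⟩ := S.isBasis_affineOpens.exists_subset_of_mem_open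
    (Set.mem_univ (f (f.fiberι s z))) isOpen_univ
  obtain ⟨_, ⟨W, hW, rfl⟩, hxW, hWU⟩ := X.isBasis_affineOpens.exists_subset_of_mem_open
    (show f.fiberι s z ∈ (f ⁻¹ᵁ U : Set X) ∩ O from ⟨hxU, hOz.ge hz⟩)
    ((f ⁻¹ᵁ U).isOpen.inter hO)
  replace hU : IsAffineOpen U := hU
  replace hW : IsAffineOpen W := hW
  have hWU' : W ≤ f ⁻¹ᵁ U := fun w hw => (hWU hw).1
  have hcomm := hU.SpecMap_appLE_fromSpec f hW hWU'
  obtain ⟨q, hq⟩ : f.fiberι s z ∈ Set.range hW.fromSpec := by rw [hW.range_fromSpec]; exact hxW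
  have hqs : hU.fromSpec (Spec.map (f.appLE U W hWU') q) = s := by
    rw [← Scheme.Hom.comp_apply, hcomm, Scheme.Hom.comp_apply, hq, hs]
  subst hqs
  have hfib := smooth_fiber_of_chart f _ _ _ hcomm (Spec.map (f.appLE U W hWU') q) fun z' hz' => by
    rw [hW.range_fromSpec] at hz'
    exact hOz.le (hWU hz').2
  obtain ⟨r, hr, hsm⟩ := exists_smooth_of_smooth_fiber _
    (HasRingHomProperty.appLE @LocallyOfFinitePresentation f inferInstance ⟨U, hU⟩ ⟨W, hW⟩ hWU')
    (HasRingHomProperty.appLE @Flat f inferInstance ⟨U, hU⟩ ⟨W, hW⟩ hWU') q hfib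
  obtain ⟨q', hq'⟩ : q ∈ Set.range
      (Spec.map (CommRingCat.ofHom (algebraMap Γ(X, W) (Localization.Away r)))) :=
    (PrimeSpectrum.localization_away_comap_range (Localization.Away r) r).ge hr
  have : Smooth ((Spec.map (CommRingCat.ofHom (algebraMap Γ(X, W) (Localization.Away r))) ≫
      hW.fromSpec) ≫ f) := by
    rw [Category.assoc, ← hcomm, ← Category.assoc]
    infer_instance
  have := mem_smoothLocus_of_smooth (Spec.map (CommRingCat.ofHom
    (algebraMap Γ(X, W) (Localization.Away r))) ≫ hW.fromSpec) f q'
  rwa [Scheme.Hom.comp_apply, hq', hq] at this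

/-! ### Dimension and transcendence degree -/

lemma indepMod_zero {A B : Type*} [CommRing A] [CommRing B] (φ : A →+* B) (q : Ideal B)
    (b : Fin 0 → B) : IndepMod φ q b := by
  intro F hF m
  rw [F.eq_C_of_isEmpty, MvPolynomial.eval₂_C] at hF
  rwa [Subsingleton.elim m 0]

/-- Each strict inclusion in the chain is a strict generization of generic points and adds an
independent function by `IndepMod.cons`. Over a field the condition on contractions to the base is
automatic. -/
lemma exists_indepMod_of_ltSeries {k : Type u} [Field k] {Z : Scheme.{u}} (g : Z ⟶ Spec (.of k))
    (l : LTSeries (TopologicalSpace.IrreducibleCloseds Z)) :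
    ∃ (B : CommRingCat.{u}) (ψ : .of k ⟶ B) (i : Spec B ⟶ Z) (y : Spec B) (b : Fin l.length → B),
      IsOpenImmersion i ∧ i ≫ g = Spec.map ψ ∧ closure {i y} = (l.last : Set Z) ∧
        IndepMod ψ.hom y.asIdeal b := by
  induction l using RelSeries.inductionOn' with
  | singleton C =>
    obtain ⟨z, hz⟩ := QuasiSober.sober C.isIrreducible C.isClosed
    obtain ⟨_, ⟨U, hU, rfl⟩, hyU, -⟩ := Z.isBasis_affineOpens.exists_subset_of_mem_open
      (Set.mem_univ z) isOpen_univ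
    replace hU : IsAffineOpen U := hU
    obtain ⟨y, rfl⟩ : z ∈ Set.range hU.fromSpec := by rw [hU.range_fromSpec]; exact hyU
    refine ⟨_, Spec.preimage (hU.fromSpec ≫ g), hU.fromSpec, y, Fin.elim0, inferInstance,
      (Spec.map_preimage _).symm, hz, indepMod_zero _ _ _⟩
  | snoc l C h ih =>
    obtain ⟨B, ψ, i, y, b, _, hi, hy, hb⟩ := ih
    obtain ⟨z, hz⟩ := QuasiSober.sober C.isIrreducible C.isClosed
    have hlt : (l.last : Set Z) ⊂ C := h
    have hzy : z ⤳ i y := by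
      rw [specializes_iff_closure_subset, hy, hz]
      exact hlt.subset
    obtain ⟨y', rfl⟩ : z ∈ Set.range i :=
      hzy.mem_open i.isOpenEmbedding.isOpen_range ⟨y, rfl⟩
    have hyy : y' ⤳ y := i.isOpenEmbedding.isInducing.specializes_iff.mp hzy
    have hle : y'.asIdeal ≤ y.asIdeal := (PrimeSpectrum.le_iff_specializes _ _).mpr hyy
    have hne : ¬ y.asIdeal ≤ y'.asIdeal := fun hle' => by
      have : y' = y := PrimeSpectrum.ext (hle.antisymm hle')
      rw [← this, hz] at hy
      exact hlt.ne hy.symm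
    obtain ⟨c, hc, hc'⟩ := Set.not_subset.mp hne
    refine ⟨B, ψ, i, y', Fin.cons c b, inferInstance, hi, by rw [RelSeries.last_snoc]; exact hz, ?_⟩
    refine hb.cons hle ?_ hc hc'
    have h₁ (q : Spec B) : q.asIdeal.comap ψ.hom = ⊥ :=
      Ideal.eq_bot_of_prime (h := Ideal.comap_isPrime _ _) _
    exact (h₁ y).trans (h₁ y').symm

lemma topologicalKrullDim_closure_le {k : Type u} [Field k] {Z : Scheme.{u}} (g : Z ⟶ Spec (.of k))
    {η : Z} {n : ℕ} (h : relTrdeg g η ≤ n) : topologicalKrullDim (closure {η}) ≤ n := by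
  refine iSup_le fun l => ?_
  let l' := l.map _ (TopologicalSpace.IrreducibleCloseds.map_strictMono_of_isInducing
    (Topology.IsInducing.subtypeVal (t := closure {η})))
  obtain ⟨B, ψ, i, y, b, _, hi, hy, hb⟩ := exists_indepMod_of_ltSeries g l'
  have hη : η ⤳ i y := by
    rw [specializes_iff_mem_closure]
    have : i y ∈ (l'.last : Set Z) := hy.le (subset_closure rfl)
    have hle : (l'.last : Set Z) ⊆ closure {η} := by
      rw [show l'.last = TopologicalSpace.IrreducibleCloseds.map _ continuous_subtype_val l.last from rfl]
      refine closure_minimal ?_ isClosed_closure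
      rintro _ ⟨z, -, rfl⟩
      exact z.2
    exact hle this
  obtain ⟨y', rfl⟩ : η ∈ Set.range i := hη.mem_open i.isOpenEmbedding.isOpen_range ⟨y, rfl⟩
  have hle : y'.asIdeal ≤ y.asIdeal := (PrimeSpectrum.le_iff_specializes _ _).mpr
    (i.isOpenEmbedding.isInducing.specializes_iff.mp hη)
  rw [relTrdeg_apply_of_locallyQuasiFinite, hi] at h
  have key : l.length ≤ n := by
    -- If the chain stops short of η, one more step reaches it and the inequality is even strict.
    rcases eq_or_ne y' y with rfl | hne
    · exact_mod_cast hb.le_relTrdeg.trans h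
    · obtain ⟨c, hc, hc'⟩ := Set.not_subset.mp
        (fun hle' => hne (PrimeSpectrum.ext (hle.antisymm hle')))
      have h₁ (q : Spec B) : q.asIdeal.comap ψ.hom = ⊥ :=
        Ideal.eq_bot_of_prime (h := Ideal.comap_isPrime _ _) _
      have := (hb.cons hle ((h₁ y).trans (h₁ y').symm) hc hc').le_relTrdeg.trans h
      have : l'.length + 1 ≤ n := by exact_mod_cast this
      exact (Nat.le_succ _).trans this
  exact_mod_cast key

lemma ringKrullDim_le_of_finite_of_injective {A D : Type*} [CommRing A] [CommRing D] [IsDomain A]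
    [Algebra A D] [Algebra.IsIntegral A D] (h : Function.Injective (algebraMap A D)) :
    ringKrullDim A ≤ ringKrullDim D := by
  refine iSup_le fun l => ?_
  have : FaithfulSMul A D := (faithfulSMul_iff_algebraMap_injective A D).mpr h
  obtain ⟨P, -, hP, hPl⟩ := Ideal.exists_ideal_over_prime_of_isIntegral l.head.asIdeal (⊥ : Ideal D)
    (by rw [← RingHom.ker_eq_comap_bot, (RingHom.injective_iff_ker_eq_bot _).mp h]; exact bot_le)
  have : P.LiesOver l.head.asIdeal := ⟨hPl.symm⟩
  obtain ⟨L, hL, -⟩ := Ideal.exists_ltSeries_of_hasGoingUp (S := D) l P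
  rw [← hL]
  exact Order.LTSeries.length_le_krullDim L

lemma relTrdeg_le_of_finite {A B D : CommRingCat.{u}} (ψ : A ⟶ B) (π : B ⟶ D)
    (hπ : Function.Surjective π.hom) {m : ℕ} (φ : CommRingCat.of (MvPolynomial (Fin m) A) ⟶ D)
    (hφ : φ.hom.Finite) (h : CommRingCat.ofHom MvPolynomial.C ≫ φ = ψ ≫ π) (z : Spec D) :
    relTrdeg (Spec.map ψ) (Spec.map π z) ≤ m := by
  have hcomp : Spec.map π ≫ Spec.map ψ =
      Spec.map φ ≫ Spec.map (CommRingCat.ofHom (MvPolynomial.C (R := A) (σ := Fin m))) := by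
    rw [← Spec.map_comp, ← Spec.map_comp, h]
  have hπ' : IsClosedImmersion (Spec.map π) := IsClosedImmersion.spec_of_surjective _ hπ
  have hφ' : IsFinite (Spec.map φ) := IsFinite.SpecMap_iff _ |>.mpr hφ
  rw [relTrdeg_apply_of_locallyQuasiFinite, hcomp, ← relTrdeg_apply_of_locallyQuasiFinite]
  exact relTrdeg_mvPolynomial_le m _

lemma exists_SpecMap_quotient_eq {B : CommRingCat.{u}} (y : Spec B) :
    ∃ z, Spec.map (CommRingCat.ofHom (Ideal.Quotient.mk y.asIdeal)) z = y := by
  have : y ∈ PrimeSpectrum.zeroLocus (RingHom.ker (Ideal.Quotient.mk y.asIdeal) : Set B) := by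
    rw [Ideal.mk_ker]
    exact le_refl y.asIdeal
  exact (range_comap_of_surjective _ _ Ideal.Quotient.mk_surjective).ge this

/-- By Noether normalization the quotient is finite over a polynomial ring in m variables, so it has
dimension at least m, while its residue fields have transcendence degree at most m. -/
lemma le_ringKrullDim_quotient {k : Type u} [Field k] {B : CommRingCat.{u}} (ψ : .of k ⟶ B)
    (hψ : ψ.hom.FiniteType) {y : Spec B} {n : ℕ} (h : n ≤ relTrdeg (Spec.map ψ) y) :
    n ≤ ringKrullDim (B ⧸ y.asIdeal) := by
  algebraize [ψ.hom]
  have hB : Algebra.FiniteType k B := hψ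
  obtain ⟨m, φ, hφi, hφ⟩ := exists_finite_inj_algHom_of_fg k (B ⧸ y.asIdeal)
  algebraize [φ.toRingHom]
  have hkm : ringKrullDim (MvPolynomial (Fin m) k) = m := by
    simp [MvPolynomial.ringKrullDim_of_isNoetherianRing]
  have hint : Algebra.IsIntegral (MvPolynomial (Fin m) k) (B ⧸ y.asIdeal) :=
    ⟨fun x => RingHom.Finite.to_isIntegral hφ x⟩
  have hD : ringKrullDim (MvPolynomial (Fin m) k) ≤ ringKrullDim (B ⧸ y.asIdeal) :=
    ringKrullDim_le_of_finite_of_injective hφi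
  refine le_trans ?_ (hkm.symm.le.trans hD)
  have hnm : n ≤ m := by
    obtain ⟨z, hz⟩ := exists_SpecMap_quotient_eq y
    have := relTrdeg_le_of_finite ψ (CommRingCat.ofHom (Ideal.Quotient.mk y.asIdeal))
      Ideal.Quotient.mk_surjective (CommRingCat.ofHom φ.toRingHom) hφ
      (CommRingCat.hom_ext (RingHom.ext φ.commutes)) z
    rw [hz] at this
    exact_mod_cast h.trans this
  exact_mod_cast hnm

lemma le_topologicalKrullDim_closure {k : Type u} [Field k] {Z : Scheme.{u}} (g : Z ⟶ Spec (.of k))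
    [LocallyOfFiniteType g] {η : Z} {n : ℕ} (h : n ≤ relTrdeg g η) :
    n ≤ topologicalKrullDim (closure {η}) := by
  obtain ⟨_, ⟨U, hU, rfl⟩, hyU, -⟩ := Z.isBasis_affineOpens.exists_subset_of_mem_open
    (Set.mem_univ η) isOpen_univ
  replace hU : IsAffineOpen U := hU
  obtain ⟨y, rfl⟩ : η ∈ Set.range hU.fromSpec := by rw [hU.range_fromSpec]; exact hyU
  have hψ := Spec.map_preimage (hU.fromSpec ≫ g)
  set ψ := Spec.preimage (hU.fromSpec ≫ g)
  have hft : ψ.hom.FiniteType := by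
    rw [← HasRingHomProperty.Spec_iff (P := @LocallyOfFiniteType), hψ]
    infer_instance
  rw [relTrdeg_apply_of_locallyQuasiFinite, ← hψ] at h
  refine (le_ringKrullDim_quotient ψ hft h).trans ?_
  rw [← PrimeSpectrum.topologicalKrullDim_eq_ringKrullDim]
  have hind : Topology.IsInducing (fun z : PrimeSpectrum (Γ(Z, U) ⧸ y.asIdeal) =>
      hU.fromSpec (PrimeSpectrum.comap (Ideal.Quotient.mk y.asIdeal) z)) :=
    hU.fromSpec.isOpenEmbedding.isInducing.comp
      (PrimeSpectrum.isClosedEmbedding_comap_of_surjective _ _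
        Ideal.Quotient.mk_surjective).isInducing
  refine (hind.codRestrict (s := closure {hU.fromSpec y}) fun z => ?_).topologicalKrullDim_le
  rw [← specializes_iff_mem_closure]
  refine Specializes.map ?_ hU.fromSpec.continuous
  refine (PrimeSpectrum.le_iff_specializes _ _).mp fun b hb => ?_
  rw [PrimeSpectrum.comap_asIdeal, Ideal.mem_comap, Ideal.Quotient.eq_zero_iff_mem.mpr hb]
  exact Ideal.zero_mem _

lemma topologicalKrullDim_closure {k : Type u} [Field k] {Z : Scheme.{u}} (g : Z ⟶ Spec (.of k))
    [LocallyOfFiniteType g] {η : Z} {n : ℕ} (h : relTrdeg g η = n) :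
    topologicalKrullDim (closure {η}) = n :=
  (topologicalKrullDim_closure_le g h.le).antisymm (le_topologicalKrullDim_closure g h.ge)

/-- At the generic point of a component through z, the relative dimension equals the transcendence
degree, which is the dimension of that component. Pure-dimensionality enters only here. -/
lemma exists_forall_hasRelDim_of_field {k : Type u} [Field k] {Z : Scheme.{u}}
    (g : Z ⟶ Spec (.of k)) [LocallyOfFiniteType g] (hZ : IsPureDimensional Z) :
    ∃ n, ∀ z m, HasRelDim g m z → m = n := by
  obtain ⟨n, hn⟩ := hZ
  refine ⟨n, fun z m hz => ?_⟩
  obtain ⟨η, hη, -, hgen⟩ := exists_isFiberGeneric g z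
  obtain ⟨U, hzU, hU⟩ := hz
  have hη' : HasRelDim g m η := ⟨U, hη.mem_open U.isOpen hzU, hU⟩
  have h₁ := topologicalKrullDim_closure g (hη'.relTrdeg_eq hgen)
  have h₂ := hn (closure {η}) ?_
  · exact_mod_cast h₁.symm.trans h₂
  · obtain ⟨ξ, hξ⟩ := QuasiSober.sober (isIrreducible_irreducibleComponent (x := η))
      isClosed_irreducibleComponent
    have hξη : ξ ⤳ η := by
      rw [specializes_iff_mem_closure, hξ]
      exact mem_irreducibleComponent
    rw [← hgen ξ hξη (Subsingleton.elim _ _), hξ]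
    exact irreducibleComponent_mem_irreducibleComponents η

/-- If the fiber over `s` is pure-dimensional then the relative dimension is constant along the
smooth points of the fiber. -/
lemma exists_forall_hasRelDim {X S : Scheme.{u}} (f : X ⟶ S) [LocallyOfFinitePresentation f] (s : S)
    (h : IsPureDimensional (f.fiber s)) :
    ∃ n, ∀ x ∈ f.smoothLocus, f x = s → HasRelDim f n x := by
  have : @LocallyOfFiniteType (f.fiber s) (Spec (.of (S.residueField s)))
      (f.fiberToSpecResidueField s) :=
    inferInstanceAs (LocallyOfFiniteType (pullback.snd f (S.fromSpecResidueField s)))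
  obtain ⟨n, hn⟩ := exists_forall_hasRelDim_of_field (k := S.residueField s)
    (f.fiberToSpecResidueField s) h
  refine ⟨n, fun x hx hs => ?_⟩
  obtain ⟨m, hm⟩ := exists_hasRelDim f hx
  obtain ⟨z, rfl⟩ : x ∈ Set.range (f.fiberι s) := by rw [f.range_fiberι]; exact hs
  have := hn z m (hm.of_isPullback (IsPullback.of_hasPullback f (S.fromSpecResidueField s)))
  rwa [← this]

lemma fiberDense_smoothLocus {X S : Scheme.{u}} (f : X ⟶ S) [LocallyOfFinitePresentation f] [Flat f]
    {s : S} (h : Dense ((f.fiberToSpecResidueField s).smoothLocus : Set (f.fiber s))) :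
    FiberDense f f.smoothLocus s :=
  fiberDense_iff.mpr (h.mono fun _ hz => fiberι_mem_smoothLocus f hz)

/-! ### Sections of the sheaf of components -/

section Cls

variable {Y S : Scheme.{u}} (f : Y ⟶ S)

/-- The section of the presheaf quotient defined by `a : U ⟶ Y`. -/
def presheafCls {U : Scheme.{u}} (a : U ⟶ Y) : (componentPresheaf f).obj (op U) :=
  ULift.up (Quotient.mk (componentSetoid f U) a)

/-- The section of `π₀(Y/S)` defined by `a : U ⟶ Y`. -/
def cls {U : Scheme.{u}} (a : U ⟶ Y) : (piZero f).obj (op U) :=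
  (toSheafify Scheme.etaleTopology.{u} (componentPresheaf f)).app (op U) (presheafCls f a)

lemma map_cls {U V : Scheme.{u}} (g : V ⟶ U) (a : U ⟶ Y) :
    (piZero f).map g.op (cls f a) = cls f (g ≫ a) :=
  (NatTrans.naturality_apply (toSheafify Scheme.etaleTopology.{u} (componentPresheaf f)) g.op
    (presheafCls f a)).symm

lemma piZeroToBase_cls {U : Scheme.{u}} (a : U ⟶ Y) :
    (piZeroToBase f).app (op U) (cls f a) = ULift.up (a ≫ f) := by
  have := toSheafify_sheafifyLift Scheme.etaleTopology.{u} (componentPresheafToBase f)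
    (isSheaf_scheme S)
  exact ConcreteCategory.congr_hom (NatTrans.congr_app this (op U)) (presheafCls f a)

variable {f}

/-- Geometric points are points of the étale site: they lift along every covering. -/
lemma exists_lift_of_mem_etaleTopology {U : Scheme.{u}} {R : Sieve U}
    (hR : R ∈ Scheme.etaleTopology.{u} U) {K : Type u} [Field K] [IsAlgClosed K]
    (τ : Spec (.of K) ⟶ U) :
    ∃ (V : Scheme.{u}) (g : V ⟶ U) (σ : Spec (.of K) ⟶ V), R g ∧ σ ≫ g = τ := by
  obtain ⟨V, g, hg, σ, hσ⟩ := (Scheme.geometricFiber K).jointly_surjective R hR τ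
  exact ⟨V, g, σ, hg, hσ⟩

lemma arrow_of_mem_etaleTopology {K : Type u} [Field K] [IsAlgClosed K]
    {R : Sieve (Spec (.of K))} (hR : R ∈ Scheme.etaleTopology.{u} (Spec (.of K))) : R (𝟙 _) := by
  obtain ⟨V, g, σ, hg, hσ⟩ := exists_lift_of_mem_etaleTopology hR (𝟙 _)
  rw [← hσ]
  exact R.downward_closed hg σ

/-- The presheaf quotient is already separated. Equality after sheafification means equality on a
covering, while the relation is tested at geometric points, which lift to the covering. -/
lemma cls_eq_iff {U : Scheme.{u}} {a b : U ⟶ Y} : cls f a = cls f b ↔ SameComponent f a b := by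
  refine ⟨fun h => ?_, fun h => ?_⟩
  · have hR := Presheaf.equalizerSieve_mem Scheme.etaleTopology.{u}
      (toSheafify Scheme.etaleTopology.{u} (componentPresheaf f)) (presheafCls f a)
      (presheafCls f b) h
    have hab : a ≫ f = b ≫ f := by
      have := congrArg ((piZeroToBase f).app (op U)) h
      rw [piZeroToBase_cls, piZeroToBase_cls] at this
      exact congrArg ULift.down this
    refine sameComponent_iff.mpr ⟨hab, fun K _ _ t => ?_⟩
    obtain ⟨V, g, σ, hg, rfl⟩ := exists_lift_of_mem_etaleTopology hR t
    have h₁ : SameComponent f (g ≫ a) (g ≫ b) :=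
      Quotient.exact (s := componentSetoid f V) (congrArg ULift.down hg)
    rw [Category.assoc, Category.assoc]
    exact (sameComponent_iff.mp h₁).2 K σ
  · have : presheafCls f a = presheafCls f b :=
      congrArg ULift.up (Quotient.sound (s := componentSetoid f U) h)
    rw [cls, this, cls]

lemma cls_eq_iff_rel [Smooth f] {K : Type u} [Field K] [IsAlgClosed K] {a b : Spec (.of K) ⟶ Y} :
    cls f a = cls f b ↔ Rel f a b := by
  rw [cls_eq_iff, sameComponent_iff]
  refine ⟨fun h => by simpa using h.2 K (𝟙 _), fun h => ⟨h.comp_eq, fun L _ _ t => ?_⟩⟩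
  exact (Rel.comp_iff t h.comp_eq).mpr h

/-- The sieve of all morphisms along which a section of `π₀(Y/S)` comes from `Y`. -/
lemma exists_sieve_cls {U : Scheme.{u}} (ξ : (piZero f).obj (op U)) :
    ∃ R ∈ Scheme.etaleTopology.{u} U, ∀ ⦃V : Scheme.{u}⦄ (g : V ⟶ U), R g →
      ∃ a : V ⟶ Y, (piZero f).map g.op ξ = cls f a := by
  refine ⟨_, Presheaf.imageSieve_mem Scheme.etaleTopology.{u}
    (toSheafify Scheme.etaleTopology.{u} (componentPresheaf f)) ξ, fun V g ⟨⟨c⟩, hc⟩ => ?_⟩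
  obtain ⟨a, rfl⟩ := Quotient.exists_rep c
  exact ⟨a, hc.symm⟩

lemma exists_eq_cls {K : Type u} [Field K] [IsAlgClosed K]
    (ξ : (piZero f).obj (op (Spec (.of K)))) : ∃ a : Spec (.of K) ⟶ Y, ξ = cls f a := by
  obtain ⟨R, hR, h⟩ := exists_sieve_cls ξ
  obtain ⟨a, ha⟩ := h _ (arrow_of_mem_etaleTopology hR)
  exact ⟨a, by simpa using ha⟩

end Cls

/-! ### Points -/

lemma Points.mk_map {F : PSh.{u}} {K L : Type u} [Field K] [Field L]
    (ξ : F.obj (op (Spec (.of K)))) (i : Spec (.of L) ⟶ Spec (.of K)) :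
    (Quot.mk _ ⟨L, F.map i.op ξ⟩ : Points F) = Quot.mk _ ⟨K, ξ⟩ := by
  refine Quot.sound ⟨L, inferInstance, RingHom.id L, (Spec.preimage i).hom, ?_⟩
  have h : Spec.map (CommRingCat.ofHom (Spec.preimage i).hom) = i := Spec.map_preimage i
  have h' : Spec.map (CommRingCat.ofHom (RingHom.id L)) = 𝟙 _ := Spec.map_id _
  rw [h, h']
  simp

lemma Points.ofScheme_apply {F : PSh.{u}} {U : Scheme.{u}} (ξ : F.obj (op U)) {K : Type u} [Field K]
    (τ : Spec (.of K) ⟶ U) :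
    Points.ofScheme ξ (τ default) = Quot.mk _ ⟨K, F.map τ.op ξ⟩ := by
  obtain ⟨M, _, _, i, j, h⟩ := exists_common_geometricPoint
    (K := U.residueField (τ default)) (U.fromSpecResidueField (τ default)) τ
    (U.fromSpecResidueField_apply _ _)
  have h₁ := Points.mk_map (K := U.residueField (τ default))
    (F.map (U.fromSpecResidueField (τ default)).op ξ) i
  have h₂ := Points.mk_map (F.map τ.op ξ) j
  rw [← Functor.map_comp_apply, ← op_comp] at h₁ h₂
  rw [← h, h₁] at h₂
  exact h₂

/-- The point of `T` underlying a point of the functor of points of `T`. -/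
def Points.toScheme {T : Scheme.{u}} : Points (uliftYoneda.{u + 1}.obj T) → T :=
  Quot.lift (fun p => (show Spec (.of p.K) ⟶ T from p.pt.down) default) <| by
    rintro p q ⟨M, _, i, j, h⟩
    have h' : Spec.map (CommRingCat.ofHom i) ≫ (show Spec (.of p.K) ⟶ T from p.pt.down) =
      Spec.map (CommRingCat.ofHom j) ≫ (show Spec (.of q.K) ⟶ T from q.pt.down) :=
        congrArg ULift.down h
    have := congrArg (fun g : Spec (.of M) ⟶ T => g default) h'
    simp only [Scheme.Hom.comp_apply] at this
    rwa [Subsingleton.elim (Spec.map (CommRingCat.ofHom i) default) default,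
      Subsingleton.elim (Spec.map (CommRingCat.ofHom j) default) default] at this

section Pullback

variable {F G H : PSh.{u}} (φ : F ⟶ H) (g : G ⟶ H) {U : Scheme.{u}}

lemma exists_pullback_section {x : F.obj (op U)} {y : G.obj (op U)}
    (h : φ.app _ x = g.app _ y) : ∃ p : (pullback φ g).obj (op U),
      (pullback.fst φ g).app _ p = x ∧ (pullback.snd φ g).app _ p = y := by
  have := ((IsPullback.of_hasPullback φ g).map ((evaluation _ _).obj (op U)))
  rw [Types.isPullback_iff] at this
  obtain ⟨p, hp⟩ := this.2.2 x y h
  exact ⟨p, hp⟩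

variable {φ g}

lemma pullback_section_ext {p q : (pullback φ g).obj (op U)}
    (h₁ : (pullback.fst φ g).app _ p = (pullback.fst φ g).app _ q)
    (h₂ : (pullback.snd φ g).app _ p = (pullback.snd φ g).app _ q) : p = q := by
  have := ((IsPullback.of_hasPullback φ g).map ((evaluation _ _).obj (op U)))
  rw [Types.isPullback_iff] at this
  exact this.2.1 p q ⟨h₁, h₂⟩

end Pullback

/-! ### Open subsets meeting all components of a fiber -/

/-- `f : X ⟶ S` is universally closed, and `j : Y ⟶ X` identifies `Y` with an open subscheme of `X`
which is smooth over `S`, dense in every fiber, and of constant dimension in every fiber. -/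
structure IsSmoothDense {X Y S : Scheme.{u}} (f : X ⟶ S) (j : Y ⟶ X) : Prop where
  universallyClosed : UniversallyClosed f
  locallyOfFiniteType : LocallyOfFiniteType f
  isOpenImmersion : IsOpenImmersion j
  smooth : Smooth (j ≫ f)
  dense : ∀ s, FiberDense f (Set.range j) s
  dim : ∀ s, ∃ n, ∀ y, f (j y) = s → HasRelDim f n (j y)

lemma IsSmoothDense.of_isPullback {X Y S X' Y' S' : Scheme.{u}} {f : X ⟶ S} {j : Y ⟶ X}
    {f' : X' ⟶ S'} {j' : Y' ⟶ X'} {q : Y' ⟶ Y} {p : X' ⟶ X} {g : S' ⟶ S}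
    (h : IsSmoothDense f j) (hj : IsPullback q j' j p) (hf : IsPullback p f' f g) :
    IsSmoothDense f' j' where
  universallyClosed := MorphismProperty.of_isPullback hf h.universallyClosed
  locallyOfFiniteType := MorphismProperty.of_isPullback hf h.locallyOfFiniteType
  isOpenImmersion := MorphismProperty.of_isPullback hj h.isOpenImmersion
  smooth := MorphismProperty.of_isPullback (hj.paste_vert hf) h.smooth
  dense s := by
    have := (h.dense (g s)).preimage hf
    rwa [← Set.image_univ, ← Scheme.image_preimage_eq_of_isPullback hj, Set.preimage_univ,
      Set.image_univ] at this
  dim s := by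
    obtain ⟨n, hn⟩ := h.dim (g s)
    refine ⟨n, fun y hy => ?_⟩
    have hpy : p (j' y) = j (q y) := by
      rw [← Scheme.Hom.comp_apply, ← Scheme.Hom.comp_apply, hj.w]
    refine HasRelDim.of_isPullback hf ?_
    rw [hpy]
    refine hn _ ?_
    rw [← hpy, ← Scheme.Hom.comp_apply, hf.w, Scheme.Hom.comp_apply, hy]

/-- `V` meets every component of the geometric fibers over `s`. -/
def MeetsComponents {Y S : Scheme.{u}} (f : Y ⟶ S) (V : Set Y) (s : S) : Prop :=
  ∀ (K : Type u) [Field K] [IsAlgClosed K] (y : Spec (.of K) ⟶ Y), f (y default) = s →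
    ∃ y' : Spec (.of K) ⟶ Y, Rel f y y' ∧ y' default ∈ V

/-- Density is stable under extension of the base field, and components of the geometric fiber are
open, so each contains a rational point of V. -/
lemma FiberDense.meetsComponents {Y S : Scheme.{u}} {f : Y ⟶ S} [Smooth f] {V : Set Y} {s : S}
    (hVo : IsOpen V) (hV : FiberDense f V s) : MeetsComponents f V s := by
  rintro K _ _ y rfl
  let g := pullback.snd f (y ≫ f)
  let p := pullback.fst f (y ≫ f)
  have hpb : IsPullback p g f (y ≫ f) := .of_hasPullback _ _
  have hV' : FiberDense g (p ⁻¹' V) default := hV.preimage hpb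
  let σ : Spec (.of K) ⟶ pullback f (y ≫ f) := pullback.lift y (𝟙 _) (by simp)
  obtain ⟨z, hzc, hzV, -⟩ := mem_closure_iff.mp (hV' (a := σ default) (Subsingleton.elim _ _)) _
    (isOpen_connectedComponent_of_smooth g (σ default)) mem_connectedComponent
  obtain ⟨τ, hτ, hτm⟩ := exists_point_mem_of_isOpen g
    ((isOpen_connectedComponent_of_smooth g (σ default)).inter
      (hVo.preimage p.continuous)) ⟨z, hzc, hzV⟩
  refine ⟨τ ≫ p, ?_, ?_⟩
  · have := (rel_iff_of_isPullback hpb (x := σ) (y := τ) (by simp [σ, g]) hτ).mpr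
      (connectedComponent_eq (hτm default).1)
    rwa [show σ ≫ p = y by simp [σ, p]] at this
  · rw [Scheme.Hom.comp_apply]
    exact (hτm default).2

lemma Rel.exists_mem_preimage {Y S : Scheme.{u}} {f : Y ⟶ S} [Smooth f] {K : Type u} [Field K]
    [IsAlgClosed K] {x y : Spec (.of K) ⟶ Y} (h : Rel f x y) {U V : Set Y} (hU : IsOpen U)
    (hV : IsOpen V) (hx : x default ∈ U) (hy : y default ∈ V) :
    ∃ z : Spec (.of K) ⟶ Y, z default ∈ U ∩ V ∧ z ≫ f = x ≫ f := by
  obtain ⟨z, hz, hxz, -⟩ := h.exists_mem ⟨U, hU⟩ ⟨V, hV⟩ hx hy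
  exact ⟨z, hz, hxz.comp_eq.symm⟩

/-- An open set meeting the fiber meets its smooth part. The component found there also meets V and
is irreducible, so the two open sets intersect on it. -/
lemma IsSmoothDense.fiberDense {X Y S : Scheme.{u}} {f : X ⟶ S} {j : Y ⟶ X}
    (h : IsSmoothDense f j) {V : Set Y} (hVo : IsOpen V) {s : S}
    (hV : MeetsComponents (j ≫ f) V s) : FiberDense f (j '' V) s := by
  have := h.smooth
  have := h.isOpenImmersion
  intro x hx
  rw [mem_closure_iff]
  intro O hO hxO
  obtain ⟨_, hyO, ⟨y, rfl⟩, hys⟩ := mem_closure_iff.mp (h.dense s hx) O hO hxO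
  obtain ⟨K, _, _, τ, hτ⟩ := exists_geometricPoint y
  obtain ⟨τ', hττ', hτ'⟩ := hV K τ (by rw [hτ, Scheme.Hom.comp_apply]; exact hys)
  obtain ⟨z, hz, hzf⟩ := hττ'.exists_mem_preimage (hO.preimage j.continuous) hVo
    (by rw [hτ]; exact hyO) hτ'
  refine ⟨j (z default), hz.1, ⟨_, hz.2, rfl⟩, ?_⟩
  have := congrArg (fun g : Spec (.of K) ⟶ S => g default) hzf
  simp only [Scheme.Hom.comp_apply, hτ] at this
  exact this.trans hys

/-- If an open subset meets all components of the fiber over `s₀` then also all components of the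
nearby fibers. -/
theorem IsSmoothDense.exists_nhds {X Y S : Scheme.{u}} {f : X ⟶ S} {j : Y ⟶ X}
    (h : IsSmoothDense f j) {V : Set Y} (hVo : IsOpen V) {s₀ : S}
    (hV : MeetsComponents (j ≫ f) V s₀) :
    ∃ M : Set S, IsOpen M ∧ s₀ ∈ M ∧ ∀ s ∈ M, MeetsComponents (j ≫ f) V s := by
  have := h.smooth
  have := h.isOpenImmersion
  have := h.universallyClosed
  have := h.locallyOfFiniteType
  obtain ⟨M, hM, hs₀, hM'⟩ := exists_nhds_fiberDense f f.isClosedMap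
    j.isOpenEmbedding.isOpen_range (j.isOpenEmbedding.isOpenMap _ hVo) (Set.image_subset_range _ _)
    h.dense (fun s => by
      obtain ⟨n, hn⟩ := h.dim s
      refine ⟨n, ?_⟩
      rintro _ ⟨y, rfl⟩ hy
      exact hn y hy) (h.fiberDense hVo hV)
  refine ⟨M, hM, hs₀, fun s hs => FiberDense.meetsComponents hVo ?_⟩
  intro y hy
  rw [mem_closure_iff]
  intro O hO hyO
  obtain ⟨_, ⟨w, hwO, rfl⟩, ⟨w', hw', hww'⟩, hwf⟩ := mem_closure_iff.mp
    (hM' s hs (a := j y) (by rw [← hy, Scheme.Hom.comp_apply]; rfl)) (j '' O)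
    (j.isOpenEmbedding.isOpenMap _ hO) ⟨y, hyO, rfl⟩
  obtain rfl := j.injective hww'
  exact ⟨w', hwO, hw', by rw [Set.mem_preimage, Scheme.Hom.comp_apply]; exact hwf⟩

/-- The image of a closed subset of `Y` which is a union of components of geometric fibers is
closed. -/
theorem IsSmoothDense.isClosed_image {X Y S : Scheme.{u}} {f : X ⟶ S} {j : Y ⟶ X}
    (h : IsSmoothDense f j) {W : Set Y} (hW : IsClosed W)
    (hsat : ∀ (K : Type u) [Field K] [IsAlgClosed K] (x y : Spec (.of K) ⟶ Y),
      Rel (j ≫ f) x y → x default ∈ W → y default ∈ W) :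
    IsClosed ((j ≫ f) '' W) := by
  rw [← isOpen_compl_iff, isOpen_iff_forall_mem_open]
  intro s hs
  -- As s is not in the image, the complement of W contains the whole fiber over s and so trivially
  -- meets all its components.
  obtain ⟨M, hM, hsM, hM'⟩ := h.exists_nhds (s₀ := s) hW.isOpen_compl fun K _ _ y hy =>
    ⟨y, .refl _ _, fun hyW => hs ⟨_, hyW, hy⟩⟩
  refine ⟨M, ?_, hM, hsM⟩
  rintro _ hw ⟨w, hwW, rfl⟩
  obtain ⟨K, _, _, τ, hτ⟩ := exists_geometricPoint w
  -- A point of W over M would share its component with a point outside W, contradicting saturation.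
  obtain ⟨τ', hττ', hτ'⟩ := hM' _ hw K τ (by rw [hτ])
  exact hτ' (hsat K _ _ hττ' (by rwa [hτ]))

/-! ### Universal closedness -/

lemma Points.map_ofScheme {F G : PSh.{u}} (φ : F ⟶ G) {U : Scheme.{u}} (ξ : F.obj (op U)) (x : U) :
    Points.map φ (Points.ofScheme ξ x) = Points.ofScheme (φ.app _ ξ) x := by
  have := NatTrans.naturality_apply φ (U.fromSpecResidueField x).op ξ
  exact congrArg (fun ζ => (Quot.mk _ { K := U.residueField x, pt := ζ } : Points G)) this

lemma Points.ofScheme_map {F : PSh.{u}} {U V : Scheme.{u}} (h : V ⟶ U) (ξ : F.obj (op U)) (x : V) :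
    Points.ofScheme (F.map h.op ξ) x = Points.ofScheme ξ (h x) := by
  obtain ⟨K, _, _, τ, hτ⟩ := exists_geometricPoint x
  rw [← hτ default, Points.ofScheme_apply, ← Functor.map_comp_apply, ← op_comp,
    ← Points.ofScheme_apply, Scheme.Hom.comp_apply]

/-- Closedness is tested on schemes T over S'. The base change of Y to T maps to the base change of
π₀, and the preimage of Z under this map is closed and a union of components. Its image in T is the
preimage of the image of Z, so `IsSmoothDense.isClosed_image` applies. -/
theorem IsSmoothDense.isUniversallyClosed {X Y S : Scheme.{u}} {f : X ⟶ S} {j : Y ⟶ X}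
    (h : IsSmoothDense f j) : IsUniversallyClosed (piZeroToBase (j ≫ f)) := by
  intro S' g Z hZ
  have := h.smooth
  let φ := piZeroToBase (j ≫ f)
  have hcl {F : PSh.{u}} (Z : Set (Points F)) : IsClosed Z ↔ ∀ (U : Scheme.{u})
      (ξ : F.obj (op U)), IsClosed (Points.ofScheme ξ ⁻¹' Z) := by
    simp only [← isOpen_compl_iff, ← Set.preimage_compl]
    rw [isOpen_iSup_iff]
    refine forall_congr' fun U => ?_
    rw [isOpen_iSup_iff]
    rfl
  rw [hcl] at hZ ⊢
  rintro T ξ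
  let t : T ⟶ S := (g.app (op T) ξ).down
  have ht {U : Scheme.{u}} (a : U ⟶ T) :
      g.app (op U) ((uliftYoneda.{u + 1}.obj S').map a.op ξ) = ULift.up (a ≫ t) := by
    rw [NatTrans.naturality_apply]
    rfl
  let p := pullback.fst f t
  let f' := pullback.snd f t
  let q := pullback.fst j p
  let j' := pullback.snd j p
  have hpb : IsPullback q (j' ≫ f') (j ≫ f) t :=
    (IsPullback.of_hasPullback j p).paste_vert (IsPullback.of_hasPullback f t)
  have h' : IsSmoothDense f' j' :=
    h.of_isPullback (IsPullback.of_hasPullback j p) (IsPullback.of_hasPullback f t)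
  obtain ⟨θ, hθ₁, hθ₂⟩ := exists_pullback_section φ g (x := cls (j ≫ f) q)
    (y := (uliftYoneda.{u + 1}.obj S').map (j' ≫ f').op ξ) (by
      rw [ht, ← hpb.w]; exact piZeroToBase_cls _ _)
  have key : Points.ofScheme ξ ⁻¹' (Points.map (pullback.snd φ g) '' Z) =
      (j' ≫ f') '' (Points.ofScheme θ ⁻¹' Z) := by
    ext x
    constructor
    · rintro ⟨⟨z⟩, hz, hzx⟩
      have hzx' := congrArg Points.toScheme hzx
      -- A point of π₀ becomes the class of a point of Y over a large enough algebraically closed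
      -- field, and this point lifts to the base change of Y to T.
      obtain ⟨M, _, _, i, l, hil⟩ := exists_common_geometricPoint
        (L := T.residueField x) (show Spec (.of z.K) ⟶ S' from ((pullback.snd φ g).app _ z.pt).down)
        (T.fromSpecResidueField x ≫ ξ.down) hzx'
      obtain ⟨a, ha⟩ := exists_eq_cls ((pullback.fst φ g).app _ ((pullback φ g).map i.op z.pt))
      have hsnd : (pullback.snd φ g).app _ ((pullback φ g).map i.op z.pt) =
          (uliftYoneda.{u + 1}.obj S').map (l ≫ T.fromSpecResidueField x).op ξ := by
        rw [NatTrans.naturality_apply]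
        exact congrArg ULift.up (hil.trans (Category.assoc _ _ _).symm)
      have hax : a ≫ j ≫ f = (l ≫ T.fromSpecResidueField x) ≫ t := by
        have := ConcreteCategory.congr_hom (NatTrans.congr_app (pullback.condition (f := φ) (g := g))
          (op (Spec (.of M)))) ((pullback φ g).map i.op z.pt)
        rw [NatTrans.comp_app_apply, NatTrans.comp_app_apply, ha, hsnd, ht] at this
        exact congrArg ULift.down ((piZeroToBase_cls _ _).symm.trans this)
      let σ := hpb.lift a _ hax
      refine ⟨σ default, ?_, ?_⟩
      · have : (pullback φ g).map σ.op θ = (pullback φ g).map i.op z.pt := by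
          refine pullback_section_ext ?_ ?_
          · rw [ha, NatTrans.naturality_apply, hθ₁, map_cls, hpb.lift_fst]
          · rw [hsnd, NatTrans.naturality_apply, hθ₂, ← Functor.map_comp_apply, ← op_comp,
              hpb.lift_snd]
        rw [Set.mem_preimage, Points.ofScheme_apply, this, Points.mk_map]
        exact hz
      · rw [← Scheme.Hom.comp_apply, hpb.lift_snd, Scheme.Hom.comp_apply]
        exact T.fromSpecResidueField_apply _ _
    · rintro ⟨w, hw, rfl⟩
      refine ⟨_, hw, ?_⟩
      rw [Points.map_ofScheme, hθ₂, Points.ofScheme_map]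
  rw [key]
  refine h'.isClosed_image (hZ _ _) fun K _ _ x y hxy hx => ?_
  rw [Set.mem_preimage, Points.ofScheme_apply] at hx ⊢
  -- Saturation: points of the same component define the same section of π₀.
  suffices heq : (pullback φ g).map x.op θ = (pullback φ g).map y.op θ by rwa [← heq]
  refine pullback_section_ext ?_ ?_
  · rw [NatTrans.naturality_apply, NatTrans.naturality_apply, hθ₁, map_cls, map_cls,
      cls_eq_iff_rel]
    exact (Rel.iff_of_isPullback hpb hxy.comp_eq).mp hxy
  · rw [NatTrans.naturality_apply, NatTrans.naturality_apply, hθ₂, ← Functor.map_comp_apply,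
      ← Functor.map_comp_apply, ← op_comp, ← op_comp, hxy.comp_eq]

/-! ### Sections of smooth morphisms -/

/-- The roots of unity of order prime to the characteristic. -/
def tameRootsOfUnity (K : Type*) [Field K] : Set K :=
  {z | ∃ N : ℕ, (N : K) ≠ 0 ∧ z ^ N = 1}

lemma infinite_tameRootsOfUnity (K : Type*) [Field K] [IsAlgClosed K] :
    (tameRootsOfUnity K).Infinite := by
  intro hfin
  -- Of two consecutive integers at most one vanishes in K, so one of them is an order N prime to
  -- the characteristic and larger than the supposed cardinality.
  obtain ⟨N, hN, hN0⟩ : ∃ N : ℕ, hfin.toFinset.card < N ∧ (N : K) ≠ 0 := by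
    by_cases h : ((hfin.toFinset.card + 1 : ℕ) : K) = 0
    · refine ⟨hfin.toFinset.card + 1 + 1, by omega, ?_⟩
      rw [Nat.cast_add, h]
      simp
    · exact ⟨_, Nat.lt_succ_self _, h⟩
  have : NeZero (N : K) := ⟨hN0⟩
  have hN' : 0 < N := by omega
  obtain ⟨ζ, hζ⟩ := HasEnoughRootsOfUnity.exists_primitiveRoot K N
  have hle : Polynomial.nthRootsFinset N (1 : K) ⊆ hfin.toFinset := by
    intro z hz
    rw [Polynomial.mem_nthRootsFinset hN'] at hz
    rw [Set.Finite.mem_toFinset]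
    exact ⟨N, hN0, hz⟩
  have := Finset.card_le_card hle
  rw [hζ.card_nthRootsFinset] at this
  omega

lemma exists_eval_ne_zero {K : Type*} [Field K] [IsAlgClosed K] {n : ℕ}
    {h : MvPolynomial (Fin n) K} (h0 : h ≠ 0) :
    ∃ z : Fin n → K, (∀ i, z i ∈ tameRootsOfUnity K) ∧ MvPolynomial.eval z h ≠ 0 := by
  by_contra! hz
  refine h0 (MvPolynomial.funext_set (fun _ => tameRootsOfUnity K)
    (fun _ => infinite_tameRootsOfUnity K) fun x hx => ?_)
  rw [hz x fun i => hx i (Set.mem_univ i), map_zero]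

/-- The coordinates are lifted one at a time by adjoining a root of Xᴺ - 1. The derivative is
inverted as well, which makes the extension étale without N being invertible in A; the point z
survives since N ≠ 0 in K. -/
lemma exists_etale_lift {A K : Type u} [CommRing A] [Field K] [Algebra A K] (n : ℕ) (z : Fin n → K)
    (hz : ∀ i, z i ∈ tameRootsOfUnity K) :
    ∃ (A' : Type u) (_ : CommRing A') (_ : Algebra A A') (ε : A' →ₐ[A] K) (t : Fin n → A'),
      Algebra.Etale A A' ∧ ∀ i, ε (t i) = z i := by
  induction n with
  | zero => exact ⟨A, inferInstance, inferInstance, Algebra.ofId A K, Fin.elim0, inferInstance,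
      fun i => i.elim0⟩
  | succ n ih =>
    obtain ⟨A', _, _, ε, t, _, ht⟩ := ih (fun i => z i.succ) (fun i => hz _)
    obtain ⟨N, hN, hzN⟩ := hz 0
    have hN0 : N ≠ 0 := by rintro rfl; simp at hN
    let := ε.toRingHom.toAlgebra
    have : IsScalarTower A A' K := .of_algebraMap_eq fun a => (ε.commutes a).symm
    let P : StandardEtalePair A' :=
      { f := Polynomial.X ^ N - 1
        monic_f := Polynomial.monic_X_pow_sub_C 1 hN0
        g := Polynomial.derivative (Polynomial.X ^ N - 1)
        cond := ⟨1, 0, 1, by simp⟩ }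
    have hP : P.HasMap (z 0) := by
      refine ⟨by simp [P, hzN], ?_⟩
      have hz0 : z 0 ≠ 0 := by
        intro h0
        rw [h0, zero_pow hN0] at hzN
        exact zero_ne_one hzN
      simp [P, Polynomial.derivative_X_pow, hN, hz0]
    let : Algebra A P.Ring := ((algebraMap A' P.Ring).comp (algebraMap A A')).toAlgebra
    have : IsScalarTower A A' P.Ring := .of_algebraMap_eq fun a => rfl
    refine ⟨P.Ring, inferInstance, inferInstance, (P.lift (z 0) hP).restrictScalars A,
      Fin.cons P.X fun i => algebraMap A' P.Ring (t i), Algebra.Etale.comp A A' P.Ring,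
      fun i => ?_⟩
    refine Fin.cases ?_ (fun i => ?_) i
    · simp
    · simp only [Fin.cons_succ, AlgHom.coe_restrictScalars', AlgHom.commutes]
      exact ht i

lemma ringHom_comp_specMap_eq {R R' R'' : Type u} [CommRing R] [CommRing R'] [CommRing R'']
    {φ : R →+* R'} {ψ : R' →+* R''} :
    Spec.map (CommRingCat.ofHom ψ) ≫ Spec.map (CommRingCat.ofHom φ) =
      Spec.map (CommRingCat.ofHom (ψ.comp φ)) := by
  rw [← Spec.map_comp, ← CommRingCat.ofHom_comp]

/-- A smooth morphism has sections over étale neighborhoods of every geometric point, and these can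
be chosen to pass through a given nonempty open subset of the geometric fiber. -/
theorem exists_etale_section {Y S : Scheme.{u}} (g : Y ⟶ S) [Smooth g] {K : Type u} [Field K]
    [IsAlgClosed K] (τ : Spec (.of K) ⟶ S) {U : Set ↥(pullback g τ)} (hU : IsOpen U)
    (hne : U.Nonempty) :
    ∃ (E : Scheme.{u}) (q : E ⟶ S) (ε : Spec (.of K) ⟶ E) (a : E ⟶ Y) (_ : Etale q)
      (hε : (ε ≫ a) ≫ g = τ), ε ≫ q = τ ∧ a ≫ g = q ∧ fiberPoint g (ε ≫ a) τ hε ∈ U := by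
  obtain ⟨σ, hσ, hσU⟩ := exists_point_mem_of_isOpen (pullback.snd g τ) hU hne
  let y := σ ≫ pullback.fst g τ
  have hyτ : y ≫ g = τ := by simp [y, pullback.condition, reassoc_of% hσ]
  obtain ⟨_, ⟨V, hV, rfl⟩, hyV, -⟩ := S.isBasis_affineOpens.exists_subset_of_mem_open
    (Set.mem_univ (τ default)) isOpen_univ
  replace hV : IsAffineOpen V := hV
  obtain ⟨A, _, j, _, hj⟩ : ∃ (A : Type u) (_ : CommRing A) (j : Spec (.of A) ⟶ S)
      (_ : IsOpenImmersion j), τ default ∈ Set.range j :=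
    ⟨Γ(S, V), inferInstance, hV.fromSpec, inferInstance, by
      rw [hV.range_fromSpec]; exact hyV⟩
  obtain ⟨B, _, _, i, _, hi, hig, -, n, _, _, _⟩ := exists_chart g j (y default) (by
    rwa [← Scheme.Hom.comp_apply, hyτ])
  have hrange {T : Scheme.{u}} (l : Spec (.of K) ⟶ T) {t : T} (h : l default = t) :
      Set.range l ⊆ {t} := by
    rintro _ ⟨p, rfl⟩
    rw [Subsingleton.elim p default, h]; rfl
  let τ' := IsOpenImmersion.lift j τ ((hrange τ rfl).trans (Set.singleton_subset_iff.mpr hj))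
  have hτ' : τ' ≫ j = τ := IsOpenImmersion.lift_fac _ _ _
  let y' := IsOpenImmersion.lift i y ((hrange y rfl).trans (Set.singleton_subset_iff.mpr hi))
  have hy' : y' ≫ i = y := IsOpenImmersion.lift_fac _ _ _
  let := (Spec.preimage τ').hom.toAlgebra
  have hτA : Spec.map (CommRingCat.ofHom (algebraMap A K)) = τ' := Spec.map_preimage τ'
  let π := Spec.map (CommRingCat.ofHom (algebraMap (MvPolynomial (Fin n) A) B))
  have hπ : Etale π := by
    rw [HasRingHomProperty.Spec_iff (P := @Etale)]
    exact RingHom.etale_algebraMap.mpr inferInstance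
  let γ := Spec.map (CommRingCat.ofHom (MvPolynomial.C (R := A) (σ := Fin n)))
  have hπγ : π ≫ γ = Spec.map (CommRingCat.ofHom (algebraMap A B)) := by
    rw [IsScalarTower.algebraMap_eq A (MvPolynomial (Fin n) A) B]
    exact ringHom_comp_specMap_eq
  let κ := Spec.map (CommRingCat.ofHom (MvPolynomial.map (σ := Fin n) (algebraMap A K)))
  let γK := Spec.map (CommRingCat.ofHom (MvPolynomial.C (R := K) (σ := Fin n)))
  have hκγ : κ ≫ γ = γK ≫ τ' := by
    rw [← hτA]
    refine ringHom_comp_specMap_eq.trans (Eq.trans ?_ ringHom_comp_specMap_eq.symm)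
    congr 2
    ext a
    simp
  -- The source is the geometric fiber of the chart, étale over affine n-space over K by its second
  -- projection.
  let m : pullback π κ ⟶ pullback g τ := pullback.lift (pullback.fst π κ ≫ i)
    (pullback.snd π κ ≫ γK) (by
      rw [Category.assoc, hig, ← hπγ, Category.assoc, pullback.condition_assoc, reassoc_of% hκγ,
        hτ', Category.assoc])
  let pt (z : Fin n → K) : Spec (.of K) ⟶ Spec (.of (MvPolynomial (Fin n) K)) :=
    Spec.map (CommRingCat.ofHom (MvPolynomial.eval z))
  have hpt (z : Fin n → K) : pt z ≫ γK = 𝟙 _ := by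
    refine ringHom_comp_specMap_eq.trans ?_
    rw [← Spec.map_id]
    congr 1
    ext a
    simp
  have hnonempty : (m ⁻¹' U).Nonempty := by
    let β := (Spec.preimage y').hom
    have hβ : Spec.map (CommRingCat.ofHom β) = y' := Spec.map_preimage y'
    let z : Fin n → K := fun l => β (algebraMap (MvPolynomial (Fin n) A) B (.X l))
    have hβA : β.comp (algebraMap A B) = algebraMap A K := by
      have : y' ≫ π ≫ γ = τ' := by
        rw [← cancel_mono j, hτ', hπγ, Category.assoc, ← hig, reassoc_of% hy', hyτ]
      rw [hπγ, ← hβ, ← hτA, ringHom_comp_specMap_eq] at this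
      exact congrArg CommRingCat.Hom.hom (Spec.map_injective this)
    have hyz : y' ≫ π = pt z ≫ κ := by
      rw [← hβ]
      refine ringHom_comp_specMap_eq.trans (Eq.trans ?_ ringHom_comp_specMap_eq.symm)
      congr 2
      refine MvPolynomial.ringHom_ext (fun a => ?_) fun l => ?_
      · have := RingHom.congr_fun hβA a
        rw [RingHom.comp_apply, IsScalarTower.algebraMap_apply A (MvPolynomial (Fin n) A) B] at this
        simpa using this
      · simp [z]
    refine ⟨pullback.lift y' (pt z) hyz default, ?_⟩
    have : pullback.lift y' (pt z) hyz ≫ m = σ := by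
      refine pullback.hom_ext ?_ ?_
      · simp [m, hy', y]
      · simp [m, hpt, hσ]
    rw [Set.mem_preimage, ← Scheme.Hom.comp_apply, this]
    exact hσU _
  obtain ⟨u₀, hu₀⟩ := hnonempty
  -- The image of U in affine space is open, so it contains the nonvanishing locus of some
  -- polynomial h ≠ 0. A point of that locus whose coordinates are tame roots of unity extends to an
  -- étale A-algebra.
  have hopen : IsOpen (pullback.snd π κ '' (m ⁻¹' U)) :=
    (pullback.snd π κ).isOpenMap _ (hU.preimage m.continuous)
  obtain ⟨_, ⟨_, ⟨h, rfl⟩, rfl⟩, hmem, hsub⟩ :=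
    PrimeSpectrum.isBasis_basic_opens.exists_subset_of_mem_open
      (Set.mem_image_of_mem (pullback.snd π κ) hu₀) hopen
  have h0 : h ≠ 0 := by
    rintro rfl
    exact hmem (Ideal.zero_mem _)
  obtain ⟨z, hz, hzh⟩ := exists_eval_ne_zero h0
  obtain ⟨u, huU, hu⟩ : pt z default ∈ pullback.snd π κ '' (m ⁻¹' U) := hsub fun hmem => by
    have hmem' : MvPolynomial.eval z h ∈ (default : Spec (.of K)).asIdeal := hmem
    have hbot : (default : Spec (.of K)).asIdeal = ⊥ :=
      Ideal.eq_bot_of_prime (h := PrimeSpectrum.isPrime _) _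
    exact hzh (hbot.le hmem')
  obtain ⟨u', hu', -⟩ := Scheme.Pullback.exists_preimage_pullback (f := pullback.snd π κ)
    (g := pt z) u default hu
  -- K is algebraically closed, so the étale fiber over z has a rational point in U.
  obtain ⟨ω, hω, hωU⟩ := exists_point_mem_of_isOpen (pullback.snd (pullback.snd π κ) (pt z))
    (hU.preimage (pullback.fst (pullback.snd π κ) (pt z) ≫ m).continuous) ⟨u', by
      rw [Set.mem_preimage, Scheme.Hom.comp_apply, hu']; exact huU⟩
  let w := ω ≫ pullback.fst (pullback.snd π κ) (pt z)
  have hw : w ≫ pullback.snd π κ = pt z := by simp [w, pullback.condition, reassoc_of% hω]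
  obtain ⟨A', _, _, ε', t, _, ht⟩ := exists_etale_lift (A := A) n z hz
  let ρ := Spec.map (CommRingCat.ofHom
    (MvPolynomial.aeval t : MvPolynomial (Fin n) A →ₐ[A] A').toRingHom)
  let ε₀ := Spec.map (CommRingCat.ofHom ε'.toRingHom)
  have hw' : (w ≫ pullback.fst π κ) ≫ π = ε₀ ≫ ρ := by
    rw [Category.assoc, pullback.condition, reassoc_of% hw]
    refine ringHom_comp_specMap_eq.trans (Eq.trans ?_ ringHom_comp_specMap_eq.symm)
    congr 2
    refine MvPolynomial.ringHom_ext (fun a => ?_) fun l => ?_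
    · simp
    · simp [ht]
  let ε := pullback.lift (w ≫ pullback.fst π κ) ε₀ hw'
  have hA' : ρ ≫ γ = Spec.map (CommRingCat.ofHom (algebraMap A A')) := by
    refine ringHom_comp_specMap_eq.trans ?_
    congr 2
    ext a
    simp
  have hε₀ : ε₀ ≫ Spec.map (CommRingCat.ofHom (algebraMap A A')) = τ' := by
    rw [← hτA]
    refine ringHom_comp_specMap_eq.trans ?_
    congr 2
    ext a
    simp
  have hA'e : Etale (Spec.map (CommRingCat.ofHom (algebraMap A A'))) := by
    rw [HasRingHomProperty.Spec_iff (P := @Etale)]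
    exact RingHom.etale_algebraMap.mpr inferInstance
  have ha : (pullback.fst π ρ ≫ i) ≫ g =
      pullback.snd π ρ ≫ Spec.map (CommRingCat.ofHom (algebraMap A A')) ≫ j := by
    rw [← hA', Category.assoc, hig, ← hπγ, Category.assoc, pullback.condition_assoc,
      Category.assoc]
  have hq : ε ≫ pullback.snd π ρ ≫ Spec.map (CommRingCat.ofHom (algebraMap A A')) ≫ j = τ := by
    simp [ε, reassoc_of% hε₀, hτ']
  -- The neighborhood is the pullback of the étale chart along the lifted point of affine space. Its
  -- projection to the chart is the required section.
  refine ⟨pullback π ρ, _, ε, pullback.fst π ρ ≫ i, inferInstance, ?_, hq, ha, ?_⟩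
  · rw [Category.assoc, ha, hq]
  · rw [fiberPoint]
    have hfac : pullback.lift (ε ≫ pullback.fst π ρ ≫ i) (𝟙 _) (by
        rw [Category.assoc, ha, hq]; simp) = w ≫ m := by
      refine pullback.hom_ext ?_ ?_
      · simp [ε, m]
      · simp [m, reassoc_of% hw, hpt]
    rw [hfac]
    have := hωU default
    rwa [Set.mem_preimage, ← Scheme.Hom.comp_apply, ← Category.assoc] at this

/-! ### The number of components of a geometric fiber -/

section Topology

variable {X D : Type*} [TopologicalSpace X] [TopologicalSpace D] {j : D → X}

/-- The image is open and irreducible. Any irreducible set containing it has it as a dense subset,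
so its closure is maximal. -/
lemma closure_image_connectedComponent_mem (hj : Topology.IsOpenEmbedding j) {z : D}
    (ho : IsOpen (connectedComponent z)) (hz : IsPreirreducible (connectedComponent z)) :
    closure (j '' connectedComponent z) ∈ irreducibleComponents X := by
  have hne : (j '' connectedComponent z).Nonempty := ⟨_, _, mem_connectedComponent, rfl⟩
  have hirr : IsPreirreducible (j '' connectedComponent z) :=
    hz.image j hj.continuous.continuousOn
  refine ⟨⟨hne.closure, hirr.closure⟩, fun Z hZ hle => ?_⟩
  obtain ⟨x, hx⟩ := hne
  refine (subset_closure_inter_of_isPreirreducible_of_isOpen hZ.2 (hj.isOpenMap _ ho)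
    ⟨x, hle (subset_closure hx), hx⟩).trans (closure_mono Set.inter_subset_right)

lemma connectedComponent_eq_of_closure_image_eq (hj : Topology.IsOpenEmbedding j) {z z' : D}
    (ho : IsOpen (connectedComponent z))
    (h : closure (j '' connectedComponent z) = closure (j '' connectedComponent z')) :
    connectedComponent z = connectedComponent z' := by
  have hz : j z ∈ closure (j '' connectedComponent z') :=
    h.le (subset_closure ⟨z, mem_connectedComponent, rfl⟩)
  obtain ⟨_, ⟨w, hw, rfl⟩, ⟨w', hw', hww'⟩⟩ := mem_closure_iff.mp hz _ (hj.isOpenMap _ ho)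
    ⟨z, mem_connectedComponent, rfl⟩
  obtain rfl := hj.injective hww'
  rw [connectedComponent_eq hw, connectedComponent_eq hw']

/-- The closures of the components of D are finitely many irreducible components of X, and their
union is closed and dense. An irreducible component is thus contained in one of them, hence equal to
it. -/
lemma exists_eq_closure_image_connectedComponent (hj : Topology.IsOpenEmbedding j)
    (hd : DenseRange j) (ho : ∀ z : D, IsOpen (connectedComponent z))
    (hi : ∀ z : D, IsPreirreducible (connectedComponent z)) (hfin : (irreducibleComponents X).Finite)
    {Z : Set X} (hZ : Z ∈ irreducibleComponents X) :
    ∃ z, Z = closure (j '' connectedComponent z) := by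
  let I : Set (Set X) := Set.range fun z => closure (j '' connectedComponent z)
  have hI : I.Finite := hfin.subset (by
    rintro _ ⟨z, rfl⟩
    exact closure_image_connectedComponent_mem hj (ho z) (hi z))
  have hU : ⋃₀ I = Set.univ := by
    have hcl : IsClosed (⋃₀ I) := by
      rw [Set.sUnion_eq_biUnion]
      exact Set.Finite.isClosed_biUnion hI (by rintro _ ⟨z, rfl⟩; exact isClosed_closure)
    refine Set.univ_subset_iff.mp (hd.closure_range.ge.trans (closure_minimal ?_ hcl))
    rintro _ ⟨z, rfl⟩
    exact ⟨_, ⟨z, rfl⟩, subset_closure ⟨z, mem_connectedComponent, rfl⟩⟩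
  obtain ⟨_, hC, hZC⟩ := isIrreducible_iff_sUnion_isClosed.mp hZ.1 hI.toFinset
    (fun C hC => by
      obtain ⟨z, rfl⟩ := hI.mem_toFinset.mp hC
      exact isClosed_closure) (by rw [hI.coe_toFinset, hU]; exact Set.subset_univ _)
  obtain ⟨z, rfl⟩ := hI.mem_toFinset.mp hC
  exact ⟨z, hZC.antisymm (hZ.2 (closure_image_connectedComponent_mem hj (ho z) (hi z)).1 hZC)⟩

end Topology

/-- The sections `c i` of `g` over a geometric point `τ` meet every component of the geometric fiber
exactly once. -/
structure IsFrame {Y S : Scheme.{u}} (g : Y ⟶ S) {ι : Type*} {K : Type u} [Field K]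
    (τ : Spec (.of K) ⟶ S) (c : ι → (Spec (.of K) ⟶ Y)) : Prop where
  comp_eq : ∀ i, c i ≫ g = τ
  inj : ∀ i i', Rel g (c i) (c i') → i = i'
  surj : ∀ y, y ≫ g = τ → ∃ i, Rel g y (c i)

lemma IsSmoothDense.exists_isFrame {X Y S : Scheme.{u}} {f : X ⟶ S} {j : Y ⟶ X}
    (h : IsSmoothDense f j) {K : Type u} [Field K] [IsAlgClosed K] (τ : Spec (.of K) ⟶ S) {d : ℕ}
    (hd : (irreducibleComponents ↥(pullback f τ)).encard = d) :
    ∃ c : Fin d → (Spec (.of K) ⟶ Y), IsFrame (j ≫ f) τ c := by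
  let p := pullback.fst f τ
  let f' := pullback.snd f τ
  let q := pullback.fst j p
  let j' := pullback.snd j p
  have hpb : IsPullback q (j' ≫ f') (j ≫ f) τ :=
    (IsPullback.of_hasPullback j p).paste_vert (IsPullback.of_hasPullback f τ)
  have h' : IsSmoothDense f' j' :=
    h.of_isPullback (IsPullback.of_hasPullback j p) (IsPullback.of_hasPullback f τ)
  have := h'.smooth
  have := h'.isOpenImmersion
  have hj' := j'.isOpenEmbedding
  have hdense : DenseRange j' := fun x =>
    closure_mono Set.inter_subset_left (h'.dense default (a := x) (Subsingleton.elim _ _))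
  have ho := isOpen_connectedComponent_of_smooth (j' ≫ f')
  have hi := isPreirreducible_connectedComponent_of_smooth (j' ≫ f')
  have hfin := Set.finite_of_encard_eq_coe hd
  have hcard : hfin.toFinset.card = d := by
    rw [hfin.encard_eq_coe_toFinset_card] at hd
    exact_mod_cast hd
  let e := (hfin.toFinset.equivFinOfCardEq hcard).symm
  have hex (i : Fin d) : ∃ σ : Spec (.of K) ⟶ pullback j p, σ ≫ j' ≫ f' = 𝟙 _ ∧
      (e i : Set _) = closure (Set.image j' (connectedComponent (σ default))) := by
    obtain ⟨z, hz⟩ := exists_eq_closure_image_connectedComponent hj' hdense ho hi hfin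
      (hfin.mem_toFinset.mp (e i).2)
    obtain ⟨σ, hσ, hσz⟩ := exists_point_mem_of_isOpen (j' ≫ f') (ho z) ⟨z, mem_connectedComponent⟩
    exact ⟨σ, hσ, by rw [hz, connectedComponent_eq (hσz default)]⟩
  choose σ hσ hσe using hex
  refine ⟨fun i => σ i ≫ q, fun i => ?_, fun i i' h => ?_, fun y hy => ?_⟩
  · rw [Category.assoc, hpb.w, ← Category.assoc, hσ, Category.id_comp]
  · rw [rel_iff_of_isPullback hpb (hσ i) (hσ i')] at h
    refine e.injective (Subtype.ext ?_)
    rw [hσe, hσe, h]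
  · let y' := hpb.lift y (𝟙 _) (by rw [hy, Category.id_comp])
    have hy' : y' ≫ j' ≫ f' = 𝟙 _ := hpb.lift_snd _ _ _
    obtain ⟨i, hi⟩ := e.surjective ⟨_, hfin.mem_toFinset.mpr
      (closure_image_connectedComponent_mem hj' (ho (y' default)) (hi _))⟩
    refine ⟨i, ?_⟩
    have : Rel (j ≫ f) (y' ≫ q) (σ i ≫ q) := by
      rw [rel_iff_of_isPullback hpb hy' (hσ i)]
      refine connectedComponent_eq_of_closure_image_eq hj' (ho _) ?_
      rw [← hσe, hi]
    rwa [hpb.lift_fst] at this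

section Frame

variable {Y S : Scheme.{u}} {g : Y ⟶ S} {d : ℕ} {K : Type u} [Field K] {τ : Spec (.of K) ⟶ S}
  {c₀ c : Fin d → (Spec (.of K) ⟶ Y)}

/-- Comparison with the known frame gives an injective self-map of `Fin d`, which is surjective. The
surjective variant below is the same count. -/
lemma IsFrame.of_inj (h₀ : IsFrame g τ c₀) (hc : ∀ i, c i ≫ g = τ)
    (h : ∀ i i', Rel g (c i) (c i') → i = i') : IsFrame g τ c := by
  choose φ hφ using fun i => h₀.surj (c i) (hc i)
  have hinj : Function.Injective φ := fun i i' hii' => h i i' <| by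
    have := hφ i'
    rw [← hii'] at this
    exact (hφ i).trans this.symm
  refine ⟨hc, h, fun y hy => ?_⟩
  obtain ⟨k, hk⟩ := h₀.surj y hy
  obtain ⟨i, rfl⟩ := Finite.surjective_of_injective hinj k
  exact ⟨i, hk.trans (hφ i).symm⟩

lemma IsFrame.of_surj (h₀ : IsFrame g τ c₀) (hc : ∀ i, c i ≫ g = τ)
    (h : ∀ y, y ≫ g = τ → ∃ i, Rel g y (c i)) : IsFrame g τ c := by
  choose φ hφ using fun k => h (c₀ k) (h₀.comp_eq k)
  have hinj : Function.Injective φ := fun k k' hkk' => h₀.inj k k' <| by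
    have := hφ k'
    rw [← hkk'] at this
    exact (hφ k).trans this.symm
  refine ⟨hc, fun i i' hii' => ?_, h⟩
  obtain ⟨k, rfl⟩ := Finite.surjective_of_injective hinj i
  obtain ⟨k', rfl⟩ := Finite.surjective_of_injective hinj i'
  exact congrArg φ (h₀.inj k k' (((hφ k).trans hii').trans (hφ k').symm))

end Frame

/-- The sections are produced one by one, on fiber products of étale neighborhoods; the open set
prescribed to `exists_etale_section` is the component of `y i`. -/
lemma exists_etale_sections {Y S : Scheme.{u}} (g : Y ⟶ S) [Smooth g] {K : Type u} [Field K]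
    [IsAlgClosed K] (τ : Spec (.of K) ⟶ S) (n : ℕ) (y : Fin n → (Spec (.of K) ⟶ Y))
    (hy : ∀ i, y i ≫ g = τ) :
    ∃ (E : Scheme.{u}) (q : E ⟶ S) (ε : Spec (.of K) ⟶ E) (a : Fin n → (E ⟶ Y)), Etale q ∧
      ε ≫ q = τ ∧ (∀ i, a i ≫ g = q) ∧ ∀ i, Rel g (y i) (ε ≫ a i) := by
  induction n with
  | zero => exact ⟨S, 𝟙 S, τ, Fin.elim0, inferInstance, by simp, fun i => i.elim0,
      fun i => i.elim0⟩
  | succ n ih =>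
    obtain ⟨E, q, ε, a, _, hε, ha, hεa⟩ := ih (fun i => y i.succ) fun i => hy _
    obtain ⟨E', q', ε', a', _, h', hε', ha', hmem⟩ := exists_etale_section g τ
      (isOpen_connectedComponent_of_smooth (pullback.snd g τ) (fiberPoint g (y 0) τ (hy 0)))
      ⟨_, mem_connectedComponent⟩
    refine ⟨pullback q q', pullback.fst q q' ≫ q, pullback.lift ε ε' (by rw [hε, hε']),
      Fin.cons (pullback.snd q q' ≫ a') fun i => pullback.fst q q' ≫ a i, inferInstance,
      by simp [hε], fun i => ?_, fun i => ?_⟩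
    · refine Fin.cases ?_ (fun i => ?_) i
      · simp [ha', pullback.condition]
      · simp [ha]
    · refine Fin.cases ?_ (fun i => ?_) i
      · simp only [Fin.cons_zero, pullback.lift_snd_assoc]
        exact (rel_iff (hy 0) h').mpr (connectedComponent_eq hmem)
      · simpa using hεa i

/-- A family all of whose geometric fibers have `d` components has, étale locally on the base,
sections meeting every component of every geometric fiber exactly once. -/
theorem IsSmoothDense.exists_etale_frame {X Y S : Scheme.{u}} {f : X ⟶ S} {j : Y ⟶ X}
    (h : IsSmoothDense f j) {d : ℕ}
    (hd : ∀ (K : Type u) [Field K] [IsAlgClosed K] (τ : Spec (.of K) ⟶ S),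
      (irreducibleComponents ↥(pullback f τ)).encard = d) (s : S) :
    ∃ (E : Scheme.{u}) (q : E ⟶ S) (c : Fin d → (E ⟶ Y)), Etale q ∧ s ∈ Set.range q ∧
      (∀ i, c i ≫ j ≫ f = q) ∧
      ∀ (K : Type u) [Field K] [IsAlgClosed K] (x : Spec (.of K) ⟶ E),
        IsFrame (j ≫ f) (x ≫ q) fun i => x ≫ c i := by
  have := h.smooth
  obtain ⟨K, _, _, τ, hτ⟩ := exists_geometricPoint s
  obtain ⟨y, hy⟩ := h.exists_isFrame τ (hd K τ)
  obtain ⟨E, q, ε, a, _, hε, ha, hεa⟩ := exists_etale_sections (j ≫ f) τ d y hy.comp_eq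
  let p := pullback.fst f q
  let f' := pullback.snd f q
  let r := pullback.fst j p
  let j' := pullback.snd j p
  have hpb : IsPullback r (j' ≫ f') (j ≫ f) q :=
    (IsPullback.of_hasPullback j p).paste_vert (IsPullback.of_hasPullback f q)
  have h' : IsSmoothDense f' j' :=
    h.of_isPullback (IsPullback.of_hasPullback j p) (IsPullback.of_hasPullback f q)
  have hab (i : Fin d) : r ≫ j ≫ f = ((j' ≫ f') ≫ a i) ≫ j ≫ f := by
    rw [hpb.w, Category.assoc _ (a i), ha]
  -- V is the set of points sharing a component with one of the sections `a i`. It is open, so once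
  -- it meets all components over the chosen point it does so nearby.
  let V : Set ↥(pullback j p) := ⋃ i, relLocus (j ≫ f) r ((j' ≫ f') ≫ a i)
  have hV : IsOpen V := isOpen_iUnion fun i => isOpen_relLocus (hab i)
  have hmeet : MeetsComponents (j' ≫ f') V (ε default) := by
    intro L _ _ z hz
    refine ⟨z, .refl _ _, ?_⟩
    obtain ⟨M, _, _, l, k, hlk⟩ := exists_common_geometricPoint (z ≫ j' ≫ f') ε
      (by rw [Scheme.Hom.comp_apply, hz])
    obtain ⟨y', hy'⟩ := h.exists_isFrame (k ≫ τ) (hd M _)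
    -- The frame over K stays a frame over the larger field M: its members remain unrelated, and the
    -- number of components is still d.
    have hfr : IsFrame (j ≫ f) (k ≫ τ) fun i => k ≫ y i := by
      refine hy'.of_inj (fun i => by rw [Category.assoc, hy.comp_eq]) fun i i' hii' => ?_
      refine hy.inj i i' ((Rel.comp_iff k ?_).mp hii')
      rw [hy.comp_eq, hy.comp_eq]
    obtain ⟨i, hi⟩ := hfr.surj (l ≫ z ≫ r) (by
      rw [Category.assoc, Category.assoc, hpb.w, ← hε, ← Category.assoc k, ← hlk]
      simp only [Category.assoc])
    refine Set.mem_iUnion.mpr ⟨i, ?_⟩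
    rw [mem_relLocus_iff (hab i)]
    rw [← Rel.comp_iff l (by rw [Category.assoc, hab i, Category.assoc z])]
    refine hi.trans ?_
    have : l ≫ z ≫ (j' ≫ f') ≫ a i = k ≫ ε ≫ a i := by
      rw [← Category.assoc k, ← hlk]
      simp only [Category.assoc]
    rw [this, Rel.comp_iff k ((hεa i).comp_eq)]
    exact hεa i
  obtain ⟨M, hM, hεM, hM'⟩ := h'.exists_nhds hV hmeet
  let U : E.Opens := ⟨M, hM⟩
  refine ⟨U, U.ι ≫ q, fun i => U.ι ≫ a i, inferInstance, ⟨⟨ε default, hεM⟩, ?_⟩, fun i => ?_,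
    fun L _ _ x => ?_⟩
  · change q (ε default) = s
    rw [← Scheme.Hom.comp_apply, hε, hτ]
  · rw [Category.assoc, ha]
  · obtain ⟨c₀, hc₀⟩ := h.exists_isFrame (x ≫ U.ι ≫ q) (hd L _)
    -- Only surjectivity needs proof; d sections meeting all of d components meet each exactly once.
    refine hc₀.of_surj (fun i => by simp only [Category.assoc, ha]) fun w hw => ?_
    let w' := hpb.lift w (x ≫ U.ι) (by rw [hw, Category.assoc])
    obtain ⟨w'', hw'', hwV⟩ := hM' ((x ≫ U.ι) default) (x default).2 L w' (by
      rw [← Scheme.Hom.comp_apply, hpb.lift_snd])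
    obtain ⟨i, hi⟩ := Set.mem_iUnion.mp hwV
    rw [mem_relLocus_iff (hab i)] at hi
    refine ⟨i, ?_⟩
    have h₁ := (Rel.iff_of_isPullback hpb hw''.comp_eq).mp hw''
    rw [hpb.lift_fst] at h₁
    have h₂ := h₁.trans hi
    rwa [← Category.assoc w'', ← hw''.comp_eq, hpb.lift_snd, Category.assoc] at h₂

/-! ### Descent of finite étale algebras from idempotents -/

section Descent

open TensorProduct Algebra.TensorProduct

variable (A : Type u) {B : Type u} [CommRing A] [CommRing B] [Algebra A B]

/-- `x ⊗ y ↦ x ⊗ (y ⊗ 1)` -/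
def tensorLeft : B ⊗[A] B →ₐ[A] B ⊗[A] (B ⊗[A] B) :=
  Algebra.TensorProduct.map (.id A B) includeLeft

/-- `x ⊗ y ↦ x ⊗ (1 ⊗ y)` -/
def tensorRight : B ⊗[A] B →ₐ[A] B ⊗[A] (B ⊗[A] B) :=
  Algebra.TensorProduct.map (.id A B) includeRight

/-- `x ⊗ (y ⊗ z) ↦ x z ⊗ y` -/
def tensorContract : B ⊗[A] (B ⊗[A] B) →ₐ[A] B ⊗[A] B :=
  Algebra.TensorProduct.lift includeLeft
    (Algebra.TensorProduct.lift includeRight includeLeft fun _ _ => .all _ _) fun _ _ => .all _ _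

/-- The exchange of factors. -/
abbrev tensorSwap : B ⊗[A] B →ₐ[A] B ⊗[A] B :=
  (Algebra.TensorProduct.comm A B B).toAlgHom

lemma tensorContract_tensorLeft (t : B ⊗[A] B) : tensorContract A (tensorLeft A t) = t := by
  have : (tensorContract A).comp (tensorLeft A) = .id A (B ⊗[A] B) := by
    ext <;> simp [tensorContract, tensorLeft]
  exact DFunLike.congr_fun this t

lemma tensorContract_tensorRight (t : B ⊗[A] B) :
    tensorContract A (tensorRight A t) = lmul' A t ⊗ₜ 1 := by
  have : (tensorContract A).comp (tensorRight A) =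
      (includeLeft : B →ₐ[A] B ⊗[A] B).comp (lmul' A) := by
    ext <;> simp [tensorContract, tensorRight]
  exact DFunLike.congr_fun this t

lemma tensorContract_one_tmul (t : B ⊗[A] B) :
    tensorContract A (1 ⊗ₜ t) = tensorSwap A t := by
  have : (tensorContract A).comp includeRight = tensorSwap A (B := B) := by
    ext <;> simp [tensorContract]
  exact DFunLike.congr_fun this t

lemma lmul'_tensorSwap (t : B ⊗[A] B) : lmul' A (tensorSwap A t) = lmul' A t := by
  have : (lmul' A).comp (tensorSwap A (B := B)) = lmul' A := by
    ext <;> simp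
  exact DFunLike.congr_fun this t

variable {A} {d : ℕ} (e : Fin d → Fin d → B ⊗[A] B)

/-- A family of elements of `B ⊗ B` gluing `d` copies of `Spec B` to a scheme over `Spec A`. -/
structure IsGluing : Prop where
  sum_eq_one : ∀ i, ∑ j, e i j = 1
  cocycle : ∀ i j k, 1 ⊗ₜ e i j * tensorLeft A (tensorSwap A (e i k)) =
    1 ⊗ₜ e i j * tensorRight A (tensorSwap A (e j k))
  diag : ∀ i j, lmul' A (e i j) = if i = j then 1 else 0

/-- The algebra of functions on the scheme glued from `d` copies of `Spec B` by means of `e`. -/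
def gluedSubalgebra : Subalgebra A (Fin d → B) where
  carrier := {b | ∀ i j, e i j * (b i ⊗ₜ 1) = e i j * (1 ⊗ₜ b j)}
  mul_mem' := by
    intro b b' hb hb' i j
    have h₁ : (b * b') i ⊗ₜ[A] (1 : B) = (b i ⊗ₜ 1) * (b' i ⊗ₜ 1) := by simp
    have h₂ : (1 : B) ⊗ₜ[A] (b * b') j = (1 ⊗ₜ b j) * (1 ⊗ₜ b' j) := by simp
    rw [h₁, h₂, ← mul_assoc, hb i j, mul_right_comm, hb' i j]
    ring
  add_mem' := by
    intro b b' hb hb' i j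
    simp only [Pi.add_apply, add_tmul, tmul_add, mul_add, hb i j, hb' i j]
  algebraMap_mem' := by
    intro a i j
    congr 1
    simp only [Pi.algebraMap_apply]
    rw [Algebra.algebraMap_eq_smul_one, TensorProduct.smul_tmul]

/-- The linear map whose kernel is `gluedSubalgebra e`. -/
def gluingMap : (Fin d → B) →ₗ[A] (Fin d × Fin d → B ⊗[A] B) :=
  LinearMap.pi fun ij => (LinearMap.mulLeft A (e ij.1 ij.2)).comp
    ((includeLeft : B →ₐ[A] B ⊗[A] B).toLinearMap.comp (LinearMap.proj ij.1) -
      (includeRight : B →ₐ[A] B ⊗[A] B).toLinearMap.comp (LinearMap.proj ij.2))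

lemma exact_gluingMap : Function.Exact (gluedSubalgebra e).val.toLinearMap (gluingMap e) := by
  intro b
  have : gluingMap e b = 0 ↔ b ∈ gluedSubalgebra e := by
    rw [funext_iff, Prod.forall]
    refine forall₂_congr fun i j => ?_
    simp [gluingMap, mul_sub, sub_eq_zero]
  rw [this]
  exact ⟨fun hb => ⟨⟨b, hb⟩, rfl⟩, by rintro ⟨c, rfl⟩; exact c.2⟩

lemma lTensor_gluingMap (m : B ⊗[A] (Fin d → B)) (i j : Fin d) :
    (LinearMap.proj (R := A) (φ := fun _ : Fin d × Fin d => B ⊗[A] B) (i, j)).lTensor B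
      ((gluingMap e).lTensor B m) =
    1 ⊗ₜ e i j * (tensorLeft A ((LinearMap.proj i).lTensor B m) -
      tensorRight A ((LinearMap.proj j).lTensor B m)) := by
  induction m with
  | zero => simp
  | add x y hx hy =>
    simp only [map_add, hx, hy]
    ring
  | tmul x b => simp [gluingMap, tensorLeft, tensorRight, tmul_sub, mul_sub]

lemma piRight_apply_eq {ι : Type*} [Fintype ι] [DecidableEq ι] {M : Type*} [AddCommGroup M]
    [Module A M] (m : B ⊗[A] (ι → M)) (i : ι) :
    TensorProduct.piRight A A B (fun _ => M) m i =
      (LinearMap.proj (R := A) (φ := fun _ : ι => M) i).lTensor B m := by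
  induction m with
  | zero => simp
  | add x y hx hy => simp only [map_add, Pi.add_apply, hx, hy]
  | tmul x b => simp

lemma eq_of_forall_lTensor_proj_eq {ι : Type*} [Finite ι] {M : Type*} [AddCommGroup M] [Module A M]
    {m m' : B ⊗[A] (ι → M)}
    (h : ∀ i, (LinearMap.proj (R := A) (φ := fun _ : ι => M) i).lTensor B m =
      (LinearMap.proj i).lTensor B m') : m = m' := by
  classical
  have := Fintype.ofFinite ι
  refine (TensorProduct.piRight A A B (fun _ => M)).injective (funext fun i => ?_)
  rw [piRight_apply_eq, piRight_apply_eq, h]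

/-- The base change of the glued scheme to `Spec B` is a disjoint union of copies of `Spec B`. -/
def gluedBaseChange : B ⊗[A] gluedSubalgebra e →ₐ[B] (Fin d → B) :=
  Algebra.TensorProduct.lift (Algebra.ofId B (Fin d → B)) (gluedSubalgebra e).val
    fun _ _ => .all _ _

lemma gluedBaseChange_tmul (b : B) (c : gluedSubalgebra e) (i : Fin d) :
    gluedBaseChange e (b ⊗ₜ c) i = b * (c : Fin d → B) i := by
  simp [gluedBaseChange, Algebra.ofId_apply]

lemma gluedBaseChange_apply (z : B ⊗[A] gluedSubalgebra e) (i : Fin d) :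
    gluedBaseChange e z i = lmul' A ((LinearMap.proj i).lTensor B
      ((gluedSubalgebra e).val.toLinearMap.lTensor B z)) := by
  induction z with
  | zero => simp
  | add x y hx hy => simp only [map_add, Pi.add_apply, hx, hy]
  | tmul x b => simp [gluedBaseChange_tmul]

variable {e}

/-- Effective descent made explicit. By flatness, B ⊗ `gluedSubalgebra e` is the kernel of the
base-changed gluing map, a set of tuples mᵢ in B ⊗ B. Contracting the gluing equations shows that
such a tuple is determined by its restrictions to the diagonal, because the `e i j` sum to 1 over j.
Conversely, for given diagonal values v, the tuple mᵢ = ∑ₖ swap(eᵢₖ)(vₖ ⊗ 1) satisfies the equations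
by the cocycle condition. -/
theorem IsGluing.bijective_gluedBaseChange (h : IsGluing e) [Module.Flat A B] :
    Function.Bijective (gluedBaseChange e) := by
  have hexact := Module.Flat.lTensor_exact B (exact_gluingMap e)
  constructor
  · rw [injective_iff_map_eq_zero]
    intro z hz
    refine Module.Flat.lTensor_preserves_injective_linearMap (M := B)
      (gluedSubalgebra e).val.toLinearMap Subtype.val_injective ?_
    rw [map_zero]
    set m := (gluedSubalgebra e).val.toLinearMap.lTensor B z with hm
    refine eq_of_forall_lTensor_proj_eq fun i => ?_
    have hm0 : (gluingMap e).lTensor B m = 0 := hexact.apply_apply_eq_zero z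
    rw [map_zero, ← one_mul ((LinearMap.proj i).lTensor B m), ← map_one (tensorSwap A),
      ← h.sum_eq_one i, map_sum, Finset.sum_mul]
    refine Finset.sum_eq_zero fun j _ => ?_
    have := lTensor_gluingMap e m i j
    rw [hm0, map_zero] at this
    have := congrArg (tensorContract A) this
    rw [map_zero, map_mul, map_sub, tensorContract_tensorLeft, tensorContract_tensorRight,
      tensorContract_one_tmul, hm, ← gluedBaseChange_apply, hz] at this
    simpa using this.symm
  · intro v
    let m' (i : Fin d) : B ⊗[A] B := ∑ k, tensorSwap A (e i k) * (v k ⊗ₜ 1)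
    obtain ⟨m, hm⟩ : ∃ m : B ⊗[A] (Fin d → B), ∀ i, (LinearMap.proj i).lTensor B m = m' i := by
      refine ⟨(TensorProduct.piRight A A B (fun _ => B)).symm m', fun i => ?_⟩
      rw [← piRight_apply_eq, LinearEquiv.apply_symm_apply]
    obtain ⟨z, hz⟩ := (hexact m).mp (eq_of_forall_lTensor_proj_eq fun ⟨i, j⟩ => by
      rw [lTensor_gluingMap, hm, hm, map_zero]
      simp only [m', map_sum, map_mul, ← Finset.sum_sub_distrib, Finset.mul_sum, mul_sub,
        ← mul_assoc, h.cocycle]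
      refine Finset.sum_eq_zero fun k _ => ?_
      simp [tensorLeft, tensorRight])
    refine ⟨z, funext fun i => ?_⟩
    rw [gluedBaseChange_apply, hz, hm]
    simp only [m', map_sum, map_mul, lmul'_tensorSwap, h.diag]
    simp

/-- The isomorphism given by `gluedBaseChange`. -/
def IsGluing.equiv (h : IsGluing e) [Module.Flat A B] : B ⊗[A] gluedSubalgebra e ≃ₐ[B] (Fin d → B) :=
  .ofBijective _ h.bijective_gluedBaseChange

variable [Module.FaithfullyFlat A B]

lemma IsGluing.finite (h : IsGluing e) : Module.Finite A (gluedSubalgebra e) :=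
  have : Module.Finite B (B ⊗[A] gluedSubalgebra e) := .equiv h.equiv.symm.toLinearEquiv
  .of_finite_tensorProduct_of_faithfullyFlat B

lemma IsGluing.etale (h : IsGluing e) : Algebra.Etale A (gluedSubalgebra e) :=
  have : Algebra.Etale B (B ⊗[A] gluedSubalgebra e) := .of_equiv h.equiv.symm
  .of_etale_tensorProduct_of_faithfullyFlat B

lemma IsGluing.rankAtStalk (h : IsGluing e) (p : PrimeSpectrum A) :
    Module.rankAtStalk (gluedSubalgebra e) p = d := by
  have := h.finite
  have := h.etale
  obtain ⟨q, rfl⟩ := PrimeSpectrum.comap_surjective_of_faithfullyFlat (A := A) (B := B) p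
  have := q.nontrivial
  rw [← Module.rankAtStalk_baseChange, Module.rankAtStalk_eq_of_equiv h.equiv.toLinearEquiv,
    Module.rankAtStalk_eq_finrank_of_free]
  simp

/-- The points of the glued scheme. -/
lemma IsGluing.exists_eq (h : IsGluing e) {K : Type*} [Field K] (φ : gluedSubalgebra e →+* K)
    (x : B →+* K) (hx : x.comp (algebraMap A B) = φ.comp (algebraMap A (gluedSubalgebra e))) :
    ∃ i, ∀ c : gluedSubalgebra e, φ c = x ((c : Fin d → B) i) := by
  let := x.toAlgebra
  let : Algebra A K := (x.comp (algebraMap A B)).toAlgebra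
  have : IsScalarTower A B K := .of_algebraMap_eq fun a => rfl
  let φ' : gluedSubalgebra e →ₐ[A] K := ⟨φ, fun a => (RingHom.congr_fun hx a).symm⟩
  let χ : (Fin d → B) →ₐ[B] K :=
    (Algebra.TensorProduct.lift (Algebra.ofId B K) φ' fun _ _ => .all _ _).comp
      h.equiv.symm.toAlgHom
  have hχ (z : B ⊗[A] gluedSubalgebra e) : χ (gluedBaseChange e z) =
      Algebra.TensorProduct.lift (Algebra.ofId B K) φ' (fun _ _ => .all _ _) z := by
    change Algebra.TensorProduct.lift (Algebra.ofId B K) φ' (fun _ _ => .all _ _)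
      (h.equiv.symm (h.equiv z)) = _
    rw [AlgEquiv.symm_apply_apply]
  -- A homomorphism from Bᵈ to a field is nonzero on some coordinate idempotent and therefore
  -- factors through that coordinate.
  have hsum : ∑ i, χ (Pi.single i 1) = 1 := by
    have : ∑ i, (Pi.single i 1 : Fin d → B) = 1 := Finset.univ_sum_single (1 : Fin d → B)
    rw [← map_sum, this, map_one]
  obtain ⟨i, -, hi⟩ := Finset.exists_ne_zero_of_sum_ne_zero (hsum.trans_ne one_ne_zero)
  refine ⟨i, fun c => ?_⟩
  have h₁ : χ (Pi.single i 1) * χ (c : Fin d → B) =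
      χ (Pi.single i 1) * algebraMap B K ((c : Fin d → B) i) := by
    rw [← χ.commutes, ← map_mul, ← map_mul]
    congr 1
    ext k
    rcases eq_or_ne k i with rfl | hk
    · simp
    · simp [hk]
  have h₂ : gluedBaseChange e (1 ⊗ₜ c) = c := by
    ext k
    rw [gluedBaseChange_tmul, one_mul]
  have h₃ := hχ (1 ⊗ₜ c)
  rw [h₂] at h₃
  have h₄ := mul_left_cancel₀ hi h₁
  rw [h₃] at h₄
  have h₅ : φ' c = algebraMap B K ((c : Fin d → B) i) := by simpa using h₄
  exact h₅

/-- The glued functions span Bᵈ over B, so they distinguish the coordinates. -/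
lemma IsGluing.eq_of_forall_eq (h : IsGluing e) {K : Type*} [Field K] (x : B →+* K) {i j : Fin d}
    (hij : ∀ c : gluedSubalgebra e, x ((c : Fin d → B) i) = x ((c : Fin d → B) j)) : i = j := by
  have key (z : B ⊗[A] gluedSubalgebra e) :
      x (gluedBaseChange e z i) = x (gluedBaseChange e z j) := by
    induction z with
    | zero => simp
    | add y z hy hz => simp only [map_add, Pi.add_apply, hy, hz]
    | tmul b c => rw [gluedBaseChange_tmul, gluedBaseChange_tmul, map_mul, map_mul, hij]
  by_contra hne
  obtain ⟨z, hz⟩ := h.bijective_gluedBaseChange.2 (Pi.single i 1)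
  have := key z
  rw [hz] at this
  simp [Pi.single_eq_of_ne (Ne.symm hne)] at this

end Descent

/-! ### Idempotents -/

lemma eq_of_isIdempotentElem {R : Type u} [CommRing R] {e e' : R} (he : IsIdempotentElem e)
    (he' : IsIdempotentElem e')
    (h : ∀ (K : Type u) [Field K] [IsAlgClosed K] (φ : R →+* K), φ e = 1 ↔ φ e' = 1) : e = e' := by
  have key {e : R} (he : IsIdempotentElem e) {K : Type u} [Field K] (φ : R →+* K) :
      φ e ≠ 0 ↔ φ e = 1 := by
    rcases IsIdempotentElem.iff_eq_zero_or_one.mp (he.map φ) with h | h <;> simp [h]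
  refine PrimeSpectrum.basicOpen_injOn_isIdempotentElem he he' ?_
  ext p
  let φ : R →+* AlgebraicClosure p.asIdeal.ResidueField :=
    (algebraMap p.asIdeal.ResidueField _).comp (algebraMap R _)
  have hφ (r : R) : r ∈ p.asIdeal ↔ φ r = 0 := by
    rw [RingHom.comp_apply, map_eq_zero, Ideal.algebraMap_residueField_eq_zero]
  have h₁ : e ∉ p.asIdeal ↔ e' ∉ p.asIdeal := by
    rw [hφ, hφ]
    exact (key he φ).trans ((h _ φ).trans (key he' φ).symm)
  exact h₁

/-! ### The gluing datum of a frame -/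

section FrameGluing

open TensorProduct Algebra.TensorProduct

variable {Y S : Scheme.{u}} {A B : Type u} [CommRing A] [CommRing B] [Algebra A B] {d : ℕ}

/-- Sections `c i` of `g` over `Spec B` meeting each geometric component of the fibers exactly
once. -/
structure IsAffineFrame (g : Y ⟶ S) (s : Spec (.of A) ⟶ S) (c : Fin d → (Spec (.of B) ⟶ Y)) :
    Prop where
  comp_eq : ∀ i, c i ≫ g = Spec.map (CommRingCat.ofHom (algebraMap A B)) ≫ s
  isFrame : ∀ (K : Type u) [Field K] [IsAlgClosed K] (x : Spec (.of K) ⟶ Spec (.of B)),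
    IsFrame g (x ≫ Spec.map (CommRingCat.ofHom (algebraMap A B)) ≫ s) fun i => x ≫ c i

/-- The function `e i j` is the indicator function of the locus where `c i` and `c j` lie in the
same component. -/
def IsIndicator (g : Y ⟶ S) (c : Fin d → (Spec (.of B) ⟶ Y)) (e : Fin d → Fin d → B ⊗[A] B) :
    Prop :=
  ∀ i j, IsIdempotentElem (e i j) ∧
    ∀ (K : Type u) [Field K] [IsAlgClosed K] (φ : B ⊗[A] B →+* K), φ (e i j) = 1 ↔
      Rel g (Spec.map (CommRingCat.ofHom (φ.comp includeLeftRingHom)) ≫ c i)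
        (Spec.map (CommRingCat.ofHom (φ.comp includeRight.toRingHom)) ≫ c j)

lemma specMap_default_mem_basicOpen_iff {R K : Type u} [CommRing R] [Field K] (φ : R →+* K) (r : R) :
    Spec.map (CommRingCat.ofHom φ) (default : Spec (.of K)) ∈
      (PrimeSpectrum.basicOpen r : Set (PrimeSpectrum R)) ↔ φ r ≠ 0 := by
  have : (default : Spec (.of K)).asIdeal = ⊥ :=
    Ideal.eq_bot_of_prime (h := PrimeSpectrum.isPrime _) _
  change r ∉ Ideal.comap φ (default : Spec (.of K)).asIdeal ↔ _
  rw [this]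
  simp

lemma specMap_comp_eq_of_comp_eq {K : Type u} [Field K] {g : Y ⟶ S}
    {s : Spec (.of A) ⟶ S} {c : Fin d → (Spec (.of B) ⟶ Y)} (h : IsAffineFrame g s c)
    {x x' : B →+* K} (hx : x.comp (algebraMap A B) = x'.comp (algebraMap A B)) (i : Fin d) :
    (Spec.map (CommRingCat.ofHom x) ≫ c i) ≫ g =
      Spec.map (CommRingCat.ofHom x') ≫ Spec.map (CommRingCat.ofHom (algebraMap A B)) ≫ s := by
  rw [Category.assoc, h.comp_eq, ← Category.assoc, ringHom_comp_specMap_eq, hx,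
    ← ringHom_comp_specMap_eq, Category.assoc]

lemma includeLeft_comp_eq {K : Type u} [Field K] (φ : B ⊗[A] B →+* K) :
    (φ.comp includeLeftRingHom).comp (algebraMap A B) =
      (φ.comp (includeRight : B →ₐ[A] B ⊗[A] B).toRingHom).comp (algebraMap A B) := by
  ext a
  have := ((includeRight : B →ₐ[A] B ⊗[A] B).commutes a)
  simp only [RingHom.comp_apply]
  congr 1
  exact this.symm

variable {g : Y ⟶ S} {s : Spec (.of A) ⟶ S} {c : Fin d → (Spec (.of B) ⟶ Y)}

/-- For fixed i, a frame makes the open loci where `c i` on the left factor meets `c j` on the right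
factor a partition indexed by j. Each is therefore clopen and given by an idempotent. -/
theorem IsAffineFrame.exists_isIndicator [Smooth g] (h : IsAffineFrame g s c) :
    ∃ e : Fin d → Fin d → B ⊗[A] B, IsIndicator g c e := by
  let a (i : Fin d) :=
    Spec.map (CommRingCat.ofHom (includeLeftRingHom (R := A) (A := B) (B := B))) ≫ c i
  let b (j : Fin d) :=
    Spec.map (CommRingCat.ofHom (includeRight (R := A) (A := B) (B := B)).toRingHom) ≫ c j
  have hab (i j) : a i ≫ g = b j ≫ g := by
    simp only [a, b, Category.assoc, h.comp_eq]
    rw [← Category.assoc, ← Category.assoc, ringHom_comp_specMap_eq, ringHom_comp_specMap_eq]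
    congr 3
    ext a
    exact ((includeRight : B →ₐ[A] B ⊗[A] B).commutes a).symm
  have key (K : Type u) [Field K] [IsAlgClosed K] (φ : B ⊗[A] B →+* K) (i j : Fin d) :
      Spec.map (CommRingCat.ofHom φ) default ∈ relLocus g (a i) (b j) ↔
      Rel g (Spec.map (CommRingCat.ofHom (φ.comp includeLeftRingHom)) ≫ c i)
        (Spec.map (CommRingCat.ofHom (φ.comp includeRight.toRingHom)) ≫ c j) := by
    rw [mem_relLocus_iff (hab i j), ← ringHom_comp_specMap_eq, ← ringHom_comp_specMap_eq]
    simp only [a, b, Category.assoc]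
  have hpt (t : Spec (.of (B ⊗[A] B))) : ∃ (K : Type u) (_ : Field K) (_ : IsAlgClosed K)
      (φ : B ⊗[A] B →+* K), Spec.map (CommRingCat.ofHom φ) default = t := by
    obtain ⟨K, _, _, τ, hτ⟩ := exists_geometricPoint t
    obtain ⟨φ, rfl⟩ := Spec.map_surjective τ
    exact ⟨K, _, ‹_›, φ.hom, hτ _⟩
  have hclopen (i j) : IsClopen (relLocus g (a i) (b j)) := by
    refine ⟨?_, isOpen_relLocus (hab i j)⟩
    have : (relLocus g (a i) (b j))ᶜ = ⋃ (k) (_ : k ≠ j), relLocus g (a i) (b k) := by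
      ext t
      obtain ⟨K, _, _, φ, rfl⟩ := hpt t
      have hf := h.isFrame K (Spec.map (CommRingCat.ofHom (φ.comp includeRight.toRingHom)))
      obtain ⟨k, hk⟩ := hf.surj _ (specMap_comp_eq_of_comp_eq h (includeLeft_comp_eq φ) i)
      simp only [Set.mem_compl_iff, Set.mem_iUnion, key]
      constructor
      · intro hj
        exact ⟨k, fun hkj => hj (hkj ▸ hk), hk⟩
      · rintro ⟨l, hlj, hl⟩ hj
        exact hlj (hf.inj _ _ (hl.symm.trans hj))
    rw [← isOpen_compl_iff, this]
    exact isOpen_iUnion fun k => isOpen_iUnion fun _ => isOpen_relLocus (hab i k)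
  choose e he he' using fun i j =>
    PrimeSpectrum.exists_idempotent_basicOpen_eq_of_isClopen (hclopen i j)
  refine ⟨e, fun i j => ⟨he i j, fun K _ _ φ => ?_⟩⟩
  rw [← key, he']
  refine Iff.trans ?_ (specMap_default_mem_basicOpen_iff φ (e i j)).symm
  rcases IsIdempotentElem.iff_eq_zero_or_one.mp ((he i j).map φ) with h | h <;> simp [h]

variable {e : Fin d → Fin d → B ⊗[A] B}

lemma IsIndicator.mul_eq_zero (he : IsIndicator g c e) (h : IsAffineFrame g s c) (i : Fin d)
    {j k : Fin d} (hjk : j ≠ k) : e i j * e i k = 0 := by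
  refine eq_of_isIdempotentElem ((he i j).1.mul (he i k).1) .zero fun K _ _ φ => ?_
  simp only [map_zero, zero_ne_one, iff_false, map_mul]
  intro h1
  have hj : φ (e i j) = 1 := by
    rcases IsIdempotentElem.iff_eq_zero_or_one.mp ((he i j).1.map φ) with h | h
    · simp [h] at h1
    · exact h
  have hk : φ (e i k) = 1 := by rwa [hj, one_mul] at h1
  rw [(he i j).2] at hj
  rw [(he i k).2] at hk
  exact hjk ((h.isFrame K (Spec.map (CommRingCat.ofHom (φ.comp includeRight.toRingHom)))).inj _ _
    (hj.symm.trans hk))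

/-- Identities between idempotents can be checked at geometric points. There the sum says that
exactly one `c j` shares the component of `c i`, the cocycle condition is transitivity of the
relation, and the diagonal condition says that distinct sections of the frame are unrelated. -/
theorem IsIndicator.isGluing (he : IsIndicator g c e) (h : IsAffineFrame g s c) : IsGluing e where
  sum_eq_one i := by
    have ho : OrthogonalIdempotents (e i) := ⟨fun j => (he i j).1, fun j k hjk => he.mul_eq_zero h i hjk⟩
    refine eq_of_isIdempotentElem (ho.isIdempotentElem_sum) .one fun K _ _ φ => ?_
    simp only [map_one, iff_true]
    obtain ⟨j, hj⟩ := (h.isFrame K (Spec.map (CommRingCat.ofHom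
      (φ.comp includeRight.toRingHom)))).surj _ (specMap_comp_eq_of_comp_eq h (includeLeft_comp_eq φ) i)
    rw [← (he i j).2] at hj
    have := congrArg φ (ho.mul_sum_of_mem (Finset.mem_univ j))
    rwa [map_mul, hj, one_mul] at this
  cocycle i j k := by
    refine eq_of_isIdempotentElem ?_ ?_ fun K _ _ φ => ?_
    · exact (((he i j).1.map includeRight)).mul (((he i k).1.map _).map _)
    · exact (((he i j).1.map includeRight)).mul (((he j k).1.map _).map _)
    · have key {a b : K} (ha : IsIdempotentElem a) : a * b = 1 ↔ a = 1 ∧ b = 1 := by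
        rcases IsIdempotentElem.iff_eq_zero_or_one.mp ha with h | h <;> simp [h]
      have h₁ : φ (1 ⊗ₜ e i j) = 1 ↔ _ := (he i j).2 K (φ.comp includeRight.toRingHom)
      have h₂ : φ (tensorLeft A (tensorSwap A (e i k))) = 1 ↔ _ :=
        (he i k).2 K (φ.comp ((tensorLeft A).comp (tensorSwap A)).toRingHom)
      have h₃ : φ (tensorRight A (tensorSwap A (e j k))) = 1 ↔ _ :=
        (he j k).2 K (φ.comp ((tensorRight A).comp (tensorSwap A)).toRingHom)
      have hid : IsIdempotentElem (φ (1 ⊗ₜ[A] e i j)) := ((he i j).1.map includeRight).map φ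
      rw [map_mul, map_mul, key hid, key hid]
      refine and_congr_right fun h₀ => ?_
      rw [h₂, h₃]
      replace h₀ := h₁.mp h₀
      have e₁ : (φ.comp (tensorLeft A (B := B)|>.comp (tensorSwap A)).toRingHom).comp
          includeLeftRingHom = (φ.comp includeRight.toRingHom).comp includeLeftRingHom := by
        ext b; simp [tensorLeft]
      have e₂ : (φ.comp (tensorRight A (B := B)|>.comp (tensorSwap A)).toRingHom).comp
          includeLeftRingHom = (φ.comp includeRight.toRingHom).comp includeRight.toRingHom := by
        ext b; simp [tensorRight]
      have e₃ : (φ.comp (tensorLeft A (B := B)|>.comp (tensorSwap A)).toRingHom).comp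
          includeRight.toRingHom = φ.comp includeLeftRingHom := by
        ext b; simp [tensorLeft, Algebra.TensorProduct.one_def]
      have e₄ : (φ.comp (tensorRight A (B := B)|>.comp (tensorSwap A)).toRingHom).comp
          includeRight.toRingHom = φ.comp includeLeftRingHom := by
        ext b; simp [tensorRight, Algebra.TensorProduct.one_def]
      rw [e₁, e₂, e₃, e₄]
      exact ⟨h₀.symm.trans, h₀.trans⟩
  diag i j := by
    refine eq_of_isIdempotentElem ((he i j).1.map _) ?_ fun K _ _ φ => ?_
    · split
      exacts [.one, .zero]
    · have h₁ : φ (lmul' A (e i j)) = 1 ↔ _ := (he i j).2 K (φ.comp (lmul' A).toRingHom)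
      have e₁ : (φ.comp (lmul' A (S := B)).toRingHom).comp includeLeftRingHom = φ := by
        ext b; simp
      have e₂ : (φ.comp (lmul' A (S := B)).toRingHom).comp includeRight.toRingHom = φ := by
        ext b; simp
      rw [h₁, e₁, e₂]
      rcases eq_or_ne i j with rfl | hij
      · simp [Rel.refl]
      · simp only [if_neg hij, map_zero, zero_ne_one, iff_false]
        exact fun hr => hij ((h.isFrame K (Spec.map (CommRingCat.ofHom φ))).inj _ _ hr)

/-- The equality of points of the glued scheme. -/
theorem IsIndicator.forall_eq_iff [Module.FaithfullyFlat A B] (he : IsIndicator g c e)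
    (h : IsAffineFrame g s c)
    {K : Type u} [Field K] [IsAlgClosed K] {x x' : B →+* K}
    (hx : x.comp (algebraMap A B) = x'.comp (algebraMap A B)) (i j : Fin d) :
    (∀ b : gluedSubalgebra e, x ((b : Fin d → B) i) = x' ((b : Fin d → B) j)) ↔
      Rel g (Spec.map (CommRingCat.ofHom x) ≫ c i) (Spec.map (CommRingCat.ofHom x') ≫ c j) := by
  have key (j : Fin d) (hr : Rel g (Spec.map (CommRingCat.ofHom x) ≫ c i)
      (Spec.map (CommRingCat.ofHom x') ≫ c j)) (b : gluedSubalgebra e) :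
      x ((b : Fin d → B) i) = x' ((b : Fin d → B) j) := by
    let : Algebra A K := (x.comp (algebraMap A B)).toAlgebra
    let y : B →ₐ[A] K := ⟨x, fun _ => rfl⟩
    let y' : B →ₐ[A] K := ⟨x', fun a => (RingHom.congr_fun hx a).symm⟩
    let φ : B ⊗[A] B →ₐ[A] K := Algebra.TensorProduct.lift y y' fun _ _ => .all _ _
    have e₁ : φ.toRingHom.comp includeLeftRingHom = x := by
      ext b; simp [φ, y]
    have e₂ : φ.toRingHom.comp includeRight.toRingHom = x' := by
      ext b; simp [φ, y']
    have h₁ : φ (e i j) = 1 := by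
      refine ((he i j).2 K φ.toRingHom).mpr ?_
      rwa [e₁, e₂]
    have := congrArg φ (b.2 i j)
    rw [map_mul, map_mul, h₁, one_mul, one_mul] at this
    simpa [φ, y, y'] using this
  refine ⟨fun hxx => ?_, fun hr => key j hr⟩
  -- Some `c k` is related to the given point, hence equal to it on glued functions; these separate
  -- coordinates, so k = j.
  obtain ⟨k, hk⟩ := (h.isFrame K (Spec.map (CommRingCat.ofHom x'))).surj _
    (specMap_comp_eq_of_comp_eq h hx i)
  have : j = k := (he.isGluing h).eq_of_forall_eq x' fun b => (hxx b).symm.trans (key k hk b)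
  rwa [this]

end FrameGluing

/-! ### Local representability of the space of components -/

lemma isSheaf_piZero {Y S : Scheme.{u}} (g : Y ⟶ S) :
    Presieve.IsSheaf Scheme.etaleTopology.{u} (piZero g) :=
  (isSheaf_iff_isSheaf_of_type _ _).mp
    ((presheafToSheaf Scheme.etaleTopology.{u} _).obj (componentPresheaf g)).property

lemma generate_ofArrows_mem_etaleTopology {I : Type*} {S : Scheme.{u}} {X : I → Scheme.{u}}
    (f : ∀ i, X i ⟶ S) (hs : ∀ x, ∃ i, x ∈ Set.range (f i)) (hf : ∀ i, Etale (f i)) :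
    Sieve.generate (Presieve.ofArrows X f) ∈ Scheme.etaleTopology.{u} S :=
  Precoverage.generate_mem_toGrothendieck
    ((Scheme.ofArrows_mem_precoverage_iff @Etale).mpr ⟨hs, hf⟩)

/-- The diagonal of an étale morphism is an open immersion, so the pair (v, w) factors through it as
soon as it does so on points. -/
lemma eq_of_forall_geometricPoint_of_etale {P S V : Scheme.{u}} (p : P ⟶ S) [Etale p] {v w : V ⟶ P}
    (h : v ≫ p = w ≫ p) (hvw : ∀ (K : Type u) [Field K] [IsAlgClosed K] (τ : Spec (.of K) ⟶ V),
      τ ≫ v = τ ≫ w) : v = w := by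
  let l := IsOpenImmersion.lift (pullback.diagonal p) (pullback.lift v w h) <| by
    rintro _ ⟨t, rfl⟩
    obtain ⟨K, _, _, τ, hτ⟩ := exists_geometricPoint t
    refine ⟨(τ ≫ v) default, ?_⟩
    rw [← hτ default, ← Scheme.Hom.comp_apply, ← Scheme.Hom.comp_apply]
    have : (τ ≫ v) ≫ pullback.diagonal p = τ ≫ pullback.lift v w h := by
      apply pullback.hom_ext <;> simp [hvw K τ]
    rw [this]
  have hl : l ≫ pullback.diagonal p = pullback.lift v w h := IsOpenImmersion.lift_fac _ _ _
  have h₁ := congrArg (· ≫ pullback.fst p p) hl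
  have h₂ := congrArg (· ≫ pullback.snd p p) hl
  simp only [Category.assoc, pullback.diagonal_fst, pullback.diagonal_snd, Category.comp_id,
    pullback.lift_fst, pullback.lift_snd] at h₁ h₂
  rw [← h₁, ← h₂]

/-- The pair `(P, θ)` represents the restriction of `F` to `S'`. -/
structure Represents {F : PSh.{u}} {S S' P : Scheme.{u}} (φ : F ⟶ uliftYoneda.{u + 1}.obj S)
    (s : S' ⟶ S) (p : P ⟶ S') (θ : F.obj (op P)) : Prop where
  app_eq : φ.app (op P) θ = ULift.up (p ≫ s)
  existsUnique : ∀ ⦃V : Scheme.{u}⦄ (b : V ⟶ S') (ξ : F.obj (op V)),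
    φ.app (op V) ξ = ULift.up (b ≫ s) → ∃! v : V ⟶ P, v ≫ p = b ∧ F.map v.op θ = ξ

/-- The sieve of all morphisms along which `ξ` comes from `P`. -/
def liftSieve {F : PSh.{u}} {S' P : Scheme.{u}} (p : P ⟶ S') (θ : F.obj (op P)) {V : Scheme.{u}}
    (b : V ⟶ S') (ξ : F.obj (op V)) : Sieve V where
  arrows W m := ∃ w : W ⟶ P, w ≫ p = m ≫ b ∧ F.map w.op θ = F.map m.op ξ
  downward_closed := by
    rintro W W' m ⟨w, hw, hw'⟩ n
    refine ⟨n ≫ w, by simp [hw], ?_⟩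
    simp [hw']

/-- Lifts to P exist on a covering, agree on overlaps by uniqueness, and glue because schemes are
étale sheaves. The sheaf property of F identifies the pullback of θ with ξ. -/
lemma Represents.of_liftSieve_mem {F : PSh.{u}} {S S' P : Scheme.{u}}
    {φ : F ⟶ uliftYoneda.{u + 1}.obj S} {s : S' ⟶ S} {p : P ⟶ S'} {θ : F.obj (op P)}
    (hF : Presieve.IsSheaf Scheme.etaleTopology.{u} F)
    (hθ : φ.app (op P) θ = ULift.up (p ≫ s))
    (huniq : ∀ (V : Scheme.{u}) (v w : V ⟶ P), v ≫ p = w ≫ p →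
      F.map v.op θ = F.map w.op θ → v = w)
    (hcov : ∀ (V : Scheme.{u}) (b : V ⟶ S') (ξ : F.obj (op V)),
      φ.app (op V) ξ = ULift.up (b ≫ s) → liftSieve p θ b ξ ∈ Scheme.etaleTopology.{u} V) :
    Represents φ s p θ where
  app_eq := hθ
  existsUnique V b ξ hξ := by
    refine existsUnique_of_exists_of_unique ?_ fun v w ⟨hv, hv'⟩ ⟨hw, hw'⟩ =>
      huniq _ _ _ (hv.trans hw.symm) (hv'.trans hw'.symm)
    have hR := hcov V b ξ hξ
    have hsP := (isSheaf_iff_isSheaf_of_type _ _).mp (isSheaf_scheme P) _ hR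
    have hsS := (isSheaf_iff_isSheaf_of_type _ _).mp (isSheaf_scheme S') _ hR
    have hsF := hF _ hR
    choose w hw hw' using fun W (m : W ⟶ V) (hm : liftSieve p θ b ξ m) => hm
    let x : Presieve.FamilyOfElements (uliftYoneda.{u + 1}.obj P) (liftSieve p θ b ξ).arrows :=
      fun W m hm => ULift.up (w W m hm)
    have hx : x.Compatible := by
      intro W₁ W₂ Z n₁ n₂ m₁ m₂ h₁ h₂ e
      refine congrArg ULift.up (huniq _ _ _ ?_ ?_)
      · change (n₁ ≫ w W₁ m₁ h₁) ≫ p = (n₂ ≫ w W₂ m₂ h₂) ≫ p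
        rw [Category.assoc, hw, Category.assoc, hw, ← Category.assoc, e, Category.assoc]
      · change F.map (n₁ ≫ w W₁ m₁ h₁).op θ = F.map (n₂ ≫ w W₂ m₂ h₂).op θ
        rw [op_comp, op_comp, Functor.map_comp_apply, Functor.map_comp_apply, hw', hw',
          ← Functor.map_comp_apply, ← Functor.map_comp_apply, ← op_comp, ← op_comp, e]
    let v : V ⟶ P := (hsP.amalgamate x hx).down
    have hv {W : Scheme.{u}} (m : W ⟶ V) (hm : liftSieve p θ b ξ m) : m ≫ v = w W m hm :=
      congrArg ULift.down (hsP.valid_glue hx m hm)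
    refine ⟨v, ?_, hsF.isSeparatedFor.ext fun W m hm => ?_⟩
    · refine congrArg ULift.down (hsS.isSeparatedFor.ext (t₁ := ULift.up (v ≫ p))
        (t₂ := ULift.up b) fun W m hm => congrArg ULift.up ?_)
      change m ≫ v ≫ p = m ≫ b
      rw [← Category.assoc, hv m hm, hw]
    · rw [← Functor.map_comp_apply, ← op_comp, hv m hm, hw']

/-- The scheme `P` over `S'` is glued from copies of `E`, by means of sections `c i` over `E` which
meet each geometric component of the fibers exactly once. -/
structure IsComponentChart {Y S S' E P : Scheme.{u}} {d : ℕ} (g : Y ⟶ S) (s : S' ⟶ S) (p : P ⟶ S')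
    (q : E ⟶ S') (ι : Fin d → (E ⟶ P)) (c : Fin d → (E ⟶ Y)) : Prop where
  etale : Etale p
  etale_cover : Etale q
  surjective : Surjective q
  ι_comp : ∀ i, ι i ≫ p = q
  ι_surjective : ∀ t : P, ∃ i, t ∈ Set.range (ι i)
  comp_eq : ∀ i, c i ≫ g = q ≫ s
  isFrame : ∀ (K : Type u) [Field K] [IsAlgClosed K] (x : Spec (.of K) ⟶ E),
    IsFrame g (x ≫ q ≫ s) fun i => x ≫ c i
  eq_iff : ∀ (K : Type u) [Field K] [IsAlgClosed K] (x x' : Spec (.of K) ⟶ E),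
    x ≫ q = x' ≫ q → ∀ i j, x ≫ ι i = x' ≫ ι j ↔ Rel g (x ≫ c i) (x' ≫ c j)

namespace IsComponentChart

variable {Y S S' E P : Scheme.{u}} {d : ℕ} {g : Y ⟶ S} {s : S' ⟶ S} {p : P ⟶ S'}
  {q : E ⟶ S'} {ι : Fin d → (E ⟶ P)} {c : Fin d → (E ⟶ Y)}

lemma generate_mem (h : IsComponentChart g s p q ι c) :
    Sieve.generate (Presieve.ofArrows (fun _ => E) ι) ∈ Scheme.etaleTopology.{u} P := by
  refine generate_ofArrows_mem_etaleTopology _ h.ι_surjective fun i => ?_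
  have := h.etale
  have : Etale (ι i ≫ p) := by rw [h.ι_comp i]; exact h.etale_cover
  exact .of_comp (ι i) p

lemma exists_lift (h : IsComponentChart g s p q ι c) {K : Type u} [Field K] [IsAlgClosed K]
    (v : Spec (.of K) ⟶ P) : ∃ (i : Fin d) (x : Spec (.of K) ⟶ E), x ≫ ι i = v := by
  obtain ⟨V, m, σ, ⟨_, m', _, ⟨i⟩, rfl⟩, rfl⟩ := exists_lift_of_mem_etaleTopology h.generate_mem v
  exact ⟨i, σ ≫ m', by simp⟩

lemma exists_section [Smooth g] (h : IsComponentChart g s p q ι c) :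
    ∃ θ : (piZero g).obj (op P), ∀ i, (piZero g).map (ι i).op θ = cls g (c i) := by
  have hs := (isSheaf_piZero g).isSheafFor _ h.generate_mem
  rw [Presieve.isSheafFor_arrows_iff] at hs
  refine (hs (fun i => cls g (c i)) fun i j Z a b hab => ?_).exists
  have hq : a ≫ q = b ≫ q := by
    have := congrArg (· ≫ p) hab
    simpa only [Category.assoc, h.ι_comp] using this
  change (piZero g).map a.op (cls g (c i)) = (piZero g).map b.op (cls g (c j))
  rw [map_cls, map_cls, cls_eq_iff, sameComponent_iff]
  refine ⟨?_, fun K _ _ t => ?_⟩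
  · rw [Category.assoc, Category.assoc, h.comp_eq, h.comp_eq, ← Category.assoc, hq, Category.assoc]
  · rw [← Category.assoc, ← Category.assoc, ← h.eq_iff K]
    · simp [hab]
    · simp [hq]

variable {θ : (piZero g).obj (op P)}

lemma piZeroToBase_section (h : IsComponentChart g s p q ι c)
    (hθ : ∀ i, (piZero g).map (ι i).op θ = cls g (c i)) :
    (piZeroToBase g).app (op P) θ = ULift.up (p ≫ s) := by
  have hs := ((isSheaf_iff_isSheaf_of_type _ _).mp (isSheaf_scheme S)).isSheafFor _ h.generate_mem
  refine hs.isSeparatedFor.ext ?_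
  rintro _ _ ⟨i⟩
  have h₁ := NatTrans.naturality_apply (piZeroToBase g) (ι i).op θ
  rw [hθ, piZeroToBase_cls] at h₁
  refine h₁.symm.trans (congrArg ULift.up ?_)
  rw [h.comp_eq, ← h.ι_comp i]
  exact Category.assoc _ _ _

lemma eq_of_map_section_eq [Smooth g] (h : IsComponentChart g s p q ι c)
    (hθ : ∀ i, (piZero g).map (ι i).op θ = cls g (c i)) {V : Scheme.{u}} {v w : V ⟶ P}
    (hvw : v ≫ p = w ≫ p) (hvw' : (piZero g).map v.op θ = (piZero g).map w.op θ) : v = w := by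
  have := h.etale
  refine eq_of_forall_geometricPoint_of_etale p hvw fun K _ _ τ => ?_
  obtain ⟨i, x, hx⟩ := h.exists_lift (τ ≫ v)
  obtain ⟨j, x', hx'⟩ := h.exists_lift (τ ≫ w)
  have h₁ := congrArg ((piZero g).map τ.op) hvw'
  rw [← Functor.map_comp_apply, ← Functor.map_comp_apply, ← op_comp, ← op_comp, ← hx, ← hx',
    op_comp, op_comp, Functor.map_comp_apply, Functor.map_comp_apply, hθ, hθ, map_cls, map_cls,
    cls_eq_iff_rel, ← h.eq_iff] at h₁
  · rw [← hx, ← hx', h₁]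
  · rw [← h.ι_comp i, ← Category.assoc, hx, h.ι_comp i, ← h.ι_comp j, ← Category.assoc x', hx',
      Category.assoc, Category.assoc, hvw]

/-- Étale locally, ξ is the class of some a : W ⟶ Y and the base point lifts to x : W ⟶ E. The open
sets where a shares the component of `x ≫ c i` cover W, and on the i-th one ξ is pulled back from P
along `x ≫ ι i`. -/
lemma liftSieve_mem [Smooth g] (h : IsComponentChart g s p q ι c)
    (hθ : ∀ i, (piZero g).map (ι i).op θ = cls g (c i)) {V : Scheme.{u}} (b : V ⟶ S')
    (ξ : (piZero g).obj (op V)) (hξ : (piZeroToBase g).app (op V) ξ = ULift.up (b ≫ s)) :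
    liftSieve p θ b ξ ∈ Scheme.etaleTopology.{u} V := by
  obtain ⟨R, hR, hR'⟩ := exists_sieve_cls ξ
  have hq : Sieve.generate (Presieve.ofArrows (fun _ : Unit => E) fun _ => q) ∈
      Scheme.etaleTopology.{u} S' :=
    generate_ofArrows_mem_etaleTopology _ (fun x => ⟨(), h.surjective.surj x⟩)
      fun _ => h.etale_cover
  refine Scheme.etaleTopology.{u}.transitive (Scheme.etaleTopology.{u}.intersection_covering hR
    (Scheme.etaleTopology.{u}.pullback_stable b hq)) _ ?_
  rintro W m ⟨hm, _, x, _, ⟨⟩, hx⟩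
  obtain ⟨a, ha⟩ := hR' m hm
  have hag : a ≫ g = x ≫ q ≫ s := by
    have h₁ := NatTrans.naturality_apply (piZeroToBase g) m.op ξ
    rw [ha, piZeroToBase_cls, hξ] at h₁
    have h₂ : a ≫ g = m ≫ b ≫ s := congrArg ULift.down h₁
    rw [h₂, ← Category.assoc x, hx, Category.assoc]
  have hab (i : Fin d) : a ≫ g = (x ≫ c i) ≫ g := by
    rw [hag, Category.assoc, h.comp_eq]
  let O (i : Fin d) : W.Opens := ⟨relLocus g a (x ≫ c i), isOpen_relLocus (hab i)⟩
  refine Scheme.etaleTopology.{u}.superset_covering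
    (S := Sieve.generate (Presieve.ofArrows (fun i => (O i : Scheme.{u})) fun i => (O i).ι)) ?_ ?_
  · rw [Sieve.generate_le_iff]
    rintro _ _ ⟨i⟩
    refine ⟨(O i).ι ≫ x ≫ ι i, by simp [h.ι_comp, hx], ?_⟩
    rw [op_comp, op_comp, Functor.map_comp_apply, Functor.map_comp_apply, hθ, map_cls, map_cls,
      op_comp, Functor.map_comp_apply, ha, map_cls, eq_comm, cls_eq_iff,
      sameComponent_iff_relLocus (by simp only [Category.assoc, hab i]),
      ← preimage_relLocus (hab i)]
    exact Set.eq_univ_of_forall fun t => t.2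
  · refine generate_ofArrows_mem_etaleTopology _ (fun t => ?_) fun i => inferInstance
    obtain ⟨K, _, _, τ, hτ⟩ := exists_geometricPoint t
    obtain ⟨i, hi⟩ := (h.isFrame K (τ ≫ x)).surj (τ ≫ a) (by
      rw [Category.assoc, hag, Category.assoc])
    refine ⟨i, ?_⟩
    rw [Scheme.Opens.range_ι]
    change t ∈ relLocus g a (x ≫ c i)
    rw [← hτ default, mem_relLocus_iff (hab i)]
    simpa using hi

theorem represents [Smooth g] (h : IsComponentChart g s p q ι c)
    (hθ : ∀ i, (piZero g).map (ι i).op θ = cls g (c i)) :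
    Represents (piZeroToBase g) s p θ :=
  .of_liftSieve_mem (isSheaf_piZero g) (h.piZeroToBase_section hθ)
    (fun _ _ _ => h.eq_of_map_section_eq hθ) fun _ => h.liftSieve_mem hθ

end IsComponentChart

/-! ### Affine frames -/

lemma etale_specMap (A B : Type u) [CommRing A] [CommRing B] [Algebra A B] [Algebra.Etale A B] :
    Etale (Spec.map (CommRingCat.ofHom (algebraMap A B))) := by
  rw [HasRingHomProperty.Spec_iff (P := @Etale)]
  exact RingHom.etale_algebraMap.mpr inferInstance

lemma IsFrame.congr {Y S : Scheme.{u}} {g : Y ⟶ S} {ι : Type*} {K : Type u} [Field K]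
    {τ τ' : Spec (.of K) ⟶ S} {c c' : ι → (Spec (.of K) ⟶ Y)} (h : IsFrame g τ c) (hτ : τ' = τ)
    (hc : ∀ i, c' i = c i) : IsFrame g τ' c' := by
  obtain rfl : c' = c := funext hc
  rwa [hτ]

section GluedChart

variable {Y S : Scheme.{u}} {A B : Type u} [CommRing A] [CommRing B] [Algebra A B] {d : ℕ}
  {g : Y ⟶ S} {s : Spec (.of A) ⟶ S} {c : Fin d → (Spec (.of B) ⟶ Y)}

/-- The structure morphism of the glued scheme. -/
def gluedToBase (e : Fin d → Fin d → TensorProduct A B B) :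
    Spec (.of (gluedSubalgebra e)) ⟶ Spec (.of A) :=
  Spec.map (CommRingCat.ofHom (algebraMap A (gluedSubalgebra e)))

/-- The `i`-th chart of the glued scheme. -/
def gluedChart (e : Fin d → Fin d → TensorProduct A B B) (i : Fin d) :
    Spec (.of B) ⟶ Spec (.of (gluedSubalgebra e)) :=
  Spec.map (CommRingCat.ofHom ((Pi.evalRingHom (fun _ : Fin d => B) i).comp
    (gluedSubalgebra e).subtype))

variable [Algebra.Etale A B] [Module.FaithfullyFlat A B] {e : Fin d → Fin d → TensorProduct A B B}

lemma surjective_specMap_of_faithfullyFlat (A B : Type u) [CommRing A] [CommRing B] [Algebra A B]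
    [Module.FaithfullyFlat A B] :
    Surjective (Spec.map (CommRingCat.ofHom (algebraMap A B))) :=
  ⟨PrimeSpectrum.comap_surjective_of_faithfullyFlat⟩

theorem IsIndicator.isComponentChart (he : IsIndicator g c e) (h : IsAffineFrame g s c) :
    IsComponentChart g s (gluedToBase e) (Spec.map (CommRingCat.ofHom (algebraMap A B)))
      (gluedChart e) c where
  etale :=
    have := (he.isGluing h).etale
    etale_specMap A (gluedSubalgebra e)
  etale_cover := etale_specMap A B
  surjective := surjective_specMap_of_faithfullyFlat A B
  ι_comp i := ringHom_comp_specMap_eq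
  ι_surjective t := by
    obtain ⟨K, _, _, τ, hτ⟩ := exists_geometricPoint t
    obtain ⟨φ, rfl⟩ := Spec.map_surjective τ
    have := etale_specMap A B
    have hq := generate_ofArrows_mem_etaleTopology (fun _ : Unit =>
      Spec.map (CommRingCat.ofHom (algebraMap A B)))
      (fun x => ⟨(), (surjective_specMap_of_faithfullyFlat A B).surj x⟩) fun _ => this
    -- The geometric point is first lifted to Spec B on the base; `IsGluing.exists_eq` then says on
    -- which chart it lies.
    obtain ⟨V, m, σ, ⟨_, m', _, ⟨⟩, hm⟩, hσ⟩ :=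
      exists_lift_of_mem_etaleTopology hq (Spec.map φ ≫ gluedToBase e)
    obtain ⟨x, hx⟩ := Spec.map_surjective (σ ≫ m')
    have hx' : x.hom.comp (algebraMap A B) =
        φ.hom.comp (algebraMap A (gluedSubalgebra e)) := by
      have : CommRingCat.ofHom (algebraMap A B) ≫ x =
          CommRingCat.ofHom (algebraMap A (gluedSubalgebra e)) ≫ φ := by
        apply Spec.map_injective
        rw [Spec.map_comp, Spec.map_comp, hx, Category.assoc, hm, hσ]
        rfl
      exact congrArg CommRingCat.Hom.hom this
    obtain ⟨i, hi⟩ := (he.isGluing h).exists_eq φ.hom x.hom hx'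
    refine ⟨i, Spec.map x default, ?_⟩
    have : CommRingCat.ofHom ((Pi.evalRingHom (fun _ : Fin d => B) i).comp
        (gluedSubalgebra e).subtype) ≫ x = φ := by
      ext b
      exact (hi b).symm
    rw [← hτ default, ← Scheme.Hom.comp_apply, gluedChart, ← Spec.map_comp, this]
  comp_eq := h.comp_eq
  isFrame := h.isFrame
  eq_iff K _ _ x x' hxx i j := by
    obtain ⟨x, rfl⟩ := Spec.map_surjective x
    obtain ⟨x', rfl⟩ := Spec.map_surjective x'
    rw [← Spec.map_comp, ← Spec.map_comp] at hxx
    have hx : x.hom.comp (algebraMap A B) = x'.hom.comp (algebraMap A B) :=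
      congrArg CommRingCat.Hom.hom (Spec.map_injective hxx)
    refine Iff.trans ?_ (he.forall_eq_iff h hx i j)
    rw [gluedChart, gluedChart, ← Spec.map_comp, ← Spec.map_comp]
    refine ⟨fun heq b => ?_, fun heq => ?_⟩
    · exact congrArg (fun m => CommRingCat.Hom.hom m b) (Spec.map_injective heq)
    · congr 1
      ext b
      exact heq b

theorem IsAffineFrame.exists_represents [Smooth g] (h : IsAffineFrame g s c) :
    ∃ (P : Scheme.{u}) (p : P ⟶ Spec (.of A)) (θ : (piZero g).obj (op P)),
      finiteEtaleOfDegree d p ∧ Represents (piZeroToBase g) s p θ := by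
  obtain ⟨e, he⟩ := h.exists_isIndicator
  have hch := he.isComponentChart h
  obtain ⟨θ, hθ⟩ := hch.exists_section
  have hfin := (he.isGluing h).finite
  have het := (he.isGluing h).etale
  refine ⟨_, gluedToBase e, θ, ⟨?_, hch.etale, fun t => ?_⟩, hch.represents hθ⟩
  · rw [gluedToBase, IsFinite.SpecMap_iff]
    exact RingHom.finite_algebraMap.mpr hfin
  · exact (Scheme.Hom.finrank_SpecMap_algebraMap A (gluedSubalgebra e) t).trans
      ((he.isGluing h).rankAtStalk t)

end GluedChart

/-- Étale neighborhoods can be shrunk to affine étale covers of affine open subschemes. -/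
lemma exists_affine_etale_cover {E S : Scheme.{u}} (q : E ⟶ S) [Etale q] {s : S}
    (hs : s ∈ Set.range q) :
    ∃ (A B : Type u) (_ : CommRing A) (_ : CommRing B) (_ : Algebra A B) (i : Spec (.of A) ⟶ S)
      (j : Spec (.of B) ⟶ E), IsOpenImmersion i ∧ s ∈ Set.range i ∧ Algebra.Etale A B ∧
      Module.FaithfullyFlat A B ∧
      j ≫ q = Spec.map (CommRingCat.ofHom (algebraMap A B)) ≫ i := by
  obtain ⟨t, ht⟩ := hs
  obtain ⟨R, i₀, _, r₀, hr₀⟩ := Scheme.exists_Spec_apply_eq s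
  obtain ⟨t', ht', ht''⟩ := Scheme.Pullback.exists_preimage_pullback (f := q) (g := i₀) t r₀
    (ht.trans hr₀.symm)
  obtain ⟨B₀, j₀, _, b₀, hb₀⟩ := Scheme.exists_Spec_apply_eq t'
  obtain ⟨φ, hφ⟩ := Spec.map_surjective (j₀ ≫ pullback.snd q i₀)
  have het : Etale (Spec.map φ) := by rw [hφ]; infer_instance
  have hopen : IsOpen (Set.range (Spec.map φ)) := (Spec.map φ).isOpenMap.isOpen_range
  have hmem : r₀ ∈ Set.range (Spec.map φ) := ⟨b₀, by
    rw [hφ, Scheme.Hom.comp_apply, hb₀, ht'']⟩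
  -- Shrinking the base to a basic open set inside the open image makes the étale map surjective,
  -- hence faithfully flat.
  obtain ⟨_, ⟨r, rfl⟩, hr, hr'⟩ :=
    PrimeSpectrum.isTopologicalBasis_basic_opens.exists_subset_of_mem_open hmem hopen
  let := φ.hom.toAlgebra
  have : Algebra.Etale R B₀ := by
    rw [HasRingHomProperty.Spec_iff (P := @Etale)] at het
    exact RingHom.etale_algebraMap.mp het
  let A := Localization.Away r
  have hpb := isPullback_SpecMap_of_isPushout _ _ _ _
    (CommRingCat.isPushout_tensorProduct R A B₀)
  have hrange : Set.range (Spec.map (CommRingCat.ofHom (algebraMap R A))) =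
      (PrimeSpectrum.basicOpen r : Set (PrimeSpectrum R)) :=
    PrimeSpectrum.localization_away_comap_range A r
  have : IsOpenImmersion (Spec.map (CommRingCat.ofHom (algebraMap R A))) :=
    IsOpenImmersion.of_isLocalization r
  refine ⟨A, TensorProduct R A B₀, inferInstance, inferInstance, inferInstance,
    Spec.map (CommRingCat.ofHom (algebraMap R A)) ≫ i₀,
    Spec.map (CommRingCat.ofHom (Algebra.TensorProduct.includeRight.toRingHom)) ≫ j₀ ≫
      pullback.fst q i₀, inferInstance, ?_, inferInstance, ?_, ?_⟩
  · obtain ⟨a, ha⟩ : r₀ ∈ Set.range (Spec.map (CommRingCat.ofHom (algebraMap R A))) := by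
      rw [hrange]; exact hr
    exact ⟨a, by rw [Scheme.Hom.comp_apply, ha, hr₀]⟩
  · refine .of_comap_surjective fun a => ?_
    obtain ⟨b, hb⟩ := hr' (hrange.subset ⟨a, rfl⟩)
    obtain ⟨z, hz, -⟩ := Scheme.exists_preimage_of_isPullback hpb a b hb.symm
    exact ⟨z, hz⟩
  · have h₁ := hpb.w
    rw [Category.assoc, Category.assoc, pullback.condition, ← Category.assoc j₀, ← hφ]
    have h₂ := congrArg (· ≫ i₀) h₁
    simp only [Category.assoc] at h₂
    exact h₂.symm

theorem IsSmoothDense.exists_represents {X Y S : Scheme.{u}} {f : X ⟶ S} {j : Y ⟶ X}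
    (h : IsSmoothDense f j) {d : ℕ}
    (hd : ∀ (K : Type u) [Field K] [IsAlgClosed K] (τ : Spec (.of K) ⟶ S),
      (irreducibleComponents ↥(pullback f τ)).encard = d) (s : S) :
    ∃ (S' P : Scheme.{u}) (i : S' ⟶ S) (p : P ⟶ S') (θ : (piZero (j ≫ f)).obj (op P)),
      IsOpenImmersion i ∧ s ∈ Set.range i ∧ finiteEtaleOfDegree d p ∧
      Represents (piZeroToBase (j ≫ f)) i p θ := by
  have := h.smooth
  obtain ⟨E, q, c, _, hs, hc, hfr⟩ := h.exists_etale_frame hd s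
  obtain ⟨A, B, _, _, _, i, k, hi, hsi, _, _, hk⟩ := exists_affine_etale_cover q hs
  have hfr' : IsAffineFrame (j ≫ f) i fun n => k ≫ c n :=
    { comp_eq := fun n => by rw [Category.assoc, hc, hk]
      isFrame := fun K _ _ x => (hfr K (x ≫ k)).congr (by rw [Category.assoc, hk])
        fun n => (Category.assoc _ _ _).symm }
  obtain ⟨P, p, θ, hp, hθ⟩ := hfr'.exists_represents
  exact ⟨_, P, i, p, θ, hi, hsi, hp, hθ⟩

/-! ### Gluing of local representations -/

lemma app_map_eq_up {F : PSh.{u}} {S U V : Scheme.{u}} (φ : F ⟶ uliftYoneda.{u + 1}.obj S)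
    {ξ : F.obj (op U)} {a : U ⟶ S} (h : φ.app (op U) ξ = ULift.up a) (v : V ⟶ U) :
    φ.app (op V) (F.map v.op ξ) = ULift.up (v ≫ a) := by
  rw [NatTrans.naturality_apply, h]
  rfl

namespace Represents

variable {F : PSh.{u}} {S S' P : Scheme.{u}} {φ : F ⟶ uliftYoneda.{u + 1}.obj S}
  {s : S' ⟶ S} {p : P ⟶ S'} {θ : F.obj (op P)}

lemma hom_ext (h : Represents φ s p θ) {V : Scheme.{u}} {v w : V ⟶ P} (h₁ : v ≫ p = w ≫ p)
    (h₂ : F.map v.op θ = F.map w.op θ) : v = w :=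
  (h.existsUnique (v ≫ p) (F.map v.op θ)
    (by rw [app_map_eq_up φ h.app_eq, Category.assoc])).unique ⟨rfl, rfl⟩ ⟨h₁.symm, h₂.symm⟩

lemma of_isPullback (h : Represents φ s p θ) {S'' P' : Scheme.{u}} {m : S'' ⟶ S'} {p' : P' ⟶ S''}
    {v : P' ⟶ P} (hpb : IsPullback v p' p m) : Represents φ (m ≫ s) p' (F.map v.op θ) where
  app_eq := by
    rw [app_map_eq_up φ h.app_eq, ← Category.assoc, hpb.w, Category.assoc]
  existsUnique V b ξ hξ := by
    obtain ⟨w, ⟨hw, hw'⟩, huniq⟩ := h.existsUnique (b ≫ m) ξ (by rw [hξ, Category.assoc])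
    refine ⟨hpb.lift w b hw, ⟨hpb.lift_snd _ _ _, ?_⟩, fun w' ⟨h₁, h₂⟩ => ?_⟩
    · rw [← Functor.map_comp_apply, ← op_comp, hpb.lift_fst, hw']
    · refine hpb.hom_ext ?_ ?_
      · rw [hpb.lift_fst]
        refine huniq _ ⟨?_, ?_⟩
        · rw [Category.assoc, hpb.w, ← Category.assoc, h₁]
        · rw [op_comp, Functor.map_comp_apply, h₂]
      · rw [hpb.lift_snd, h₁]

lemma isPullback (h : Represents φ s p θ) {S'' P' : Scheme.{u}} {m : S'' ⟶ S'} {p' : P' ⟶ S''}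
    {θ' : F.obj (op P')} (h' : Represents φ (m ≫ s) p' θ') {v : P' ⟶ P} (hv : v ≫ p = p' ≫ m)
    (hθ : F.map v.op θ = θ') : IsPullback v p' p m := by
  refine ⟨⟨hv⟩, ⟨PullbackCone.IsLimit.mk _ (fun t => (h'.existsUnique t.snd (F.map t.fst.op θ)
    ?_).choose) ?_ ?_ ?_⟩⟩
  · rw [app_map_eq_up φ h.app_eq, ← Category.assoc, t.condition, Category.assoc]
  all_goals intro t
  · have ht := (h'.existsUnique t.snd (F.map t.fst.op θ) (by
      rw [app_map_eq_up φ h.app_eq, ← Category.assoc, t.condition, Category.assoc])).choose_spec.1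
    refine h.hom_ext ?_ ?_
    · rw [Category.assoc, hv, ← Category.assoc, ht.1, t.condition]
    · rw [op_comp, Functor.map_comp_apply, hθ, ht.2]
  · exact (h'.existsUnique t.snd (F.map t.fst.op θ) (by
      rw [app_map_eq_up φ h.app_eq, ← Category.assoc, t.condition, Category.assoc])).choose_spec.1.1
  · intro w h₁ h₂
    refine (h'.existsUnique t.snd (F.map t.fst.op θ) (by
      rw [app_map_eq_up φ h.app_eq, ← Category.assoc, t.condition,
        Category.assoc])).choose_spec.2 _ ⟨h₂, ?_⟩
    rw [← hθ, ← Functor.map_comp_apply, ← op_comp, h₁]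

end Represents

instance (d : ℕ) : (finiteEtaleOfDegree.{u} d).IsStableUnderBaseChange where
  of_isPullback {X Y Y' S f g f' g'} h hf := by
    obtain ⟨h₁, h₂, h₃⟩ := hf
    refine ⟨MorphismProperty.of_isPullback h h₁, MorphismProperty.of_isPullback h h₂, fun s => ?_⟩
    rw [Scheme.Hom.finrank_of_isPullback _ _ _ _ h, h₃]

/-- By the Yoneda lemma θ is a morphism from P to F, and the universal property makes it an
isomorphism over S. -/
theorem Represents.isFiniteEtaleOfDegree {F : PSh.{u}} {S P : Scheme.{u}}
    {φ : F ⟶ uliftYoneda.{u + 1}.obj S} {p : P ⟶ S} {θ : F.obj (op P)}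
    (h : Represents φ (𝟙 S) p θ) {d : ℕ} (hp : finiteEtaleOfDegree d p) :
    IsFiniteEtaleOfDegree φ d := by
  let t : uliftYoneda.{u + 1}.obj P ⟶ F := uliftYonedaEquiv.symm θ
  have ht (V : Scheme.{u}) (v : V ⟶ P) : t.app (op V) (ULift.up v) = F.map v.op θ := rfl
  have htφ : t ≫ φ = uliftYoneda.{u + 1}.map p := by
    ext ⟨V⟩ ⟨v⟩
    have := app_map_eq_up φ h.app_eq v
    rw [Category.comp_id] at this
    exact this
  have : IsIso t := by
    rw [NatTrans.isIso_iff_isIso_app]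
    rintro ⟨V⟩
    rw [isIso_iff_bijective]
    refine ⟨?_, fun ξ => ?_⟩
    · rintro ⟨v⟩ ⟨w⟩ hvw
      have hvw' : F.map v.op θ = F.map w.op θ := hvw
      refine congrArg ULift.up (h.hom_ext ?_ hvw')
      have h₁ := congrArg (φ.app _) hvw'
      rw [app_map_eq_up φ h.app_eq, app_map_eq_up φ h.app_eq] at h₁
      simpa using congrArg ULift.down h₁
    · obtain ⟨v, ⟨-, hv⟩, -⟩ := h.existsUnique (φ.app _ ξ).down ξ (by
        rw [Category.comp_id])
      exact ⟨ULift.up v, hv⟩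
  refine (MorphismProperty.cancel_left_of_respectsIso
    ((finiteEtaleOfDegree.{u} d).relative uliftYoneda.{u + 1}) t φ).mp ?_
  rw [htφ]
  exact MorphismProperty.relative_map hp

section Gluing

variable {F : PSh.{u}} {S : Scheme.{u}} {φ : F ⟶ uliftYoneda.{u + 1}.obj S}
  {𝒰 : S.OpenCover} [Category 𝒰.I₀] [𝒰.LocallyDirected]
  {P : 𝒰.I₀ → Scheme.{u}} {p : ∀ i, P i ⟶ 𝒰.X i} {θ : ∀ i, F.obj (op (P i))}

section Transition

lemma existsUnique_transition (h : ∀ i, Represents φ (𝒰.f i) (p i) (θ i)) {i j : 𝒰.I₀} (hij : i ⟶ j) :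
    ∃! v : P i ⟶ P j, v ≫ p j = p i ≫ 𝒰.trans hij ∧ F.map v.op (θ j) = θ i := by
  refine (h j).existsUnique _ _ ?_
  rw [(h i).app_eq, Category.assoc, 𝒰.trans_map hij]

variable (h : ∀ i, Represents φ (𝒰.f i) (p i) (θ i))

/-- The transition maps between representing schemes. -/
def repTransition {i j : 𝒰.I₀} (hij : i ⟶ j) : P i ⟶ P j :=
  (existsUnique_transition h hij).choose

lemma repTransition_comp {i j : 𝒰.I₀} (hij : i ⟶ j) :
    repTransition h hij ≫ p j = p i ≫ 𝒰.trans hij :=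
  (existsUnique_transition h hij).choose_spec.1.1

lemma map_repTransition {i j : 𝒰.I₀} (hij : i ⟶ j) :
    F.map (repTransition h hij).op (θ j) = θ i :=
  (existsUnique_transition h hij).choose_spec.1.2

/-- The gluing datum given by the representing schemes. -/
def repGluingData : 𝒰.RelativeGluingData where
  functor :=
    { obj := P
      map := fun hij => repTransition h hij
      map_id := fun i => by
        refine (h i).hom_ext ?_ ?_
        · rw [repTransition_comp, 𝒰.trans_id, Category.comp_id, Category.id_comp]
        · rw [map_repTransition]
          simp
      map_comp := fun {i j k} hij hjk => by
        refine (h k).hom_ext ?_ ?_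
        · rw [repTransition_comp, Category.assoc, repTransition_comp, ← Category.assoc,
            repTransition_comp, Category.assoc, 𝒰.trans_comp]
        · rw [map_repTransition, op_comp, Functor.map_comp_apply, map_repTransition,
            map_repTransition] }
  natTrans :=
    { app := p
      naturality := fun i j hij => repTransition_comp h hij }
  equifibered := by
    intro i j hij
    refine (h j).isPullback ?_ (repTransition_comp h hij) (map_repTransition h hij)
    have := h i
    rwa [← 𝒰.trans_map hij] at this

variable [Small.{u} 𝒰.I₀] [Quiver.IsThin 𝒰.I₀]

/-- The glued scheme. -/
def repGlued : Scheme.{u} := (repGluingData h).glued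

/-- The structure morphism of the glued scheme. -/
def repGluedToBase : repGlued h ⟶ S := (repGluingData h).toBase

/-- The inclusions of the pieces of the glued scheme. -/
def repGluedι (i : 𝒰.I₀) : P i ⟶ repGlued h := colimit.ι (repGluingData h).functor i

lemma isPullback_repGluedι (i : 𝒰.I₀) :
    IsPullback (repGluedι h i) (p i) (repGluedToBase h) (𝒰.f i) :=
  ((repGluingData h).isPullback_natTrans_ι_toBase i).flip

instance (i : 𝒰.I₀) : IsOpenImmersion (repGluedι h i) :=
  MorphismProperty.of_isPullback (isPullback_repGluedι h i).flip inferInstance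

lemma repTransition_repGluedι {i j : 𝒰.I₀} (hij : i ⟶ j) :
    repTransition h hij ≫ repGluedι h j = repGluedι h i :=
  colimit.w (repGluingData h).functor hij

lemma exists_mem_range_repGluedι (t : repGlued h) : ∃ i, t ∈ Set.range (repGluedι h i) := by
  obtain ⟨x, hx⟩ := 𝒰.covers (repGluedToBase h t)
  obtain ⟨z, hz, -⟩ := Scheme.exists_preimage_of_isPullback (isPullback_repGluedι h _) t x hx.symm
  exact ⟨_, z, hz⟩

/-- Where two pieces overlap, both sections are restrictions of the one over a third member of the
cover containing the intersection; `hinf` provides that member. -/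
lemma exists_section_repGlued (hF : Presieve.IsSheaf Scheme.etaleTopology.{u} F)
    (hinf : ∀ i j : 𝒰.I₀, ∃ (k : 𝒰.I₀) (_ : k ⟶ i) (_ : k ⟶ j),
      Set.range (𝒰.f i) ∩ Set.range (𝒰.f j) ⊆ Set.range (𝒰.f k)) :
    ∃ θ' : F.obj (op (repGlued h)), ∀ i, F.map (repGluedι h i).op θ' = θ i := by
  have hs := hF.isSheafFor _ (generate_ofArrows_mem_etaleTopology (repGluedι h)
    (exists_mem_range_repGluedι h) fun i => inferInstance)
  rw [Presieve.isSheafFor_arrows_iff] at hs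
  refine (hs θ fun i j Z a b hab => ?_).exists
  obtain ⟨k, ki, kj, hk⟩ := hinf i j
  have hZ : (a ≫ p i) ≫ 𝒰.f i = (b ≫ p j) ≫ 𝒰.f j := by
    have := congrArg (· ≫ repGluedToBase h) hab
    simp only [Category.assoc, (isPullback_repGluedι h _).w] at this
    simpa only [Category.assoc] using this
  let z : Z ⟶ 𝒰.X k := IsOpenImmersion.lift (𝒰.f k) ((a ≫ p i) ≫ 𝒰.f i) <| by
    rintro _ ⟨t, rfl⟩
    refine hk ⟨⟨(a ≫ p i) t, rfl⟩, ?_⟩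
    rw [hZ]
    exact ⟨(b ≫ p j) t, rfl⟩
  have hz : z ≫ 𝒰.f k = (a ≫ p i) ≫ 𝒰.f i := IsOpenImmersion.lift_fac _ _ _
  have key {l : 𝒰.I₀} (kl : k ⟶ l) (e : Z ⟶ P l) (he : (e ≫ p l) ≫ 𝒰.f l = z ≫ 𝒰.f k) :
      ∃ e' : Z ⟶ P k, e' ≫ repTransition h kl = e := by
    have hpb : IsPullback (repTransition h kl) (p k) (p l) (𝒰.trans kl) :=
      (repGluingData h).equifibered kl
    refine ⟨hpb.lift e z ?_, hpb.lift_fst _ _ _⟩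
    rw [← cancel_mono (𝒰.f l), he, Category.assoc, 𝒰.trans_map]
  obtain ⟨a', rfl⟩ := key ki a hz.symm
  obtain ⟨b', rfl⟩ := key kj b (hZ.symm.trans hz.symm)
  have hab' : a' = b' := by
    rw [Category.assoc, Category.assoc, repTransition_repGluedι, repTransition_repGluedι] at hab
    exact (cancel_mono _).mp hab
  change F.map (a' ≫ _).op (θ i) = F.map (b' ≫ _).op (θ j)
  rw [op_comp, op_comp, Functor.map_comp_apply, Functor.map_comp_apply, map_repTransition,
    map_repTransition, hab']

theorem represents_repGlued (hF : Presieve.IsSheaf Scheme.etaleTopology.{u} F)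
    {θ' : F.obj (op (repGlued h))} (hθ' : ∀ i, F.map (repGluedι h i).op θ' = θ i) :
    Represents φ (𝟙 S) (repGluedToBase h) θ' := by
  have hcov := generate_ofArrows_mem_etaleTopology (repGluedι h)
    (exists_mem_range_repGluedι h) fun i => inferInstance
  have hbase : φ.app (op (repGlued h)) θ' = ULift.up (repGluedToBase h ≫ 𝟙 S) := by
    have hs := ((isSheaf_iff_isSheaf_of_type _ _).mp (isSheaf_scheme S)).isSheafFor _ hcov
    refine hs.isSeparatedFor.ext ?_
    rintro _ _ ⟨i⟩
    have h₁ := NatTrans.naturality_apply φ (repGluedι h i).op θ'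
    rw [hθ', (h i).app_eq] at h₁
    refine h₁.symm.trans (congrArg ULift.up ?_)
    rw [← (isPullback_repGluedι h i).w, Category.comp_id]
    rfl
  have hpull {V : Scheme.{u}} (b : V ⟶ S) :
      Sieve.generate (Presieve.ofArrows (fun i => pullback b (𝒰.f i))
        fun i => pullback.fst b (𝒰.f i)) ∈ Scheme.etaleTopology.{u} V := by
    refine generate_ofArrows_mem_etaleTopology _ (fun x => ?_) fun i => inferInstance
    obtain ⟨y, hy⟩ := 𝒰.covers (b x)
    obtain ⟨z, hz, -⟩ := Scheme.Pullback.exists_preimage_pullback x y hy.symm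
    exact ⟨_, z, hz⟩
  refine .of_liftSieve_mem hF hbase (fun V v w h₁ h₂ => ?_) fun V b ξ hξ => ?_
  · have hs := ((isSheaf_iff_isSheaf_of_type _ _).mp (isSheaf_scheme (repGlued h))).isSheafFor _
      (hpull (v ≫ repGluedToBase h))
    refine congrArg ULift.down (hs.isSeparatedFor.ext (t₁ := ULift.up v) (t₂ := ULift.up w) ?_)
    rintro _ _ ⟨i⟩
    refine congrArg ULift.up ?_
    let m := pullback.fst (v ≫ repGluedToBase h) (𝒰.f i)
    let n := pullback.snd (v ≫ repGluedToBase h) (𝒰.f i)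
    change m ≫ v = m ≫ w
    have hm : (m ≫ v) ≫ repGluedToBase h = n ≫ 𝒰.f i := by
      rw [Category.assoc]; exact pullback.condition
    have hm' : (m ≫ w) ≫ repGluedToBase h = n ≫ 𝒰.f i := by
      rw [Category.assoc, ← h₁, ← Category.assoc, hm]
    have hpb := isPullback_repGluedι h i
    rw [← hpb.lift_fst _ _ hm, ← hpb.lift_fst _ _ hm']
    congr 1
    refine (h i).hom_ext (by rw [hpb.lift_snd, hpb.lift_snd]) ?_
    rw [← hθ', ← Functor.map_comp_apply, ← Functor.map_comp_apply, ← op_comp, ← op_comp,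
      hpb.lift_fst, hpb.lift_fst, op_comp, op_comp, Functor.map_comp_apply, Functor.map_comp_apply,
      h₂]
  · refine Scheme.etaleTopology.{u}.superset_covering ?_ (hpull b)
    rw [Sieve.generate_le_iff]
    rintro _ _ ⟨i⟩
    obtain ⟨v, ⟨hv, hv'⟩, -⟩ := (h i).existsUnique (pullback.snd b (𝒰.f i))
      (F.map (pullback.fst b (𝒰.f i)).op ξ) (by
        rw [app_map_eq_up φ hξ, Category.comp_id, pullback.condition])
    refine ⟨v ≫ repGluedι h i, ?_, ?_⟩
    · rw [Category.assoc, (isPullback_repGluedι h i).w, ← Category.assoc, hv, pullback.condition]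
    · rw [op_comp, Functor.map_comp_apply, hθ', hv']

lemma prop_repGluedToBase (Q : MorphismProperty Scheme.{u}) [IsZariskiLocalAtTarget Q]
    (hp : ∀ i, Q (p i)) : Q (repGluedToBase h) := by
  rw [IsZariskiLocalAtTarget.iff_of_openCover (P := Q) 𝒰]
  intro i
  refine (MorphismProperty.arrow_mk_iso_iff Q ?_).mp (hp i)
  exact Arrow.isoMk (isPullback_repGluedι h i).isoPullback (Iso.refl _)
    (((isPullback_repGluedι h i).isoPullback_hom_snd).trans (Category.comp_id _).symm)

lemma finiteEtaleOfDegree_repGluedToBase {d : ℕ} (hp : ∀ i, finiteEtaleOfDegree d (p i)) :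
    finiteEtaleOfDegree d (repGluedToBase h) := by
  have h₁ : IsFinite (repGluedToBase h) :=
    have : IsZariskiLocalAtTarget @IsFinite.{u} :=
      @HasAffineProperty.instIsZariskiLocalAtTarget _ _
        IsFinite.instHasAffinePropertyAndIsAffineFiniteCarrierObjOppositeOpensCarrierCarrierCommRingCatPresheafOpOpensTopHomAppTop
    prop_repGluedToBase h @IsFinite.{u} fun i => (hp i).1
  have h₂ : Etale (repGluedToBase h) :=
    have : IsZariskiLocalAtTarget @Etale.{u} := HasRingHomProperty.instIsZariskiLocalAtTarget _
    prop_repGluedToBase h @Etale.{u} fun i => (hp i).2.1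
  refine ⟨h₁, h₂, fun s => ?_⟩
  obtain ⟨x, hx⟩ := 𝒰.covers s
  rw [← hx, ← Scheme.Hom.finrank_of_isPullback _ _ _ _ (isPullback_repGluedι h _)]
  exact (hp _).2.2 x

end Transition

end Gluing

/-! ### The cover by representable open subsets -/

section RepresentableCover

variable {F : PSh.{u}} {S : Scheme.{u}} (φ : F ⟶ uliftYoneda.{u + 1}.obj S)
  (Q : MorphismProperty Scheme.{u})

/-- Over the open subset `U`, the space `F` is represented by a scheme with property `Q`. -/
def IsRepresentableOver (U : S.Opens) : Prop :=
  ∃ (P : Scheme.{u}) (p : P ⟶ U) (θ : F.obj (op P)), Q p ∧ Represents φ U.ι p θ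

variable {φ Q}

lemma Represents.isRepresentableOver [Q.IsStableUnderBaseChange] {S' P : Scheme.{u}} {i : S' ⟶ S}
    [IsOpenImmersion i] {p : P ⟶ S'} {θ : F.obj (op P)} (h : Represents φ i p θ) (hp : Q p)
    {U : S.Opens} (hU : (U : Set S) ⊆ Set.range i) : IsRepresentableOver φ Q U := by
  let m : (U : Scheme.{u}) ⟶ S' := IsOpenImmersion.lift i U.ι (by simpa using hU)
  have hm : m ≫ i = U.ι := IsOpenImmersion.lift_fac _ _ _
  have hpb := IsPullback.of_hasPullback p m
  have h' := h.of_isPullback hpb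
  rw [hm] at h'
  exact ⟨_, _, _, Q.of_isPullback hpb hp, h'⟩

lemma IsRepresentableOver.mono [Q.IsStableUnderBaseChange] {U V : S.Opens}
    (h : IsRepresentableOver φ Q U) (hVU : V ≤ U) : IsRepresentableOver φ Q V := by
  obtain ⟨P, p, θ, hp, hθ⟩ := h
  exact hθ.isRepresentableOver hp (by simpa using hVU)

/-- The cover by open subsets over which `F` is represented by a scheme. -/
def representableCover (hc : ∀ s : S, ∃ U, s ∈ U ∧ IsRepresentableOver φ Q U) : S.OpenCover where
  I₀ := {U : S.Opens // IsRepresentableOver φ Q U}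
  X U := U.1
  f U := U.1.ι
  mem₀ := by
    rw [Scheme.presieve₀_mem_precoverage_iff]
    refine ⟨fun s => ?_, inferInstance⟩
    obtain ⟨U, hs, hU⟩ := hc s
    exact ⟨⟨U, hU⟩, by simpa using hs⟩

variable (hc : ∀ s : S, ∃ U, s ∈ U ∧ IsRepresentableOver φ Q U)

instance : Preorder (representableCover hc).I₀ :=
  inferInstanceAs <| Preorder {U : S.Opens // IsRepresentableOver φ Q U}

variable [Q.IsStableUnderBaseChange]

instance : (representableCover hc).LocallyDirected :=
  .ofIsBasisOpensRange (fun {i j} => by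
      have (k : (representableCover hc).I₀) : ((representableCover hc).f k).opensRange = k.1 := Scheme.Opens.opensRange_ι _
      rw [this, this]; rfl) <| by
    rw [TopologicalSpace.Opens.isBasis_iff_nbhd]
    intro U x hx
    obtain ⟨V, hxV, hV⟩ := hc x
    exact ⟨U ⊓ V, ⟨⟨U ⊓ V, hV.mono inf_le_right⟩, Scheme.Opens.opensRange_ι _⟩, ⟨hx, hxV⟩,
      inf_le_left⟩

end RepresentableCover

/-- Representability passes to smaller open sets, so all representable opens together form a cover
closed under intersection. The representing schemes have unique transition maps over it and glue
without further choices. -/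
theorem isFiniteEtaleOfDegree_of_locally {F : PSh.{u}} {S : Scheme.{u}}
    (φ : F ⟶ uliftYoneda.{u + 1}.obj S) (hF : Presieve.IsSheaf Scheme.etaleTopology.{u} F) (d : ℕ)
    (h : ∀ s : S, ∃ (S' P : Scheme.{u}) (i : S' ⟶ S) (p : P ⟶ S') (θ : F.obj (op P)),
      IsOpenImmersion i ∧ s ∈ Set.range i ∧ finiteEtaleOfDegree d p ∧ Represents φ i p θ) :
    IsFiniteEtaleOfDegree φ d := by
  have hc (s : S) : ∃ U, s ∈ U ∧ IsRepresentableOver φ (finiteEtaleOfDegree d) U := by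
    obtain ⟨S', P, i, p, θ, hi, hs, hp, hθ⟩ := h s
    exact ⟨i.opensRange, hs, hθ.isRepresentableOver hp subset_rfl⟩
  have hrep (U : (representableCover hc).I₀) : ∃ (P : Scheme.{u})
      (p : P ⟶ (representableCover hc).X U) (θ : F.obj (op P)), finiteEtaleOfDegree d p ∧
      Represents φ ((representableCover hc).f U) p θ := U.2
  choose P p θ hp hθ using hrep
  have : Small.{u} (representableCover hc).I₀ :=
    inferInstanceAs (Small.{u} {U : S.Opens // IsRepresentableOver φ (finiteEtaleOfDegree d) U})
  obtain ⟨θ', hθ'⟩ := exists_section_repGlued hθ hF fun U V =>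
    ⟨⟨U.1 ⊓ V.1, U.2.mono inf_le_left⟩, homOfLE (inf_le_left : U.1 ⊓ V.1 ≤ U.1),
      homOfLE (inf_le_right : U.1 ⊓ V.1 ≤ V.1), by
        rintro s ⟨⟨x, rfl⟩, ⟨y, hy⟩⟩
        exact ⟨⟨U.1.ι x, x.2, Set.mem_of_eq_of_mem hy.symm y.2⟩, rfl⟩⟩
  exact (represents_repGlued hθ hF hθ').isFiniteEtaleOfDegree
    (finiteEtaleOfDegree_repGluedToBase hθ hp)

theorem IsSmoothDense.isFiniteEtaleOfDegree {X Y S : Scheme.{u}} {f : X ⟶ S} {j : Y ⟶ X}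
    (h : IsSmoothDense f j) {d : ℕ}
    (hd : ∀ (K : Type u) [Field K] [IsAlgClosed K] (τ : Spec (.of K) ⟶ S),
      (irreducibleComponents ↥(pullback f τ)).encard = d) :
    IsFiniteEtaleOfDegree (piZeroToBase (j ≫ f)) d :=
  isFiniteEtaleOfDegree_of_locally _ (isSheaf_piZero _) d (h.exists_represents hd)

lemma isSmoothDense_smoothLocus {X S : Scheme.{u}} (f : X ⟶ S)
    [IsProper f] [Flat f] [LocallyOfFinitePresentation f]
    (hdim : ∀ s : S, IsPureDimensional (f.fiber s))
    (hsm : ∀ s : S, Dense ((f.fiberToSpecResidueField s).smoothLocus : Set (f.fiber s))) :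
    IsSmoothDense f f.smoothLocus.ι where
  universallyClosed := inferInstance
  locallyOfFiniteType := inferInstance
  isOpenImmersion := inferInstance
  smooth := smooth_smoothLocus_ι_comp f
  dense s := by
    rw [Scheme.Opens.range_ι]
    exact fiberDense_smoothLocus f (hsm s)
  dim s := by
    obtain ⟨n, hn⟩ := exists_forall_hasRelDim f s (hdim s)
    exact ⟨n, fun y hy => hn _ y.2 hy⟩

end ComponentsInFamilies

end

open ComponentsInFamilies in
theorem lemma2p9 {X S : Scheme.{u}} (f : X ⟶ S)
    [IsProper f] [Flat f] [LocallyOfFinitePresentation f]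
    (hdim : ∀ s : S, IsPureDimensional (f.fiber s))
    (hsm : ∀ s : S, Dense ((f.fiberToSpecResidueField s).smoothLocus : Set (f.fiber s))) :
    IsUniversallyClosed (piZeroToBase (smoothPart f)) ∧
      ∀ d : ℕ,
        (∀ (K : Type u) [Field K] [IsAlgClosed K] (s : Spec (.of K) ⟶ S),
          (irreducibleComponents ↥(pullback f s)).encard = d) →
        IsFiniteEtaleOfDegree (piZeroToBase (smoothPart f)) d := by
  have h := isSmoothDense_smoothLocus f hdim hsm
  exact ⟨h.isUniversallyClosed, fun _ hd => h.isFiniteEtaleOfDegree hd⟩
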